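/- For $\nu\ge 0$ let $J_\nu$ and $Y_\nu$ be the Bessel functions of order $\nu$ of the first and second kinds, and let $N_\nu=J_\nu^2+Y_\nu^2$. Fix $b>1$ and define $$U_\nu(\rho,t)=J_\nu(\rho t)Y_\nu(\rho b)-J_\nu(\rho b)Y_\nu(\rho t)\qquad(\rho>0,\ t>0).$$ For each $\nu\ge0$ the positive zeros of $\rho\mapsto U_\nu(\rho,1)$ form an infinite strictly increasing sequence $(\rho_{\nu,m})_{m\ge1}$, and the following hold. (i) If $\nu\ge\frac12$, then $\rho_{\nu,m}>\frac1b\left(\nu+\frac m4\right)$ for all $m\ge1$. Also, for any $\nu\ge0$, $\dfrac{\rho_{\nu,m}}{m}\to\dfrac{\pi}{b-1}$ as $m\to\infty$. (ii) If $\nu\ge0$, $m\ge1$ and $U_\nu(\rho_{\nu,m},a)=0$, where $0<a\le b$, then $$\left\{\frac{\partial U_\nu}{\partial t}(\rho_{\nu,m},a)\right\}^2=\frac{4}{\pi^2a^2}\,\frac{N_\nu(\rho_{\nu,m}b)}{N_\nu(\rho_{\nu,m}a)}\le\frac{4}{\pi^2a^2}.$$ (iii) If $\nu\ge0$, $m\ge1$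 and $U_\nu(\rho_{\nu,m},a)=0$, where $0<a<b$, then $$\rho_{\nu,m}^2\int_a^b\{U_\nu(\rho_{\nu,m},t)\}^2\,t\,dt=\frac{2}{\pi^2}\left(1-\frac{N_\nu(\rho_{\nu,m}b)}{N_\nu(\rho_{\nu,m}a)}\right)\le\frac{2}{\pi^2}.$$ (iv) If $\nu\ge\frac12$, then $$\rho_{\nu,m}^2\int_1^b\{U_\nu(\rho_{\nu,m},t)\}^2\,t\,dt\ge\frac{2}{\pi^2}\,\frac{b-1}{b}\qquad(m\ge1).$$ Also, $$\rho_{0,m}^2\int_1^b\{U_0(\rho_{0,m},t)\}^2\,t\,dt\ge\frac{2}{\pi^2}\left(1-\frac{N_0(\rho_{0,1}b)}{N_0(\rho_{0,1})}\right)\qquad(m\ge1).$$ (v) If $\nu>0$, $m\ge1$ and $a$ is the least positive zero of $U_\nu(\rho_{\nu,m},\cdot)$, then $$|U_\nu(\rho_{\nu,m},t)|\le\frac{t^{-\nu}}{\pi\nu}\qquad(0<t<a).$$ -/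

import Mathlib

open Filter Topology

/-- The Bessel function of the first kind `J_ν(x)` of real order `ν`, for `x > 0`, by its series
`∑ (-1)^k / (k! Γ(ν + k + 1)) (x / 2)^(ν + 2k)`.  At the poles of `Γ` the coefficient is `0`
(the value of the entire function `1 / Γ` there): `Real.Gamma` is `0` there and `0⁻¹ = 0`. -/
noncomputable def besselJ (ν x : ℝ) : ℝ :=
  (x / 2) ^ ν *
    ∑' k : ℕ, (-1 : ℝ) ^ k * ((k.factorial : ℝ) * Real.Gamma (ν + k + 1))⁻¹ * (x / 2) ^ (2 * k)

/-- The quotient `(J_ν(x) cos νπ - J_{-ν}(x)) / sin νπ`, meaningful for non-integer `ν`. -/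
noncomputable def besselYQuot (ν x : ℝ) : ℝ :=
  (besselJ ν x * Real.cos (ν * Real.pi) - besselJ (-ν) x) / Real.sin (ν * Real.pi)

open Classical in
/-- The Bessel function of the second kind `Y_ν(x)` of real order `ν`, for `x > 0`: the quotient
above for non-integer `ν`, and its limit in the order at integers. -/
noncomputable def besselY (ν x : ℝ) : ℝ :=
  if ∃ n : ℤ, (n : ℝ) = ν then limUnder (𝓝[≠] ν) (fun μ => besselYQuot μ x)
  else besselYQuot ν x

/-- `N_ν = J_ν² + Y_ν²`. -/
noncomputable def besselN (ν x : ℝ) : ℝ := besselJ ν x ^ 2 + besselY ν x ^ 2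

/-- The cross product `U_ν(ρ, t) = J_ν(ρt) Y_ν(ρb) - J_ν(ρb) Y_ν(ρt)`. -/
noncomputable def besselU (b ν ρ t : ℝ) : ℝ :=
  besselJ ν (ρ * t) * besselY ν (ρ * b) - besselJ ν (ρ * b) * besselY ν (ρ * t)

/-- For `m ≥ 1`, the `m`-th positive zero `ρ_{ν,m}` of `ρ ↦ U_ν(ρ, 1)`: each term is the least
zero beyond the previous one, starting from the dummy value `0` at index `0`. -/
noncomputable def besselRho (b ν : ℝ) : ℕ → ℝ
  | 0 => 0
  | m + 1 => sInf {ρ : ℝ | besselRho b ν m < ρ ∧ besselU b ν ρ 1 = 0}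

/-! Write H = J_ν + iY_ν = √N_ν e^{iθ}. The Wronskian gives θ' = 2/(πxN_ν), so U_ν(ρ, t) is
√(N_ν(ρt) N_ν(ρb)) times the sine of θ(ρb) − θ(ρt) (`besselH_mul_conj`, `besselU_eq`). Zeros are
governed by the phase, and most of the estimates reduce to monotonicity properties of N_ν. These are
read off from Nicholson's formula N_ν(x) = (8/π²) ∫_0^∞ K_0(2x sinh t) cosh(2νt) dt
(`besselN_eq_nicholsonP`): N_ν decreases because K_0 does; x N_ν(x) is nonincreasing with limit 2/π
when ν ≥ 1/2 because cosh(2νt)/cosh t is nondecreasing; N_0(bx)/N_0(x) is nonincreasing by a total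
positivity argument.

Nicholson's formula is obtained without contour integrals. The integrals P_ν, R_ν, P_{ν+1} solve the
linear system satisfied by A², AB, B² whenever (A, B) solves the system of (J_ν, J_{ν+1}). An
invariant bilinear pairing of the two kinds of solution (`nicholsonForm`) is therefore constant in
x. For −1 < ν < 0 its constants are found from x → 0, from a quadratic identity whose discriminant
is found from x → ∞, and from continuity in ν, which fixes one sign. Solving for P_ν gives the
formula on (−1, 0); differentiating it in x raises the order by one, and a limit in the order
reaches the integers. That limit also yields the differential system and the Wronskian for Y_n.

The phase difference Φ(ρ) = θ(ρb) − θ(ρ) is strictly increasing since N_ν decreases. It is positive,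
is below π when ρb ≤ ν + 1 (`lt_of_pi_le_besselTheta_sub`, a Sturm comparison), and Φ(ρ)/ρ → b − 1;
hence the m-th zero is the solution of Φ = mπ. For ν ≥ 1/2 one has θ' ≤ 1, which turns the remaining
phase (m − 1)π into length. The derivative of U_ν at a zero comes from the Wronskian, and the
integral of tU_ν² from Lommel's explicit primitive evaluated at two zeros. The bound left of the
least zero follows by integrating the Bessel equation twice (`le_rpow_of_hasDerivAt_pair`). -/

/-! ### The entire function behind `J_ν` -/

/-- The series `∑ (-w)^k / (k! Γ(ν + k + 1))`. -/
noncomputable def besselE (ν w : ℝ) : ℝ :=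
  ∑' k : ℕ, (-1 : ℝ) ^ k * ((k.factorial : ℝ) * Real.Gamma (ν + k + 1))⁻¹ * w ^ k

theorem besselJ_eq (ν x : ℝ) : besselJ ν x = (x / 2) ^ ν * besselE ν ((x / 2) ^ 2) := by
  simp only [besselJ, besselE, pow_mul]

/-- Compactness handles the finitely many k ≤ n, where n ≥ R. Beyond them 1/Γ(s) = s/Γ(s + 1) with
|s| ≥ 1, so passing to the next k cannot increase the norm. Uniformity in complex ν is what makes
the series holomorphic in the order. -/
theorem exists_norm_Gamma_inv_le (R : ℝ) :
    ∃ M : ℝ, 0 ≤ M ∧ ∀ ν : ℂ, ‖ν‖ ≤ R → ∀ k : ℕ, ‖(Complex.Gamma (ν + k + 1))⁻¹‖ ≤ M := by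
  obtain ⟨n, hn⟩ := exists_nat_ge R
  have hfin : ∀ k : ℕ, ∃ M : ℝ, 0 ≤ M ∧ ∀ ν : ℂ, ‖ν‖ ≤ R →
      ‖(Complex.Gamma (ν + k + 1))⁻¹‖ ≤ M := by
    intro k
    have hc : Continuous fun ν : ℂ => (Complex.Gamma (ν + k + 1))⁻¹ :=
      Complex.differentiable_one_div_Gamma.continuous.comp (by fun_prop)
    obtain ⟨M, hM⟩ := (isCompact_closedBall (0 : ℂ) R).exists_bound_of_continuousOn hc.continuousOn
    refine ⟨max M 0, le_max_right _ _, fun ν hν => (hM ν ?_).trans (le_max_left _ _)⟩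
    simpa using hν
  choose M hM0 hM using hfin
  refine ⟨∑ k ∈ Finset.range (n + 1), M k, Finset.sum_nonneg fun k _ => hM0 k, ?_⟩
  intro ν hν k
  induction k with
  | zero =>
    exact (hM 0 ν hν).trans
      (Finset.single_le_sum (f := M) (fun k _ => hM0 k) (by simp))
  | succ k ih =>
    by_cases hk : k + 1 ≤ n
    · exact (hM (k + 1) ν hν).trans
        (Finset.single_le_sum (f := M) (fun k _ => hM0 k) (by simp; omega))
    · have hk' : (n : ℝ) ≤ k := by exact_mod_cast (by omega : n ≤ k)
      have h1 := Complex.one_div_Gamma_eq_self_mul_one_div_Gamma_add_one (ν + k + 1)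
      have h2 : 1 ≤ ‖ν + k + 1‖ := by
        have h3 : ‖((k : ℂ) + 1)‖ = k + 1 := by
          have : ((k : ℂ) + 1) = ((k + 1 : ℝ) : ℂ) := by push_cast; ring
          rw [this, Complex.norm_real, Real.norm_of_nonneg (by positivity)]
        have h4 : ‖(k : ℂ) + 1‖ - ‖-ν‖ ≤ ‖((k : ℂ) + 1) - (-ν)‖ := norm_sub_norm_le _ _
        rw [norm_neg, h3] at h4
        have h5 : (k : ℂ) + 1 - -ν = ν + k + 1 := by ring
        rw [h5] at h4
        linarith
      rw [h1, norm_mul] at ih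
      have h6 : ν + ((k + 1 : ℕ) : ℂ) + 1 = ν + k + 1 + 1 := by push_cast; ring
      rw [h6]
      exact (le_mul_of_one_le_left (norm_nonneg _) h2).trans ih

theorem exists_abs_Gamma_inv_le (ν : ℝ) :
    ∃ M : ℝ, 0 ≤ M ∧ ∀ k : ℕ, |(Real.Gamma (ν + k + 1))⁻¹| ≤ M := by
  obtain ⟨M, hM0, hM⟩ := exists_norm_Gamma_inv_le |ν|
  refine ⟨M, hM0, fun k => ?_⟩
  have h := hM ν (by simp) k
  have h2 : (ν : ℂ) + k + 1 = ((ν + k + 1 : ℝ) : ℂ) := by push_cast; ring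
  rw [h2, Complex.Gamma_ofReal, ← Complex.ofReal_inv, Complex.norm_real] at h
  exact h

theorem abs_besselE_term_le {M g : ℝ} (hg : |g⁻¹| ≤ M) (w : ℝ) (k : ℕ) :
    |(-1 : ℝ) ^ k * ((k.factorial : ℝ) * g)⁻¹ * w ^ k| ≤ M * (|w| ^ k / k.factorial) := by
  have h : (-1 : ℝ) ^ k * ((k.factorial : ℝ) * g)⁻¹ * w ^ k =
      (-1) ^ k * (g⁻¹ * (w ^ k / k.factorial)) := by rw [mul_inv]; ring
  rw [h, abs_mul, abs_mul, abs_div, abs_pow, abs_pow, abs_neg, abs_one, one_pow, one_mul,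
    Nat.abs_cast]
  gcongr

theorem summable_besselE (ν w : ℝ) : Summable fun k : ℕ =>
    (-1 : ℝ) ^ k * ((k.factorial : ℝ) * Real.Gamma (ν + k + 1))⁻¹ * w ^ k := by
  obtain ⟨M, -, hM⟩ := exists_abs_Gamma_inv_le ν
  exact Summable.of_norm_bounded ((Real.summable_pow_div_factorial |w|).mul_left M)
    fun k => abs_besselE_term_le (hM k) w k

theorem Gamma_inv_eq_mul (s : ℝ) : (Real.Gamma s)⁻¹ = s * (Real.Gamma (s + 1))⁻¹ := by
  have h := Complex.one_div_Gamma_eq_self_mul_one_div_Gamma_add_one (s : ℂ)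
  have h2 : (s : ℂ) + 1 = ((s + 1 : ℝ) : ℂ) := by push_cast; ring
  rw [h2, Complex.Gamma_ofReal, Complex.Gamma_ofReal] at h
  exact_mod_cast h

theorem hasDerivAt_besselE (ν w : ℝ) : HasDerivAt (besselE ν) (-besselE (ν + 1) w) w := by
  obtain ⟨M, hM0, hM⟩ := exists_abs_Gamma_inv_le ν
  set R : ℝ := |w| + 1
  have hR : (0 : ℝ) ≤ R := by positivity
  let c : ℕ → ℝ := fun k => (-1 : ℝ) ^ k * ((k.factorial : ℝ) * Real.Gamma (ν + k + 1))⁻¹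
  -- At k = 0 the truncated subtraction gives the bound M, harmless because the differentiated term
  -- carries a factor k.
  have hs : Summable fun k : ℕ => M * (R ^ (k - 1) / (k - 1).factorial) := by
    refine (summable_nat_add_iff 1).1 ?_
    simpa using (Real.summable_pow_div_factorial R).mul_left M
  have hsucc : ∀ (k : ℕ) (y : ℝ), c (k + 1) * (((k + 1 : ℕ) : ℝ) * y ^ k) =
      -((-1 : ℝ) ^ k * ((k.factorial : ℝ) * Real.Gamma (ν + 1 + k + 1))⁻¹ * y ^ k) := by
    intro k y
    have h1 : ν + ((k + 1 : ℕ) : ℝ) + 1 = ν + 1 + k + 1 := by push_cast; ring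
    have h2 : ((k + 1 : ℕ) : ℝ) ≠ 0 := by positivity
    simp only [c, h1, Nat.factorial_succ, Nat.cast_mul, mul_inv, pow_succ]
    field_simp
  have hd : ∀ (k : ℕ) (y : ℝ), y ∈ Metric.ball (0 : ℝ) R →
      ‖c k * ((k : ℝ) * y ^ (k - 1))‖ ≤ M * (R ^ (k - 1) / (k - 1).factorial) := by
    intro k y hy
    have hy' : |y| ≤ R := by simpa using (Metric.mem_ball.1 hy).le
    cases k with
    | zero => simp; positivity
    | succ k =>
      have h3 := hM (k + 1)
      rw [show ν + ((k + 1 : ℕ) : ℝ) + 1 = ν + 1 + k + 1 by push_cast; ring] at h3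
      simp only [Nat.add_sub_cancel]
      rw [hsucc, norm_neg]
      refine (abs_besselE_term_le h3 y k).trans ?_
      gcongr
  have hmem : w ∈ Metric.ball (0 : ℝ) R := by simp [R]
  have key := hasDerivAt_tsum_of_isPreconnected hs Metric.isOpen_ball
    (convex_ball (0 : ℝ) R).isPreconnected (g := fun k y => c k * y ^ k)
    (fun k y _ => (hasDerivAt_pow k y).const_mul (c k)) hd hmem (summable_besselE ν w) hmem
  refine key.congr_deriv ?_
  rw [(Summable.of_norm_bounded hs fun k => hd k w hmem).tsum_eq_zero_add]
  simp only [Nat.cast_zero, zero_mul, mul_zero, zero_add, Nat.add_sub_cancel, hsucc]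
  rw [tsum_neg, besselE]

theorem continuous_besselE (ν : ℝ) : Continuous (besselE ν) :=
  continuous_iff_continuousAt.2 fun w => (hasDerivAt_besselE ν w).continuousAt

theorem besselE_zero (ν : ℝ) : besselE ν 0 = (Real.Gamma (ν + 1))⁻¹ := by
  rw [besselE, tsum_eq_single 0]
  · simp
  · intro k hk; simp [hk]

theorem besselE_contiguous (ν w : ℝ) :
    besselE ν w = (ν + 1) * besselE (ν + 1) w - w * besselE (ν + 2) w := by
  have hs1 := (summable_besselE (ν + 1) w).mul_left (ν + 1)
  have hs0 := summable_besselE ν w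
  have hterm : ∀ k : ℕ, (-1 : ℝ) ^ k * ((k.factorial : ℝ) * Real.Gamma (ν + k + 1))⁻¹ * w ^ k -
      (ν + 1) * ((-1 : ℝ) ^ k * ((k.factorial : ℝ) * Real.Gamma (ν + 1 + k + 1))⁻¹ * w ^ k) =
      k * ((-1 : ℝ) ^ k * ((k.factorial : ℝ) * Real.Gamma (ν + 1 + k + 1))⁻¹ * w ^ k) := by
    intro k
    have h := Gamma_inv_eq_mul (ν + k + 1)
    rw [show ν + (k : ℝ) + 1 + 1 = ν + 1 + k + 1 by ring] at h
    rw [mul_inv, mul_inv, h]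
    ring
  have hsub := hs0.sub hs1
  have h1 : besselE ν w - (ν + 1) * besselE (ν + 1) w = -(w * besselE (ν + 2) w) := by
    rw [besselE, besselE, ← tsum_mul_left, ← hs0.tsum_sub hs1, hsub.tsum_eq_zero_add]
    simp only [hterm]
    rw [besselE, ← tsum_mul_left, ← tsum_neg]
    simp only [Nat.cast_zero, zero_mul, zero_add]
    refine tsum_congr fun k => ?_
    have h2 : ν + 1 + ((k + 1 : ℕ) : ℝ) + 1 = ν + 2 + k + 1 := by push_cast; ring
    have h3 : ((k + 1 : ℕ) : ℝ) ≠ 0 := by positivity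
    rw [h2, Nat.factorial_succ, Nat.cast_mul, mul_inv, mul_inv, mul_inv, pow_succ, pow_succ]
    field_simp
  linarith

/-- Going through complex orders avoids differentiating 1/Γ termwise: a normally convergent series
of holomorphic functions is holomorphic, and its real restriction is differentiable. -/
theorem differentiable_besselE_order (w : ℝ) : Differentiable ℝ fun ν => besselE ν w := by
  intro ν
  let F : ℕ → ℂ → ℂ := fun k z =>
    (-1 : ℂ) ^ k * ((k.factorial : ℂ))⁻¹ * (Complex.Gamma (z + k + 1))⁻¹ * (w : ℂ) ^ k
  obtain ⟨M, hM0, hM⟩ := exists_norm_Gamma_inv_le (|ν| + 1)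
  have hdiff : DifferentiableOn ℂ (fun z => ∑' k, F k z) (Metric.ball 0 (|ν| + 1)) := by
    refine Complex.differentiableOn_tsum_of_summable_norm
      ((Real.summable_pow_div_factorial |w|).mul_left M) (fun k => ?_) Metric.isOpen_ball ?_
    · refine Differentiable.differentiableOn ?_
      have h : Differentiable ℂ fun z : ℂ => (Complex.Gamma (z + k + 1))⁻¹ :=
        Complex.differentiable_one_div_Gamma.comp (by fun_prop)
      exact (h.const_mul _).mul_const _
    · intro k z hz
      have h := hM z (by simpa using (Metric.mem_ball.1 hz).le) k
      simp only [F, norm_mul, norm_pow, norm_neg, norm_one, one_pow, one_mul, norm_inv,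
        Complex.norm_real, Real.norm_eq_abs, Complex.norm_natCast] at h ⊢
      calc _ = ‖Complex.Gamma (z + k + 1)‖⁻¹ * (|w| ^ k / k.factorial) := by ring
        _ ≤ _ := by gcongr
  have h1 : DifferentiableAt ℂ (fun z => ∑' k, F k z) (ν : ℂ) :=
    hdiff.differentiableAt (Metric.isOpen_ball.mem_nhds (by simp))
  have h2 := h1.hasDerivAt.real_of_complex
  refine h2.differentiableAt.congr_of_eventuallyEq (Eventually.of_forall fun μ => ?_)
  have h3 : ∀ k, F k μ = (((-1 : ℝ) ^ k *
      ((k.factorial : ℝ) * Real.Gamma (μ + k + 1))⁻¹ * w ^ k : ℝ) : ℂ) := by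
    intro k
    have h4 : (μ : ℂ) + k + 1 = ((μ + k + 1 : ℝ) : ℂ) := by push_cast; ring
    simp only [F, h4, Complex.Gamma_ofReal]
    push_cast
    rw [mul_inv]; ring
  simp only [h3, ← Complex.ofReal_tsum, Complex.ofReal_re, besselE]

theorem differentiable_besselJ_order {x : ℝ} (hx : 0 < x) :
    Differentiable ℝ fun ν => besselJ ν x := by
  simp only [besselJ_eq]
  intro ν
  refine DifferentiableAt.mul ?_ (differentiable_besselE_order _ ν)
  exact ((hasDerivAt_id ν).const_rpow (by positivity : 0 < x / 2)).differentiableAt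

/-! ### The first order system satisfied by pairs of contiguous Bessel functions -/

/-- `(A, B)` solves the first order system of `(J_ν, J_{ν+1})` on `(0, ∞)`. -/
def IsBesselPair (ν : ℝ) (A B : ℝ → ℝ) : Prop :=
  ∀ x, 0 < x → HasDerivAt A (ν / x * A x - B x) x ∧ HasDerivAt B (A x - (ν + 1) / x * B x) x

theorem hasDerivAt_besselE_sq (ν x : ℝ) :
    HasDerivAt (fun x => besselE ν ((x / 2) ^ 2)) (-(x / 2) * besselE (ν + 1) ((x / 2) ^ 2)) x := by
  have h : HasDerivAt (fun x : ℝ => (x / 2) ^ 2) (x / 2) x := by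
    refine (((hasDerivAt_id x).div_const 2).pow 2).congr_deriv ?_
    simp
    ring
  refine ((hasDerivAt_besselE ν _).comp x h).congr_deriv ?_
  ring

theorem hasDerivAt_besselJ (ν : ℝ) {x : ℝ} (hx : 0 < x) :
    HasDerivAt (besselJ ν) (ν / x * besselJ ν x - besselJ (ν + 1) x) x := by
  have hx2 : 0 < x / 2 := by positivity
  have h1 : HasDerivAt (fun x : ℝ => (x / 2) ^ ν) (ν / x * (x / 2) ^ ν) x := by
    refine (((hasDerivAt_id x).div_const 2).rpow_const (p := ν) (Or.inl hx2.ne')).congr_deriv ?_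
    simp only [id]
    rw [Real.rpow_sub_one hx2.ne']
    field_simp
  rw [show besselJ ν = fun x => (x / 2) ^ ν * besselE ν ((x / 2) ^ 2) from
    funext fun x => besselJ_eq ν x]
  refine (h1.mul (hasDerivAt_besselE_sq ν x)).congr_deriv ?_
  rw [besselJ_eq, Real.rpow_add_one hx2.ne']
  ring

theorem besselJ_three_term (ν : ℝ) {x : ℝ} (hx : 0 < x) :
    besselJ ν x + besselJ (ν + 2) x = 2 * (ν + 1) / x * besselJ (ν + 1) x := by
  have hx2 : 0 < x / 2 := by positivity
  rw [besselJ_eq, besselJ_eq, besselJ_eq, besselE_contiguous ν, show ν + 2 = ν + 1 + 1 by ring,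
    Real.rpow_add_one hx2.ne', Real.rpow_add_one hx2.ne']
  field_simp
  ring

theorem isBesselPair_besselJ (ν : ℝ) : IsBesselPair ν (besselJ ν) (besselJ (ν + 1)) := by
  intro x hx
  refine ⟨hasDerivAt_besselJ ν hx, (hasDerivAt_besselJ (ν + 1) hx).congr_deriv ?_⟩
  have h := besselJ_three_term ν hx
  rw [show ν + 1 + 1 = ν + 2 by ring, eq_sub_of_add_eq h]
  ring

/-- With this sign the companion makes J_{−ν} a solution of the system of order ν, not −ν. The pair
for Y_ν is then a combination of two solutions of one system with coefficients constant in x. -/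
theorem isBesselPair_besselJ_neg (ν : ℝ) :
    IsBesselPair ν (besselJ (-ν)) (fun x => -besselJ (-ν - 1) x) := by
  intro x hx
  have h := besselJ_three_term (-ν - 1) hx
  rw [show -ν - 1 + 2 = -ν + 1 by ring, show -ν - 1 + 1 = -ν by ring] at h
  refine ⟨(hasDerivAt_besselJ (-ν) hx).congr_deriv ?_,
    (hasDerivAt_besselJ (-ν - 1) hx).neg.congr_deriv ?_⟩
  · rw [eq_sub_of_add_eq' h]; ring
  · rw [show -ν - 1 + 1 = -ν by ring]; ring

theorem IsBesselPair.smul_add {ν : ℝ} {A B A' B' : ℝ → ℝ} (h : IsBesselPair ν A B)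
    (h' : IsBesselPair ν A' B') (p q : ℝ) :
    IsBesselPair ν (fun x => p * A x + q * A' x) (fun x => p * B x + q * B' x) := by
  intro x hx
  refine ⟨(((h x hx).1.const_mul p).add ((h' x hx).1.const_mul q)).congr_deriv ?_,
    (((h x hx).2.const_mul p).add ((h' x hx).2.const_mul q)).congr_deriv ?_⟩ <;> ring

theorem eq_of_hasDerivAt_zero_pos {f : ℝ → ℝ} (hf : ∀ x, 0 < x → HasDerivAt f 0 x) {x y : ℝ}
    (hx : 0 < x) (hy : 0 < y) : f x = f y :=
  (convex_Ioi (0 : ℝ)).is_const_of_fderivWithin_eq_zero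
    (fun z hz => (hf z hz).differentiableAt.differentiableWithinAt)
    (fun z hz => by
      have h := ((hf z hz).hasDerivWithinAt (s := Set.Ioi 0)).hasFDerivWithinAt.fderivWithin
        (isOpen_Ioi.uniqueDiffWithinAt hz)
      rw [h]; ext; simp) hx hy

theorem eq_of_tendsto_of_hasDerivAt_zero {f : ℝ → ℝ} {c : ℝ} {l : Filter ℝ} [l.NeBot]
    (hl : ∀ᶠ x in l, 0 < x) (hf : ∀ x, 0 < x → HasDerivAt f 0 x) (hc : Tendsto f l (𝓝 c)) {x : ℝ}
    (hx : 0 < x) : f x = c := by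
  refine tendsto_nhds_unique (Tendsto.congr' ?_ tendsto_const_nhds) hc
  filter_upwards [hl] with y hy
  exact eq_of_hasDerivAt_zero_pos hf hx hy

/-- The Wronskian `x (A B' - B A')` of two pairs. -/
theorem IsBesselPair.hasDerivAt_wronskian {ν : ℝ} {A B A' B' : ℝ → ℝ} (h : IsBesselPair ν A B)
    (h' : IsBesselPair ν A' B') {x : ℝ} (hx : 0 < x) :
    HasDerivAt (fun x => x * (A x * B' x - B x * A' x)) 0 x := by
  obtain ⟨h1, h2⟩ := h x hx
  obtain ⟨h3, h4⟩ := h' x hx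
  refine ((hasDerivAt_id x).mul ((h1.mul h4).sub (h2.mul h3))).congr_deriv ?_
  simp only [id, Pi.sub_apply, Pi.mul_apply]
  field_simp
  ring

theorem sin_mul_pi_ne_zero {ν : ℝ} (hν : ¬∃ n : ℤ, (n : ℝ) = ν) : Real.sin (ν * Real.pi) ≠ 0 := by
  intro h
  obtain ⟨n, hn⟩ := Real.sin_eq_zero_iff.1 h
  exact hν ⟨n, mul_right_cancel₀ Real.pi_ne_zero hn⟩

theorem Gamma_inv_mul_Gamma_inv (s : ℝ) :
    (Real.Gamma s)⁻¹ * (Real.Gamma (1 - s))⁻¹ = Real.sin (s * Real.pi) / Real.pi := by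
  rw [← mul_inv, Real.Gamma_mul_Gamma_one_sub, inv_div, mul_comm s]

/-- The expression is constant, so it equals its limit at 0. There the powers of x/2 cancel, only
the product of 1/Γ(ν + 1) and 1/Γ(−ν) survives, and the reflection formula evaluates it. -/
theorem wronskian_besselJ_neg (ν : ℝ) {x : ℝ} (hx : 0 < x) :
    x * (besselJ ν x * -besselJ (-ν - 1) x - besselJ (ν + 1) x * besselJ (-ν) x) =
      2 * Real.sin (ν * Real.pi) / Real.pi := by
  refine eq_of_tendsto_of_hasDerivAt_zero (l := 𝓝[>] 0) self_mem_nhdsWithin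
    (fun x hx => (isBesselPair_besselJ ν).hasDerivAt_wronskian (isBesselPair_besselJ_neg ν) hx)
    ?_ hx
  have hlim : Tendsto (fun x : ℝ => -2 * (besselE ν ((x / 2) ^ 2) * besselE (-ν - 1) ((x / 2) ^ 2))
      - x ^ 2 / 2 * (besselE (ν + 1) ((x / 2) ^ 2) * besselE (-ν) ((x / 2) ^ 2)))
      (𝓝 0) (𝓝 (2 * Real.sin (ν * Real.pi) / Real.pi)) := by
    have hc : Continuous (fun x : ℝ =>
        -2 * (besselE ν ((x / 2) ^ 2) * besselE (-ν - 1) ((x / 2) ^ 2))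
        - x ^ 2 / 2 * (besselE (ν + 1) ((x / 2) ^ 2) * besselE (-ν) ((x / 2) ^ 2))) := by
      have := continuous_besselE ν
      have := continuous_besselE (-ν - 1)
      have := continuous_besselE (ν + 1)
      have := continuous_besselE (-ν)
      fun_prop
    refine (hc.tendsto 0).mono_right (le_of_eq ?_)
    have h := Gamma_inv_mul_Gamma_inv (ν + 1)
    rw [add_mul, one_mul, Real.sin_add_pi, show 1 - (ν + 1) = -ν by ring] at h
    congr 1
    norm_num [besselE_zero]
    rw [← mul_inv, mul_inv, h]
    ring
  refine (hlim.mono_left nhdsWithin_le_nhds).congr' ?_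
  filter_upwards [self_mem_nhdsWithin] with x hx
  have hx2 : 0 < x / 2 := half_pos hx
  rw [besselJ_eq, besselJ_eq, besselJ_eq, besselJ_eq, Real.rpow_sub_one hx2.ne',
    Real.rpow_add_one hx2.ne', Real.rpow_neg hx2.le]
  have := (Real.rpow_pos_of_pos hx2 ν).ne'
  have hx0 : x ≠ 0 := (Set.mem_Ioi.1 hx).ne'
  field_simp

/-! ### `Y_ν` of non-integer order -/

theorem besselY_of_not_int {ν : ℝ} (hν : ¬∃ n : ℤ, (n : ℝ) = ν) (x : ℝ) :
    besselY ν x = (besselJ ν x * Real.cos (ν * Real.pi) - besselJ (-ν) x) /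
      Real.sin (ν * Real.pi) := by
  rw [besselY, if_neg hν, besselYQuot]

theorem not_int_add_one {ν : ℝ} (hν : ¬∃ n : ℤ, (n : ℝ) = ν) : ¬∃ n : ℤ, (n : ℝ) = ν + 1 := by
  rintro ⟨n, hn⟩
  exact hν ⟨n - 1, by push_cast; linarith⟩

theorem besselY_add_one_of_not_int {ν : ℝ} (hν : ¬∃ n : ℤ, (n : ℝ) = ν) (x : ℝ) :
    besselY (ν + 1) x = (besselJ (ν + 1) x * Real.cos (ν * Real.pi) + besselJ (-ν - 1) x) /
      Real.sin (ν * Real.pi) := by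
  rw [besselY_of_not_int (not_int_add_one hν), add_mul, one_mul, Real.sin_add_pi,
    Real.cos_add_pi, show -(ν + 1) = -ν - 1 by ring, div_neg, ← neg_div]
  ring

theorem isBesselPair_besselY_of_not_int {ν : ℝ} (hν : ¬∃ n : ℤ, (n : ℝ) = ν) :
    IsBesselPair ν (besselY ν) (besselY (ν + 1)) := by
  have h := (isBesselPair_besselJ ν).smul_add (isBesselPair_besselJ_neg ν)
    (Real.cos (ν * Real.pi) / Real.sin (ν * Real.pi)) (-1 / Real.sin (ν * Real.pi))
  convert h using 1
  · ext x; rw [besselY_of_not_int hν]; ring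
  · ext x; rw [besselY_add_one_of_not_int hν]; ring

theorem wronskian_of_not_int {ν : ℝ} (hν : ¬∃ n : ℤ, (n : ℝ) = ν) {x : ℝ} (hx : 0 < x) :
    x * (besselJ (ν + 1) x * besselY ν x - besselJ ν x * besselY (ν + 1) x) = 2 / Real.pi := by
  have hs := sin_mul_pi_ne_zero hν
  have h := wronskian_besselJ_neg ν hx
  rw [besselY_of_not_int hν, besselY_add_one_of_not_int hν]
  have h3 := Real.pi_ne_zero
  field_simp at h ⊢
  linarith

/-! ### The modified Bessel functions `K_0` and `K_1` -/

/-- `K_0(z) = ∫_0^∞ exp(-z cosh t) dt`. -/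
noncomputable def besselK0 (z : ℝ) : ℝ :=
  ∫ t in Set.Ioi (0 : ℝ), Real.exp (-z * Real.cosh t)

/-- `K_1(z) = ∫_0^∞ cosh t exp(-z cosh t) dt`. -/
noncomputable def besselK1 (z : ℝ) : ℝ :=
  ∫ t in Set.Ioi (0 : ℝ), Real.cosh t * Real.exp (-z * Real.cosh t)

theorem exp_le_two_mul_cosh (t : ℝ) : Real.exp t ≤ 2 * Real.cosh t := by
  rw [Real.cosh_eq]; linarith [Real.exp_pos (-t)]

/-- A single term of the series of exp(z cosh t), of degree n + 1, absorbs the power and leaves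
1/cosh t ≤ 2e^{−t}. -/
theorem cosh_pow_mul_exp_le {z : ℝ} (hz : 0 < z) (n : ℕ) (t : ℝ) :
    Real.cosh t ^ n * Real.exp (-z * Real.cosh t) ≤
      (2 * (n + 1).factorial / z ^ (n + 1)) * Real.exp (-t) := by
  have hc := Real.cosh_pos t
  have h1 := Real.pow_div_factorial_le_exp (x := z * Real.cosh t) (by positivity) (n + 1)
  have h2 : Real.exp (-t) ≥ 1 / (2 * Real.cosh t) := by
    rw [Real.exp_neg, ← one_div]
    exact one_div_le_one_div_of_le (Real.exp_pos t) (exp_le_two_mul_cosh t)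
  rw [neg_mul, Real.exp_neg]
  have h3 : (Real.exp (z * Real.cosh t))⁻¹ ≤ ((z * Real.cosh t) ^ (n + 1) / (n + 1).factorial)⁻¹ :=
    inv_anti₀ (by positivity) h1
  calc _ ≤ Real.cosh t ^ n * ((z * Real.cosh t) ^ (n + 1) / (n + 1).factorial)⁻¹ := by gcongr
    _ = (2 * (n + 1).factorial / z ^ (n + 1)) * (1 / (2 * Real.cosh t)) := by
      rw [mul_pow, pow_succ (Real.cosh t)]; field_simp
    _ ≤ _ := by gcongr

theorem integrableOn_cosh_pow_mul_exp {z : ℝ} (hz : 0 < z) (n : ℕ) :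
    MeasureTheory.IntegrableOn (fun t => Real.cosh t ^ n * Real.exp (-z * Real.cosh t))
      (Set.Ioi 0) := by
  have h : MeasureTheory.IntegrableOn (fun t : ℝ => Real.exp (-t)) (Set.Ioi 0) := by
    simpa using exp_neg_integrableOn_Ioi 0 one_pos
  refine MeasureTheory.Integrable.mono' (h.const_mul (2 * (n + 1).factorial / z ^ (n + 1)))
    (by fun_prop) (Eventually.of_forall fun t => ?_)
  rw [Real.norm_of_nonneg (by have := Real.cosh_pos t; positivity)]
  exact cosh_pow_mul_exp_le hz n t

theorem hasDerivAt_integral_cosh_pow_mul_exp {z : ℝ} (hz : 0 < z) (n : ℕ) :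
    HasDerivAt (fun z => ∫ t in Set.Ioi (0 : ℝ), Real.cosh t ^ n * Real.exp (-z * Real.cosh t))
      (-∫ t in Set.Ioi (0 : ℝ), Real.cosh t ^ (n + 1) * Real.exp (-z * Real.cosh t)) z := by
  have h := (hasDerivAt_integral_of_dominated_loc_of_deriv_le
    (μ := MeasureTheory.volume.restrict (Set.Ioi (0 : ℝ))) (s := Set.Ioi (z / 2)) (x₀ := z)
    (F := fun z t => Real.cosh t ^ n * Real.exp (-z * Real.cosh t))
    (F' := fun z t => -(Real.cosh t ^ (n + 1) * Real.exp (-z * Real.cosh t)))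
    (bound := fun t => Real.cosh t ^ (n + 1) * Real.exp (-(z / 2) * Real.cosh t))
    (Ioi_mem_nhds (by linarith))
    (Eventually.of_forall fun z => by fun_prop) (integrableOn_cosh_pow_mul_exp hz n)
    (by fun_prop) (Eventually.of_forall fun t y hy => ?_)
    (integrableOn_cosh_pow_mul_exp (by linarith) (n + 1))
    (Eventually.of_forall fun t y _ => ?_)).2
  · rwa [MeasureTheory.integral_neg] at h
  · have hc := Real.cosh_pos t
    have hy' : z / 2 ≤ y := le_of_lt hy
    rw [norm_neg, Real.norm_of_nonneg (by positivity)]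
    gcongr
  · refine ((((hasDerivAt_id y).neg.mul_const (Real.cosh t)).exp).const_mul _).congr_deriv ?_
    simp only [Pi.neg_apply, id]
    ring

theorem hasDerivAt_besselK0 {z : ℝ} (hz : 0 < z) : HasDerivAt besselK0 (-besselK1 z) z := by
  have h := hasDerivAt_integral_cosh_pow_mul_exp hz 0
  simp only [pow_zero, one_mul, zero_add, pow_one] at h
  exact h

/-- Integrate the derivative of sinh t · exp(−z cosh t), which vanishes at both ends, and use sinh²
= cosh² − 1. This is the Bessel equation for K_0 in disguise. -/
theorem integral_cosh_sq_mul_exp {z : ℝ} (hz : 0 < z) :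
    ∫ t in Set.Ioi (0 : ℝ), Real.cosh t ^ 2 * Real.exp (-z * Real.cosh t) =
      besselK0 z + besselK1 z / z := by
  have i0 := integrableOn_cosh_pow_mul_exp hz 0
  have i1 := integrableOn_cosh_pow_mul_exp hz 1
  have i2 := integrableOn_cosh_pow_mul_exp hz 2
  simp only [pow_zero, one_mul, pow_one] at i0 i1
  have i20 : MeasureTheory.IntegrableOn (fun t => Real.cosh t ^ 2 * Real.exp (-z * Real.cosh t) -
      Real.exp (-z * Real.cosh t)) (Set.Ioi 0) := i2.sub i0
  have hd : ∀ t ∈ Set.Ici (0 : ℝ), HasDerivAt (fun t => Real.sinh t * Real.exp (-z * Real.cosh t))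
      (Real.cosh t * Real.exp (-z * Real.cosh t) -
        z * (Real.cosh t ^ 2 * Real.exp (-z * Real.cosh t) - Real.exp (-z * Real.cosh t))) t := by
    intro t _
    refine ((Real.hasDerivAt_sinh t).mul
      ((Real.hasDerivAt_cosh t).const_mul (-z)).exp).congr_deriv ?_
    have h := Real.cosh_sq t
    linear_combination z * Real.exp (-z * Real.cosh t) * h
  have htend : Tendsto (fun t => Real.sinh t * Real.exp (-z * Real.cosh t)) atTop (𝓝 0) := by
    have h0 : Tendsto (fun t : ℝ => (2 * (1 + 1).factorial / z ^ (1 + 1)) * Real.exp (-t)) atTop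
        (𝓝 0) := by
      simpa using (Real.tendsto_exp_neg_atTop_nhds_zero).const_mul _
    refine squeeze_zero_norm' ?_ h0
    filter_upwards [eventually_ge_atTop 0] with t ht
    have h1 := cosh_pow_mul_exp_le hz 1 t
    rw [pow_one] at h1
    rw [Real.norm_of_nonneg (mul_nonneg (Real.sinh_nonneg_iff.2 ht) (Real.exp_pos _).le)]
    refine le_trans ?_ h1
    gcongr
    exact (Real.sinh_lt_cosh t).le
  have hint := MeasureTheory.integral_Ioi_of_hasDerivAt_of_tendsto' hd
    (i1.sub (i20.const_mul z)) htend
  rw [MeasureTheory.integral_sub i1 (i20.const_mul z), MeasureTheory.integral_const_mul,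
    MeasureTheory.integral_sub i2 i0] at hint
  simp only [Real.sinh_zero, zero_mul, sub_zero] at hint
  change besselK1 z - z * (_ - besselK0 z) = 0 at hint
  generalize (∫ t in Set.Ioi (0 : ℝ), Real.cosh t ^ 2 * Real.exp (-z * Real.cosh t)) = I at *
  field_simp
  linarith

theorem hasDerivAt_besselK1 {z : ℝ} (hz : 0 < z) :
    HasDerivAt besselK1 (-besselK0 z - besselK1 z / z) z := by
  have h := hasDerivAt_integral_cosh_pow_mul_exp hz 1
  simp only [pow_one, Nat.reduceAdd] at h
  rw [integral_cosh_sq_mul_exp hz] at h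
  exact h.congr_deriv (by ring)

theorem besselK0_pos {z : ℝ} (hz : 0 < z) : 0 < besselK0 z := by
  have h := integrableOn_cosh_pow_mul_exp hz 0
  simp only [pow_zero, one_mul] at h
  refine (MeasureTheory.setIntegral_pos_iff_support_of_nonneg_ae
    (Eventually.of_forall fun t => (Real.exp_pos _).le) h).2 ?_
  rw [Function.support_eq_univ fun t => (Real.exp_pos _).ne']
  simp

theorem besselK0_le_besselK1 {z : ℝ} (hz : 0 < z) : besselK0 z ≤ besselK1 z := by
  have h0 := integrableOn_cosh_pow_mul_exp hz 0
  have h1 := integrableOn_cosh_pow_mul_exp hz 1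
  simp only [pow_zero, one_mul, pow_one] at h0 h1
  refine MeasureTheory.integral_mono h0 h1 fun t => ?_
  exact le_mul_of_one_le_left (Real.exp_pos _).le (Real.one_le_cosh t)

theorem besselK1_pos {z : ℝ} (hz : 0 < z) : 0 < besselK1 z :=
  (besselK0_pos hz).trans_le (besselK0_le_besselK1 hz)

theorem strictAntiOn_besselK0 : StrictAntiOn besselK0 (Set.Ioi 0) := by
  refine strictAntiOn_of_deriv_neg (convex_Ioi 0)
    (fun z hz => (hasDerivAt_besselK0 hz).continuousAt.continuousWithinAt) fun z hz => ?_
  rw [interior_Ioi] at hz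
  rw [(hasDerivAt_besselK0 hz).deriv]
  linarith [besselK1_pos hz]

theorem continuousOn_besselK0 : ContinuousOn besselK0 (Set.Ioi 0) :=
  fun _ hz => (hasDerivAt_besselK0 hz).continuousAt.continuousWithinAt

theorem continuousOn_besselK1 : ContinuousOn besselK1 (Set.Ioi 0) :=
  fun _ hz => (hasDerivAt_besselK1 hz).continuousAt.continuousWithinAt

theorem exp_neg_le_rpow_neg {s η : ℝ} (hs : 0 < s) (hη : 0 ≤ η) (hη1 : η ≤ 1) :
    Real.exp (-s) ≤ s ^ (-η) := by
  rw [Real.exp_neg, Real.rpow_neg hs.le]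
  refine inv_anti₀ (Real.rpow_pos_of_pos hs _) ?_
  have h1 : s ^ η ≤ 1 + s := by
    rcases le_total s 1 with h | h
    · exact (Real.rpow_le_one hs.le h hη).trans (by linarith)
    · calc s ^ η ≤ s ^ (1 : ℝ) := Real.rpow_le_rpow_of_exponent_le h hη1
        _ ≤ 1 + s := by rw [Real.rpow_one]; linarith
  linarith [Real.add_one_le_exp s]

/-- One half of the exponent z cosh t supplies the decay e^{−z/2}; the other half, at least
(z/4)e^t, is traded for a power via e^{−s} ≤ s^{−η}, which leaves an integrable e^{−ηt}. The true
singularity is logarithmic, but any small power suffices. -/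
theorem besselK0_le {z η : ℝ} (hz : 0 < z) (hη : 0 < η) (hη1 : η ≤ 1) :
    besselK0 z ≤ 4 / η * (z ^ (-η) * Real.exp (-(z / 2))) := by
  have hint := integrableOn_cosh_pow_mul_exp hz 0
  simp only [pow_zero, one_mul] at hint
  have hint2 := (exp_neg_integrableOn_Ioi 0 hη).const_mul (Real.exp (-(z / 2)) * (z / 4) ^ (-η))
  have hval : ∫ t in Set.Ioi (0 : ℝ), Real.exp (-η * t) = 1 / η := by
    rw [integral_exp_mul_Ioi (by linarith) 0]
    simp
  have hle : besselK0 z ≤ Real.exp (-(z / 2)) * (z / 4) ^ (-η) * (1 / η) := by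
    rw [← hval, ← MeasureTheory.integral_const_mul, besselK0]
    refine MeasureTheory.integral_mono hint hint2 fun t => ?_
    have hc := Real.one_le_cosh t
    have h1 : z / 4 * Real.exp t ≤ z / 2 * Real.cosh t := by
      have := exp_le_two_mul_cosh t
      nlinarith
    calc Real.exp (-z * Real.cosh t)
        = Real.exp (-(z / 2 * Real.cosh t)) * Real.exp (-(z / 2 * Real.cosh t)) := by
          rw [← Real.exp_add]; ring_nf
      _ ≤ Real.exp (-(z / 2)) * Real.exp (-(z / 4 * Real.exp t)) := by
          gcongr; nlinarith
      _ ≤ Real.exp (-(z / 2)) * (z / 4 * Real.exp t) ^ (-η) := by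
          gcongr
          exact exp_neg_le_rpow_neg (by positivity) hη.le hη1
      _ = _ := by
          rw [Real.mul_rpow (by positivity) (Real.exp_pos t).le, ← Real.exp_mul]
          ring_nf
  refine hle.trans ?_
  have h4 : (4 : ℝ) ^ η ≤ 4 := by
    calc (4 : ℝ) ^ η ≤ 4 ^ (1 : ℝ) := Real.rpow_le_rpow_of_exponent_le (by norm_num) hη1
      _ = 4 := Real.rpow_one 4
  have h5 : (z / 4) ^ (-η) = z ^ (-η) * 4 ^ η := by
    rw [Real.div_rpow hz.le (by norm_num), Real.rpow_neg (by norm_num : (0 : ℝ) ≤ 4), div_inv_eq_mul]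
  rw [h5]
  calc _ = 4 ^ η / η * (z ^ (-η) * Real.exp (-(z / 2))) := by ring
    _ ≤ _ := by gcongr

/-- Split cosh t = sinh t + e^{−t}: the first part integrates exactly to e^{−z}/z and the second
contributes at most e^{−z}. -/
theorem besselK1_le {z : ℝ} (hz : 0 < z) : besselK1 z ≤ 2 / z * Real.exp (-(z / 2)) := by
  have h0 := integrableOn_cosh_pow_mul_exp hz 0
  have h1 := integrableOn_cosh_pow_mul_exp hz 1
  simp only [pow_zero, one_mul, pow_one] at h0 h1
  have hexp : MeasureTheory.IntegrableOn (fun t : ℝ => Real.exp (-t)) (Set.Ioi 0) := by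
    simpa using exp_neg_integrableOn_Ioi 0 one_pos
  have hd : ∀ t ∈ Set.Ici (0 : ℝ), HasDerivAt (fun t => -Real.exp (-z * Real.cosh t))
      (z * (Real.sinh t * Real.exp (-z * Real.cosh t))) t := by
    intro t _
    refine (((Real.hasDerivAt_cosh t).const_mul (-z)).exp.neg).congr_deriv ?_
    ring
  have hi : MeasureTheory.IntegrableOn (fun t => Real.sinh t * Real.exp (-z * Real.cosh t))
      (Set.Ioi 0) := by
    refine h1.mono' (by fun_prop) (Eventually.of_forall fun t => ?_)
    rw [norm_mul, Real.norm_of_nonneg (Real.exp_pos _).le, Real.norm_eq_abs]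
    gcongr
    exact abs_le.2 ⟨by rw [neg_le, ← Real.sinh_neg, ← Real.cosh_neg]; exact (Real.sinh_lt_cosh _).le,
      (Real.sinh_lt_cosh t).le⟩
  have htend : Tendsto (fun t => -Real.exp (-z * Real.cosh t)) atTop (𝓝 0) := by
    have h3 : Tendsto (fun t : ℝ => (2 * (0 + 1).factorial / z ^ (0 + 1)) * Real.exp (-t)) atTop
        (𝓝 0) := by
      simpa using (Real.tendsto_exp_neg_atTop_nhds_zero).const_mul _
    refine squeeze_zero_norm (fun t => ?_) h3
    rw [norm_neg, Real.norm_of_nonneg (Real.exp_pos _).le]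
    simpa using cosh_pow_mul_exp_le hz 0 t
  have hint := MeasureTheory.integral_Ioi_of_hasDerivAt_of_tendsto' hd (hi.const_mul z) htend
  rw [MeasureTheory.integral_const_mul] at hint
  simp only [Real.cosh_zero, mul_one, zero_sub, neg_neg] at hint
  have hle : besselK1 z ≤ (∫ t in Set.Ioi (0 : ℝ), Real.sinh t * Real.exp (-z * Real.cosh t)) +
      Real.exp (-z) * ∫ t in Set.Ioi (0 : ℝ), Real.exp (-t) := by
    rw [← MeasureTheory.integral_const_mul,
      ← MeasureTheory.integral_add hi (hexp.const_mul _), besselK1]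
    refine MeasureTheory.integral_mono h1 (hi.add (hexp.const_mul _)) fun t => ?_
    have h4 : Real.cosh t = Real.sinh t + Real.exp (-t) := by
      rw [← Real.cosh_sub_sinh]; ring
    have h5 : Real.exp (-z * Real.cosh t) ≤ Real.exp (-z) := by
      apply Real.exp_le_exp.2
      nlinarith [Real.one_le_cosh t]
    calc Real.cosh t * Real.exp (-z * Real.cosh t)
        = Real.sinh t * Real.exp (-z * Real.cosh t) +
          Real.exp (-z * Real.cosh t) * Real.exp (-t) := by
          linear_combination Real.exp (-z * Real.cosh t) * h4
      _ ≤ Real.sinh t * Real.exp (-z * Real.cosh t) + Real.exp (-z) * Real.exp (-t) := by gcongr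
  have h6 : ∫ t in Set.Ioi (0 : ℝ), Real.exp (-t) = 1 := integral_exp_neg_Ioi_zero
  rw [h6, eq_div_of_mul_eq hz.ne' ((mul_comm _ _).trans hint)] at hle
  have h7 : Real.exp (-z) * (1 + z) ≤ 2 * Real.exp (-(z / 2)) := by
    have h8 : Real.exp (-z) = Real.exp (-(z / 2)) * Real.exp (-(z / 2)) := by
      rw [← Real.exp_add]; ring_nf
    have h9 : Real.exp (-(z / 2)) * (1 + z) ≤ 2 := by
      rw [Real.exp_neg, inv_mul_le_iff₀ (Real.exp_pos _)]
      linarith [Real.add_one_le_exp (z / 2)]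
    rw [h8]
    nlinarith [Real.exp_pos (-(z / 2))]
  refine hle.trans ?_
  rw [div_mul_eq_mul_div, le_div_iff₀ hz]
  calc _ = Real.exp (-z) * (1 + z) := by field_simp
    _ ≤ _ := h7

/-! ### The Mellin transform of `K_0` -/

theorem integral_rpow_mul_one_sub_rpow {s : ℝ} (hs : 0 < s) :
    ∫ x in Set.Ioo (0 : ℝ) 1, x ^ (s - 1) * (1 - x) ^ (s - 1) =
      Real.Gamma s ^ 2 / Real.Gamma (2 * s) := by
  have h := ProbabilityTheory.beta_eq_betaIntegralReal s s hs hs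
  have h2 : Complex.betaIntegral s s =
      ((∫ x in Set.Ioo (0 : ℝ) 1, x ^ (s - 1) * (1 - x) ^ (s - 1) : ℝ) : ℂ) := by
    rw [Complex.betaIntegral, intervalIntegral.integral_of_le zero_le_one,
      MeasureTheory.integral_Ioc_eq_integral_Ioo, ← integral_complex_ofReal]
    refine MeasureTheory.setIntegral_congr_fun measurableSet_Ioo fun x hx => ?_
    have h3 : (0 : ℝ) ≤ 1 - x := by linarith [hx.2]
    push_cast [Complex.ofReal_cpow hx.1.le, Complex.ofReal_cpow h3]
    rfl
  rw [h2, Complex.ofReal_re] at h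
  rw [← h, ProbabilityTheory.beta, two_mul, sq]

/-- The logistic substitution x = σ(2t) maps the line onto (0, 1) with x(1 − x) = (2 cosh t)^{−2},
which turns the symmetric Beta integral into twice the half-line integral. -/
theorem integral_cosh_rpow {s : ℝ} (hs : 0 < s) :
    ∫ t in Set.Ioi (0 : ℝ), Real.cosh t ^ (-(2 * s)) =
      2 ^ (2 * s - 2) * (Real.Gamma s ^ 2 / Real.Gamma (2 * s)) := by
  have hd : ∀ t : ℝ, HasDerivAt (fun t => Real.sigmoid (2 * t))
      (2 * (Real.sigmoid (2 * t) * (1 - Real.sigmoid (2 * t)))) t := by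
    intro t
    refine ((Real.hasDerivAt_sigmoid (2 * t)).comp t
      ((hasDerivAt_id t).const_mul 2)).congr_deriv ?_
    ring
  have hinj : Set.InjOn (fun t : ℝ => Real.sigmoid (2 * t)) Set.univ := by
    intro a _ b _ hab
    have := Real.sigmoid_injective hab
    linarith
  have himg : (fun t : ℝ => Real.sigmoid (2 * t)) '' Set.univ = Set.Ioo 0 1 := by
    rw [Set.image_univ, ← Real.range_sigmoid]
    ext y
    constructor
    · rintro ⟨t, rfl⟩; exact ⟨2 * t, rfl⟩
    · rintro ⟨t, rfl⟩; exact ⟨t / 2, by simp only; ring_nf⟩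
  have h := MeasureTheory.integral_image_eq_integral_abs_deriv_smul MeasurableSet.univ
    (fun t _ => (hd t).hasDerivWithinAt) hinj (fun x : ℝ => x ^ (s - 1) * (1 - x) ^ (s - 1))
  rw [himg, integral_rpow_mul_one_sub_rpow hs] at h
  have hpt : ∀ t : ℝ, Real.sigmoid (2 * t) * (1 - Real.sigmoid (2 * t)) =
      (2 * Real.cosh t) ^ (-2 : ℝ) := by
    intro t
    have hc : 2 * Real.cosh t = Real.exp t + Real.exp (-t) := by rw [Real.cosh_eq]; ring
    have h1 : Real.exp (-(2 * t)) = Real.exp (-t) * Real.exp (-t) := by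
      rw [← Real.exp_add]; ring_nf
    have h2 : Real.exp t * Real.exp (-t) = 1 := by rw [← Real.exp_add]; simp
    have hp := Real.exp_pos t
    have hq := Real.exp_pos (-t)
    rw [Real.rpow_neg (by positivity), Real.rpow_two, hc, Real.sigmoid_def, h1]
    refine eq_inv_of_mul_eq_one_left ?_
    field_simp
    have h3 : (Real.exp t + Real.exp (-t)) = Real.exp t * (1 + Real.exp (-t) ^ 2) := by
      linear_combination -Real.exp (-t) * h2
    rw [h3]
    ring_nf
    linear_combination (1 + 2 * Real.exp (-t) ^ 2 + Real.exp (-t) ^ 4) *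
      (Real.exp t * Real.exp (-t) + 1) * h2
  have hpt2 : ∀ t : ℝ, |2 * (Real.sigmoid (2 * t) * (1 - Real.sigmoid (2 * t)))| •
      (Real.sigmoid (2 * t) ^ (s - 1) * (1 - Real.sigmoid (2 * t)) ^ (s - 1)) =
      2 * 2 ^ (-(2 * s)) * Real.cosh |t| ^ (-(2 * s)) := by
    intro t
    have hc := Real.cosh_pos t
    have h0 := Real.sigmoid_pos (2 * t)
    have h1 : 0 < 1 - Real.sigmoid (2 * t) := by linarith [Real.sigmoid_lt_one (2 * t)]
    rw [abs_of_pos (by positivity), ← Real.mul_rpow h0.le h1.le, smul_eq_mul, mul_assoc,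
      ← Real.rpow_one_add' (by positivity) (by simpa using hs.ne'), hpt, Real.cosh_abs,
      ← Real.rpow_mul (by positivity), mul_assoc, ← Real.mul_rpow (by norm_num) hc.le]
    ring_nf
  simp only [hpt2, MeasureTheory.setIntegral_univ] at h
  rw [integral_comp_abs (f := fun t => 2 * 2 ^ (-(2 * s)) * Real.cosh t ^ (-(2 * s))),
    MeasureTheory.integral_const_mul] at h
  rw [h, Real.rpow_sub (by norm_num), Real.rpow_neg (by norm_num)]
  have : (2 : ℝ) ^ (2 * s) ≠ 0 := by positivity
  norm_num
  field_simp
  ring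

theorem integral_rpow_mul_besselK0 {s : ℝ} (hs : 0 < s) :
    ∫ z in Set.Ioi (0 : ℝ), z ^ (2 * s - 1) * besselK0 z = 2 ^ (2 * s - 2) * Real.Gamma s ^ 2 := by
  have hG : 0 < Real.Gamma (2 * s) := Real.Gamma_pos_of_pos (by positivity)
  have hcont : ContinuousOn (fun p : ℝ × ℝ => p.1 ^ (2 * s - 1) * Real.exp (-p.1 * Real.cosh p.2))
      (Set.Ioi 0 ×ˢ Set.Ioi 0) := by
    refine ContinuousOn.mul ?_ (by fun_prop)
    exact ContinuousOn.rpow_const continuousOn_fst fun p hp => Or.inl (ne_of_gt hp.1)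
  have hinner : ∀ t : ℝ, ∫ z in Set.Ioi (0 : ℝ), z ^ (2 * s - 1) * Real.exp (-z * Real.cosh t) =
      Real.Gamma (2 * s) * Real.cosh t ^ (-(2 * s)) := by
    intro t
    have h := Real.integral_rpow_mul_exp_neg_mul_Ioi (a := 2 * s) (r := Real.cosh t)
      (by positivity) (Real.cosh_pos t)
    rw [Real.rpow_neg (Real.cosh_pos t).le, ← Real.inv_rpow (Real.cosh_pos t).le,
      mul_comm (Real.Gamma _), ← one_div, ← h]
    refine MeasureTheory.integral_congr_ae (Eventually.of_forall fun z => ?_)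
    simp only
    ring_nf
  have hinti : ∀ t : ℝ, MeasureTheory.IntegrableOn
      (fun z => z ^ (2 * s - 1) * Real.exp (-z * Real.cosh t)) (Set.Ioi 0) := by
    intro t
    -- A non-integrable function has Bochner integral 0, whereas the value just computed is
    -- positive; integrability comes for free.
    by_contra hn
    have h := hinner t
    rw [MeasureTheory.integral_undef hn] at h
    have := Real.rpow_pos_of_pos (Real.cosh_pos t) (-(2 * s))
    nlinarith [mul_pos hG this]
  have hcosh : MeasureTheory.IntegrableOn (fun t => Real.cosh t ^ (-(2 * s))) (Set.Ioi 0) := by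
    by_contra hn
    have h := integral_cosh_rpow hs
    rw [MeasureTheory.integral_undef hn] at h
    have := Real.Gamma_pos_of_pos hs
    have : (0 : ℝ) < 2 ^ (2 * s - 2) * (Real.Gamma s ^ 2 / Real.Gamma (2 * s)) := by positivity
    linarith
  have hprod : MeasureTheory.Integrable
      (Function.uncurry fun z t : ℝ => z ^ (2 * s - 1) * Real.exp (-z * Real.cosh t))
      ((MeasureTheory.volume.restrict (Set.Ioi 0)).prod
        (MeasureTheory.volume.restrict (Set.Ioi 0))) := by
    have hm : MeasureTheory.AEStronglyMeasurable
        (Function.uncurry fun z t : ℝ => z ^ (2 * s - 1) * Real.exp (-z * Real.cosh t))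
        ((MeasureTheory.volume.restrict (Set.Ioi 0)).prod
        (MeasureTheory.volume.restrict (Set.Ioi 0))) := by
      rw [MeasureTheory.Measure.prod_restrict]
      exact hcont.aestronglyMeasurable (measurableSet_Ioi.prod measurableSet_Ioi)
    refine (MeasureTheory.integrable_prod_iff' hm).2 ⟨Eventually.of_forall fun t => hinti t, ?_⟩
    refine (hcosh.const_mul (Real.Gamma (2 * s))).congr (Eventually.of_forall fun t => ?_)
    simp only [Function.uncurry]
    rw [← hinner t]
    refine MeasureTheory.setIntegral_congr_fun measurableSet_Ioi fun z hz => ?_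
    have hz' : (0 : ℝ) < z := hz
    exact (Real.norm_of_nonneg (by positivity)).symm
  calc _ = ∫ z in Set.Ioi (0 : ℝ), ∫ t in Set.Ioi (0 : ℝ),
        z ^ (2 * s - 1) * Real.exp (-z * Real.cosh t) := by
        simp only [besselK0, MeasureTheory.integral_const_mul]
    _ = ∫ t in Set.Ioi (0 : ℝ), Real.Gamma (2 * s) * Real.cosh t ^ (-(2 * s)) := by
        rw [MeasureTheory.integral_integral_swap hprod]
        simp only [hinner]
    _ = _ := by
        rw [MeasureTheory.integral_const_mul, integral_cosh_rpow hs]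
        field_simp

section
open MeasureTheory Set

/-! ### Integrals of `K_0` and `K_1` against functions of subexponential growth -/

/-- Continuous functions on `(0, ∞)` bounded by `C_ε exp(ε y)` for every `ε > 0`. -/
def SubExp (p : ℝ → ℝ) : Prop :=
  ContinuousOn p (Ioi 0) ∧ ∀ ε, 0 < ε → ∃ C, 0 ≤ C ∧ ∀ y, 0 < y → |p y| ≤ C * Real.exp (ε * y)

theorem SubExp.mul {p q : ℝ → ℝ} (hp : SubExp p) (hq : SubExp q) : SubExp fun y => p y * q y := by
  refine ⟨hp.1.mul hq.1, fun ε hε => ?_⟩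
  obtain ⟨C, hC, h1⟩ := hp.2 (ε / 2) (by positivity)
  obtain ⟨D, hD, h2⟩ := hq.2 (ε / 2) (by positivity)
  refine ⟨C * D, by positivity, fun y hy => ?_⟩
  rw [abs_mul]
  calc |p y| * |q y| ≤ C * Real.exp (ε / 2 * y) * (D * Real.exp (ε / 2 * y)) :=
        mul_le_mul (h1 y hy) (h2 y hy) (abs_nonneg _) (by positivity)
    _ = C * D * (Real.exp (ε / 2 * y) * Real.exp (ε / 2 * y)) := by ring
    _ = _ := by rw [← Real.exp_add]; ring_nf

theorem SubExp.abs {p : ℝ → ℝ} (hp : SubExp p) : SubExp fun y => |p y| :=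
  ⟨hp.1.abs, by simpa using hp.2⟩

theorem SubExp.of_le {p q : ℝ → ℝ} (hq : SubExp q) (hp : ContinuousOn p (Ioi 0)) (c : ℝ)
    (h : ∀ y, 0 < y → |p y| ≤ c * |q y|) : SubExp p := by
  refine ⟨hp, fun ε hε => ?_⟩
  obtain ⟨C, hC, h1⟩ := hq.2 ε hε
  refine ⟨|c| * C, by positivity, fun y hy => (h y hy).trans ?_⟩
  calc c * |q y| ≤ |c| * (C * Real.exp (ε * y)) :=
        mul_le_mul (le_abs_self c) (h1 y hy) (abs_nonneg _) (abs_nonneg _)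
    _ = _ := by ring

theorem subExp_id : SubExp fun y => y := by
  refine ⟨continuousOn_id, fun ε hε => ⟨1 / ε, by positivity, fun y hy => ?_⟩⟩
  rw [abs_of_pos hy, div_mul_eq_mul_div, one_mul, le_div_iff₀ hε]
  linarith [Real.add_one_le_exp (ε * y)]

theorem subExp_const (c : ℝ) : SubExp fun _ => c := by
  refine ⟨continuousOn_const, fun ε hε => ⟨|c|, abs_nonneg _, fun y hy => ?_⟩⟩
  exact le_mul_of_one_le_right (abs_nonneg _) (Real.one_le_exp (by positivity))

theorem SubExp.one_add_rpow (a : ℝ) (ha : 0 ≤ a) : SubExp fun y => (1 + y) ^ a := by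
  refine ⟨ContinuousOn.rpow_const (by fun_prop) fun y hy => Or.inl ?_, fun ε hε => ?_⟩
  · have : (0 : ℝ) < y := hy
    positivity
  · set δ := ε / (a + 1) with hδ
    have hδ0 : 0 < δ := by positivity
    refine ⟨Real.exp (a / δ), (Real.exp_pos _).le, fun y hy => ?_⟩
    have h1 : 1 + y ≤ Real.exp (1 / δ + δ * y) := by
      have h2 := Real.add_one_le_exp (1 / δ)
      have h3 := Real.add_one_le_exp (δ * y)
      rw [Real.exp_add]
      calc 1 + y ≤ (1 / δ + 1) * (δ * y + 1) := by
            have : 1 / δ * (δ * y) = y := by field_simp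
            have h4 : 0 < 1 / δ := by positivity
            nlinarith [mul_pos hδ0 hy]
        _ ≤ _ := by gcongr
    rw [abs_of_pos (by positivity)]
    calc (1 + y) ^ a ≤ Real.exp (1 / δ + δ * y) ^ a := Real.rpow_le_rpow (by positivity) h1 ha
      _ = Real.exp (a / δ) * Real.exp (a * δ * y) := by
        rw [← Real.exp_mul, ← Real.exp_add]; ring_nf
      _ ≤ _ := by
        gcongr
        rw [hδ, mul_div_assoc', div_le_iff₀ (by positivity)]
        nlinarith

theorem exp_arsinh_le {y : ℝ} (hy : 0 ≤ y) : Real.exp (Real.arsinh y) ≤ 2 * (1 + y) := by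
  rw [Real.exp_arsinh]
  have : √(1 + y ^ 2) ≤ 1 + y := Real.sqrt_le_iff.2 ⟨by positivity, by nlinarith⟩
  linarith

theorem cosh_le_exp_abs (u : ℝ) : Real.cosh u ≤ Real.exp |u| := by
  rw [← Real.cosh_abs, Real.cosh_eq]
  have : Real.exp (-|u|) ≤ Real.exp |u| := Real.exp_le_exp.2 (by linarith [abs_nonneg u])
  linarith

theorem subExp_cosh (a : ℝ) : SubExp fun y => Real.cosh (a * Real.arsinh y) := by
  refine (SubExp.one_add_rpow |a| (abs_nonneg a)).of_le (by fun_prop) (2 ^ |a|) fun y hy => ?_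
  have h0 : 0 ≤ Real.arsinh y := Real.arsinh_nonneg_iff.2 hy.le
  have hy1 : 0 < 1 + y := by positivity
  rw [abs_of_pos (Real.cosh_pos _), abs_of_pos (Real.rpow_pos_of_pos hy1 _),
    ← Real.mul_rpow zero_le_two hy1.le]
  calc _ ≤ Real.exp |a * Real.arsinh y| := cosh_le_exp_abs _
    _ = Real.exp (Real.arsinh y) ^ |a| := by
      rw [← Real.exp_mul, abs_mul, abs_of_nonneg h0, mul_comm]
    _ ≤ _ := Real.rpow_le_rpow (Real.exp_pos _).le (exp_arsinh_le hy.le) (abs_nonneg a)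

theorem arsinh_le_self {y : ℝ} (hy : 0 ≤ y) : Real.arsinh y ≤ y := by
  have h := Real.self_le_sinh_iff.2 (Real.arsinh_nonneg_iff.2 hy)
  rwa [Real.sinh_arsinh] at h

theorem abs_sinh_le (u : ℝ) : |Real.sinh u| ≤ 2 * |u| * Real.cosh u := by
  rw [Real.abs_sinh, ← Real.cosh_abs u]
  have h0 := abs_nonneg u
  have h1 := Real.add_one_le_exp (-(2 * |u|))
  have h2 : Real.exp (-|u|) = Real.exp |u| * Real.exp (-(2 * |u|)) := by
    rw [← Real.exp_add]; ring_nf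
  have h3 : Real.sinh |u| ≤ |u| * Real.exp |u| := by
    rw [Real.sinh_eq, h2]
    nlinarith [Real.exp_pos |u|]
  nlinarith [exp_le_two_mul_cosh |u|]

theorem abs_sinh_mul_arsinh_le (a : ℝ) {y : ℝ} (hy : 0 ≤ y) :
    |Real.sinh (a * Real.arsinh y)| ≤ 2 * |a| * y * Real.cosh (a * Real.arsinh y) := by
  refine (abs_sinh_le _).trans ?_
  rw [abs_mul, abs_of_nonneg (Real.arsinh_nonneg_iff.2 hy)]
  have := Real.cosh_pos (a * Real.arsinh y)
  have := arsinh_le_self hy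
  rw [← mul_assoc]
  gcongr

theorem subExp_sinh_div (a : ℝ) : SubExp fun y => Real.sinh (a * Real.arsinh y) / y := by
  refine (subExp_cosh a).of_le ?_ (2 * |a|) fun y hy => ?_
  · exact ContinuousOn.div (by fun_prop) continuousOn_id fun y hy => ne_of_gt hy
  · rw [abs_div, abs_of_pos hy, div_le_iff₀ hy, abs_of_pos (Real.cosh_pos _)]
    linarith [abs_sinh_mul_arsinh_le a hy.le]

theorem one_le_sqrt_one_add_sq (y : ℝ) : 1 ≤ √(1 + y ^ 2) :=
  Real.one_le_sqrt.2 (by nlinarith [sq_nonneg y])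

theorem SubExp.div_sqrt {p : ℝ → ℝ} (hp : SubExp p) : SubExp fun y => p y / √(1 + y ^ 2) := by
  refine hp.of_le (hp.1.div (by fun_prop) fun y _ => ?_) 1 fun y _ => ?_
  · linarith [one_le_sqrt_one_add_sq y]
  · have := one_le_sqrt_one_add_sq y
    rw [abs_div, abs_of_pos (by linarith : 0 < √(1 + y ^ 2)), one_mul]
    exact div_le_self (abs_nonneg _) this

theorem continuousOn_besselK0_mul {x : ℝ} (hx : 0 < x) :
    ContinuousOn (fun y => besselK0 (2 * x * y)) (Ioi 0) :=
  continuousOn_besselK0.comp (by fun_prop) fun y hy => by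
    have : (0 : ℝ) < y := hy
    exact mem_Ioi.2 (by positivity)

theorem continuousOn_besselK1_mul {x : ℝ} (hx : 0 < x) :
    ContinuousOn (fun y => besselK1 (2 * x * y)) (Ioi 0) :=
  continuousOn_besselK1.comp (by fun_prop) fun y hy => by
    have : (0 : ℝ) < y := hy
    exact mem_Ioi.2 (by positivity)

theorem SubExp.besselK0_mul_le {p : ℝ → ℝ} (hp : SubExp p) {x : ℝ} (hx : 0 < x) :
    ∃ C, 0 ≤ C ∧ ∀ y, 0 < y → |besselK0 (2 * x * y) * p y| ≤
      C * (y ^ (-(1 / 2) : ℝ) * Real.exp (-(x / 2) * y)) := by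
  -- The rate x/2 is half of the decay e^{−xy} furnished by the bound on K_0(2xy); exponent η = 1/2
  -- there keeps the singularity at y = 0 integrable.
  obtain ⟨C, hC, h⟩ := hp.2 (x / 2) (by positivity)
  refine ⟨8 * (2 * x) ^ (-(1 / 2) : ℝ) * C, by positivity, fun y hy => ?_⟩
  have h1 := besselK0_le (z := 2 * x * y) (η := 1 / 2) (by positivity) (by norm_num) (by norm_num)
  rw [abs_mul, abs_of_pos (besselK0_pos (by positivity))]
  calc _ ≤ 4 / (1 / 2) * ((2 * x * y) ^ (-(1 / 2) : ℝ) * Real.exp (-(2 * x * y / 2))) *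
        (C * Real.exp (x / 2 * y)) := mul_le_mul h1 (h y hy) (abs_nonneg _) (by positivity)
    _ = 8 * (2 * x) ^ (-(1 / 2) : ℝ) * C * (y ^ (-(1 / 2) : ℝ) *
        (Real.exp (-(2 * x * y / 2)) * Real.exp (x / 2 * y))) := by
      rw [Real.mul_rpow (by positivity) hy.le]; ring
    _ = _ := by rw [← Real.exp_add]; ring_nf

theorem SubExp.integrableOn_besselK0_mul {p : ℝ → ℝ} (hp : SubExp p) {x : ℝ} (hx : 0 < x) :
    IntegrableOn (fun y => besselK0 (2 * x * y) * p y) (Ioi 0) := by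
  obtain ⟨C, -, h⟩ := hp.besselK0_mul_le hx
  have hi := integrableOn_rpow_mul_exp_neg_mul_rpow (p := 1) (s := -(1 / 2)) (b := x / 2)
    (by norm_num) one_pos (by positivity)
  simp only [Real.rpow_one] at hi
  refine (hi.const_mul C).mono'
    (((continuousOn_besselK0_mul hx).mul hp.1).aestronglyMeasurable measurableSet_Ioi) ?_
  exact (ae_restrict_iff' measurableSet_Ioi).2 (Eventually.of_forall fun y hy => h y hy)

theorem SubExp.integrableOn_besselK1_mul {p : ℝ → ℝ} (hp : SubExp p) {x : ℝ} (hx : 0 < x) :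
    IntegrableOn (fun y => besselK1 (2 * x * y) * (y * p y)) (Ioi 0) := by
  obtain ⟨C, hC, h⟩ := hp.2 (x / 2) (by positivity)
  have hi := exp_neg_integrableOn_Ioi 0 (by positivity : 0 < x / 2)
  refine (hi.const_mul (1 / x * C)).mono' (((continuousOn_besselK1_mul hx).mul
    (continuousOn_id.mul hp.1)).aestronglyMeasurable measurableSet_Ioi) ?_
  refine (ae_restrict_iff' measurableSet_Ioi).2 (Eventually.of_forall fun y hy => ?_)
  have hy0 : (0 : ℝ) < y := hy
  have h1 := besselK1_le (z := 2 * x * y) (by positivity)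
  rw [Real.norm_eq_abs, abs_mul, abs_mul, abs_of_pos hy0,
    abs_of_pos (besselK1_pos (by positivity))]
  calc _ ≤ 2 / (2 * x * y) * Real.exp (-(2 * x * y / 2)) * (y * (C * Real.exp (x / 2 * y))) := by
        have := h y hy0
        gcongr
    _ = 1 / x * C * (Real.exp (-(2 * x * y / 2)) * Real.exp (x / 2 * y)) := by field_simp
    _ = _ := by rw [← Real.exp_add]; ring_nf

theorem strictAntiOn_besselK1 : StrictAntiOn besselK1 (Ioi 0) := by
  refine strictAntiOn_of_deriv_neg (convex_Ioi 0) continuousOn_besselK1 fun z hz => ?_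
  rw [interior_Ioi] at hz
  rw [(hasDerivAt_besselK1 hz).deriv]
  have := besselK0_pos hz
  have := div_pos (besselK1_pos hz) hz
  linarith

theorem SubExp.hasDerivAt_integral_besselK0 {p : ℝ → ℝ} (hp : SubExp p) {x : ℝ} (hx : 0 < x) :
    HasDerivAt (fun x => ∫ y in Ioi (0 : ℝ), besselK0 (2 * x * y) * p y)
      (-(2 * ∫ y in Ioi (0 : ℝ), besselK1 (2 * x * y) * (y * p y))) x := by
  have hm : ∀ x : ℝ, 0 < x → AEStronglyMeasurable (fun y => besselK0 (2 * x * y) * p y)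
      (volume.restrict (Ioi 0)) := fun x hx =>
    ((continuousOn_besselK0_mul hx).mul hp.1).aestronglyMeasurable measurableSet_Ioi
  have hx2 : 0 < x / 2 := by positivity
  have h := (hasDerivAt_integral_of_dominated_loc_of_deriv_le
    (μ := volume.restrict (Ioi (0 : ℝ))) (s := Ioi (x / 2)) (x₀ := x)
    (F := fun x y => besselK0 (2 * x * y) * p y)
    (F' := fun x y => -2 * (besselK1 (2 * x * y) * (y * p y)))
    (bound := fun y => 2 * (besselK1 (2 * (x / 2) * y) * (y * |p y|)))
    (Ioi_mem_nhds (by linarith))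
    ((eventually_gt_nhds hx).mono fun x hx => hm x hx) (hp.integrableOn_besselK0_mul hx)
    ((hp.integrableOn_besselK1_mul hx).const_mul (-2)).1
    ((ae_restrict_iff' measurableSet_Ioi).2 (Eventually.of_forall fun y hy z hz => ?_))
    ((hp.abs.integrableOn_besselK1_mul hx2).const_mul 2)
    ((ae_restrict_iff' measurableSet_Ioi).2 (Eventually.of_forall fun y hy z hz => ?_))).2
  · rw [integral_const_mul] at h
    exact h.congr_deriv (by ring)
  · have hy0 : (0 : ℝ) < y := hy
    have hz' : x / 2 < z := hz
    have hz0 : 0 < z := hx2.trans hz'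
    rw [norm_mul, norm_mul, norm_mul, Real.norm_of_nonneg (besselK1_pos (by positivity)).le,
      Real.norm_of_nonneg hy0.le]
    have h1 : besselK1 (2 * z * y) ≤ besselK1 (2 * (x / 2) * y) :=
      strictAntiOn_besselK1.antitoneOn (mem_Ioi.2 (by positivity)) (mem_Ioi.2 (by positivity))
        (by nlinarith)
    rw [norm_neg, Real.norm_two, Real.norm_eq_abs]
    gcongr
  · have hy0 : (0 : ℝ) < y := hy
    have hz0 : 0 < z := hx2.trans hz
    have hd : HasDerivAt (fun x : ℝ => 2 * x * y) (2 * y) z := by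
      refine (((hasDerivAt_id z).const_mul 2).mul_const y).congr_deriv (by ring)
    refine (((hasDerivAt_besselK0 (z := 2 * z * y) (by positivity)).comp z hd).mul_const
      (p y)).congr_deriv ?_
    ring

theorem SubExp.hasDerivAt_integral_besselK1 {p : ℝ → ℝ} (hp : SubExp p) {x : ℝ} (hx : 0 < x) :
    HasDerivAt (fun x => ∫ y in Ioi (0 : ℝ), besselK1 (2 * x * y) * (y * p y))
      (-(2 * ∫ y in Ioi (0 : ℝ), besselK0 (2 * x * y) * (y * (y * p y))) -
        (∫ y in Ioi (0 : ℝ), besselK1 (2 * x * y) * (y * p y)) / x) x := by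
  have hq : SubExp fun y => y * (y * p y) := subExp_id.mul (subExp_id.mul hp)
  have hm : ∀ x : ℝ, 0 < x → AEStronglyMeasurable (fun y => besselK1 (2 * x * y) * (y * p y))
      (volume.restrict (Ioi 0)) := fun x hx =>
    ((continuousOn_besselK1_mul hx).mul
      (continuousOn_id.mul hp.1)).aestronglyMeasurable measurableSet_Ioi
  have hx2 : 0 < x / 2 := by positivity
  have hi0 := (hq.integrableOn_besselK0_mul hx).const_mul (-2)
  have hi1 := (hp.integrableOn_besselK1_mul hx).const_mul (1 / x)
  have h := (hasDerivAt_integral_of_dominated_loc_of_deriv_le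
    (μ := volume.restrict (Ioi (0 : ℝ))) (s := Ioi (x / 2)) (x₀ := x)
    (F := fun x y => besselK1 (2 * x * y) * (y * p y))
    (F' := fun x y => -2 * (besselK0 (2 * x * y) * (y * (y * p y))) -
      1 / x * (besselK1 (2 * x * y) * (y * p y)))
    (bound := fun y => 2 * (besselK0 (2 * (x / 2) * y) * |y * (y * p y)|) +
      1 / (x / 2) * (besselK1 (2 * (x / 2) * y) * (y * |p y|)))
    (Ioi_mem_nhds (by linarith))
    ((eventually_gt_nhds hx).mono fun x hx => hm x hx) (hp.integrableOn_besselK1_mul hx)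
    (hi0.sub hi1).1
    ((ae_restrict_iff' measurableSet_Ioi).2 (Eventually.of_forall fun y hy z hz => ?_))
    (((hq.abs.integrableOn_besselK0_mul hx2).const_mul 2).add
      ((hp.abs.integrableOn_besselK1_mul hx2).const_mul _))
    ((ae_restrict_iff' measurableSet_Ioi).2 (Eventually.of_forall fun y hy z hz => ?_))).2
  · rw [integral_sub hi0 hi1, integral_const_mul, integral_const_mul] at h
    exact h.congr_deriv (by ring)
  · have hy0 : (0 : ℝ) < y := hy
    have hz' : x / 2 < z := hz
    have hz0 : 0 < z := hx2.trans hz'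
    have hle : 2 * (x / 2) * y ≤ 2 * z * y := by nlinarith
    have h0 : besselK0 (2 * z * y) ≤ besselK0 (2 * (x / 2) * y) :=
      strictAntiOn_besselK0.antitoneOn (mem_Ioi.2 (by positivity)) (mem_Ioi.2 (by positivity)) hle
    have h1 : besselK1 (2 * z * y) ≤ besselK1 (2 * (x / 2) * y) :=
      strictAntiOn_besselK1.antitoneOn (mem_Ioi.2 (by positivity)) (mem_Ioi.2 (by positivity)) hle
    refine (norm_sub_le _ _).trans ?_
    rw [norm_mul, norm_mul, norm_mul y (y * p y), norm_mul (1 / z), norm_mul (besselK1 _),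
      norm_mul y (p y), abs_mul, abs_mul, abs_of_pos hy0, Real.norm_of_nonneg (besselK1_pos (by positivity)).le,
      Real.norm_of_nonneg (besselK0_pos (by positivity)).le,
      Real.norm_of_nonneg hy0.le, Real.norm_of_nonneg (by positivity : (0 : ℝ) ≤ 1 / z),
      norm_neg, Real.norm_two, Real.norm_eq_abs]
    have hk := besselK1_pos (by positivity : 0 < 2 * z * y)
    gcongr
  · have hy0 : (0 : ℝ) < y := hy
    have hz0 : 0 < z := hx2.trans hz
    have hd : HasDerivAt (fun x : ℝ => 2 * x * y) (2 * y) z := by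
      refine (((hasDerivAt_id z).const_mul 2).mul_const y).congr_deriv (by ring)
    refine (((hasDerivAt_besselK1 (z := 2 * z * y) (by positivity)).comp z hd).mul_const
      (y * p y)).congr_deriv ?_
    field_simp

/-! ### Nicholson's integrals -/

/-- `∫_0^∞ K_0(2x sinh t) cosh(2νt) dt`, in the variable `y = sinh t`. -/
noncomputable def nicholsonP (ν x : ℝ) : ℝ :=
  ∫ y in Ioi (0 : ℝ), besselK0 (2 * x * y) * (Real.cosh (2 * ν * Real.arsinh y) / √(1 + y ^ 2))

/-- `∫_0^∞ K_1(2x sinh t) sinh((2ν+1)t) dt`, in the variable `y = sinh t`. -/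
noncomputable def nicholsonR (ν x : ℝ) : ℝ :=
  ∫ y in Ioi (0 : ℝ),
    besselK1 (2 * x * y) * (y * (Real.sinh ((2 * ν + 1) * Real.arsinh y) / y / √(1 + y ^ 2)))

theorem nicholsonP_neg (ν x : ℝ) : nicholsonP (-ν) x = nicholsonP ν x := by
  simp only [nicholsonP, mul_neg, neg_mul, Real.cosh_neg]

/-- Together with evenness of P in the order, the reflection ν ↦ −ν − 1 exchanges P_ν with P_{ν+1}
and reverses R_ν. It transfers statements about J_ν to J_{−ν} below. -/
theorem nicholsonR_neg_sub_one (ν x : ℝ) : nicholsonR (-ν - 1) x = -nicholsonR ν x := by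
  rw [nicholsonR, nicholsonR, ← integral_neg]
  refine integral_congr_ae (Eventually.of_forall fun y => ?_)
  simp only
  rw [show 2 * (-ν - 1) + 1 = -(2 * ν + 1) by ring, neg_mul, Real.sinh_neg]
  ring

theorem subExp_nicholsonP (ν : ℝ) :
    SubExp fun y => Real.cosh (2 * ν * Real.arsinh y) / √(1 + y ^ 2) :=
  (subExp_cosh (2 * ν)).div_sqrt

theorem subExp_nicholsonR (ν : ℝ) :
    SubExp fun y => Real.sinh ((2 * ν + 1) * Real.arsinh y) / y / √(1 + y ^ 2) :=
  (subExp_sinh_div (2 * ν + 1)).div_sqrt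

theorem nicholsonP_pos (ν : ℝ) {x : ℝ} (hx : 0 < x) : 0 < nicholsonP ν x := by
  have hpos : ∀ y ∈ Ioi (0 : ℝ),
      0 < besselK0 (2 * x * y) * (Real.cosh (2 * ν * Real.arsinh y) / √(1 + y ^ 2)) := by
    intro y hy
    have hy0 : (0 : ℝ) < y := hy
    have := besselK0_pos (by positivity : 0 < 2 * x * y)
    have := Real.cosh_pos (2 * ν * Real.arsinh y)
    positivity
  refine (setIntegral_pos_iff_support_of_nonneg_ae
    ((ae_restrict_iff' measurableSet_Ioi).2 (Eventually.of_forall fun y hy => (hpos y hy).le))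
    ((subExp_nicholsonP ν).integrableOn_besselK0_mul hx)).2 ?_
  refine lt_of_lt_of_le (b := volume (Ioi (0 : ℝ))) (by simp) (measure_mono ?_)
  exact fun y hy => ⟨(hpos y hy).ne', hy⟩

/-- Integration by parts: differentiate K_0(2xy) sinh(2ν arsinh y). Its boundary values vanish
because the factor sinh, of order y, beats the singularity of K_0 at 0. -/
theorem mul_nicholsonP (ν : ℝ) {x : ℝ} (hx : 0 < x) :
    ν * nicholsonP ν x = x * ∫ y in Ioi (0 : ℝ),
      besselK1 (2 * x * y) * (y * (Real.sinh (2 * ν * Real.arsinh y) / y)) := by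
  have hs := subExp_sinh_div (2 * ν)
  have hi1 := (hs.integrableOn_besselK1_mul hx).const_mul (-(2 * x))
  have hi0 := ((subExp_nicholsonP ν).integrableOn_besselK0_mul hx).const_mul (2 * ν)
  obtain ⟨C, hC, hb⟩ := hs.besselK0_mul_le hx
  have hb' : ∀ y, 0 < y → ‖besselK0 (2 * x * y) * Real.sinh (2 * ν * Real.arsinh y)‖ ≤
      C * (y ^ (1 / 2 : ℝ) * Real.exp (-(x / 2) * y)) := by
    intro y hy
    have h1 : besselK0 (2 * x * y) * Real.sinh (2 * ν * Real.arsinh y) =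
        y * (besselK0 (2 * x * y) * (Real.sinh (2 * ν * Real.arsinh y) / y)) := by
      field_simp
    have h2 : y ^ (1 / 2 : ℝ) = y * y ^ (-(1 / 2) : ℝ) := by
      rw [← Real.rpow_one_add' hy.le (by norm_num)]; norm_num
    rw [h1, norm_mul, Real.norm_of_nonneg hy.le, h2]
    have := mul_le_mul_of_nonneg_left (hb y hy) hy.le
    rw [Real.norm_eq_abs]
    linarith
  have hcont : ContinuousWithinAt
      (fun y => besselK0 (2 * x * y) * Real.sinh (2 * ν * Real.arsinh y)) (Ici 0) 0 := by
    rw [← continuousWithinAt_Ioi_iff_Ici]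
    have h0 : Tendsto (fun y : ℝ => C * (y ^ (1 / 2 : ℝ) * Real.exp (-(x / 2) * y))) (𝓝[>] 0)
        (𝓝 0) := by
      have hc : Continuous fun y : ℝ => C * (y ^ (1 / 2 : ℝ) * Real.exp (-(x / 2) * y)) := by
        have := Real.continuous_rpow_const (q := 1 / 2) (by norm_num)
        fun_prop
      have := (hc.tendsto 0).mono_left (nhdsWithin_le_nhds (s := Ioi 0))
      rwa [Real.zero_rpow (by norm_num), zero_mul, mul_zero] at this
    rw [ContinuousWithinAt, Real.arsinh_zero, mul_zero, mul_zero, Real.sinh_zero, mul_zero]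
    exact squeeze_zero_norm' (eventually_mem_nhdsWithin.mono hb') h0
  have htop : Tendsto (fun y => besselK0 (2 * x * y) * Real.sinh (2 * ν * Real.arsinh y)) atTop
      (𝓝 0) := by
    have h0 := (tendsto_rpow_mul_exp_neg_mul_atTop_nhds_zero (1 / 2) (x / 2)
      (by positivity)).const_mul C
    rw [mul_zero] at h0
    exact squeeze_zero_norm' ((eventually_gt_atTop 0).mono hb') h0
  have hd : ∀ y ∈ Ioi (0 : ℝ), HasDerivAt
      (fun y => besselK0 (2 * x * y) * Real.sinh (2 * ν * Real.arsinh y))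
      (-(2 * x) * (besselK1 (2 * x * y) * (y * (Real.sinh (2 * ν * Real.arsinh y) / y))) +
        2 * ν * (besselK0 (2 * x * y) * (Real.cosh (2 * ν * Real.arsinh y) / √(1 + y ^ 2)))) y := by
    intro y hy
    have hy0 : (0 : ℝ) < y := hy
    have h1 : HasDerivAt (fun y : ℝ => 2 * x * y) (2 * x) y := by
      simpa using (hasDerivAt_id y).const_mul (2 * x)
    refine (((hasDerivAt_besselK0 (z := 2 * x * y) (by positivity)).comp y h1).mul
      (((Real.hasDerivAt_arsinh y).const_mul (2 * ν)).sinh)).congr_deriv ?_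
    simp only [Function.comp]
    field_simp
  have h := integral_Ioi_of_hasDerivAt_of_tendsto hcont hd (hi1.add hi0) htop
  rw [integral_add hi1 hi0, integral_const_mul, integral_const_mul] at h
  simp only [Real.arsinh_zero, mul_zero, Real.sinh_zero, sub_zero] at h
  rw [nicholsonP]
  linarith

theorem hasDerivAt_nicholsonP_aux (ν : ℝ) {x : ℝ} (hx : 0 < x) :
    HasDerivAt (nicholsonP ν) (-(2 * ∫ y in Ioi (0 : ℝ), besselK1 (2 * x * y) *
      (y * (Real.cosh (2 * ν * Real.arsinh y) / √(1 + y ^ 2))))) x :=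
  (subExp_nicholsonP ν).hasDerivAt_integral_besselK0 hx

/-- The addition theorem for sinh((2ν + 1)t) expresses R_ν through the derivative of P_ν and the
integrated-by-parts form of νP_ν. The result is exactly the equation for A² when (A, B) is a Bessel
pair, with R_ν in the role of AB. -/
theorem hasDerivAt_nicholsonP (ν : ℝ) {x : ℝ} (hx : 0 < x) :
    HasDerivAt (nicholsonP ν) (2 * ν / x * nicholsonP ν x - 2 * nicholsonR ν x) x := by
  refine (hasDerivAt_nicholsonP_aux ν hx).congr_deriv ?_
  have hi1 := (subExp_sinh_div (2 * ν)).integrableOn_besselK1_mul hx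
  have hi2 := (subExp_nicholsonP ν).integrableOn_besselK1_mul hx
  have h : nicholsonR ν x = (∫ y in Ioi (0 : ℝ),
      besselK1 (2 * x * y) * (y * (Real.sinh (2 * ν * Real.arsinh y) / y))) +
      ∫ y in Ioi (0 : ℝ), besselK1 (2 * x * y) *
        (y * (Real.cosh (2 * ν * Real.arsinh y) / √(1 + y ^ 2))) := by
    rw [← integral_add hi1 hi2, nicholsonR]
    refine setIntegral_congr_fun measurableSet_Ioi fun y hy => ?_
    have hy0 : y ≠ 0 := ne_of_gt hy
    have hs := one_le_sqrt_one_add_sq y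
    rw [add_mul, one_mul, Real.sinh_add, Real.sinh_arsinh, Real.cosh_arsinh]
    field_simp
  have h2 : 2 * ν / x * nicholsonP ν x = 2 * (ν * nicholsonP ν x) / x := by ring
  rw [h, h2, mul_nicholsonP ν hx]
  field_simp
  ring

theorem hasDerivAt_nicholsonP_add_one (ν : ℝ) {x : ℝ} (hx : 0 < x) :
    HasDerivAt (nicholsonP (ν + 1))
      (2 * nicholsonR ν x - 2 * (ν + 1) / x * nicholsonP (ν + 1) x) x := by
  have h := hasDerivAt_nicholsonP (-ν - 1) hx
  rw [nicholsonR_neg_sub_one, show -ν - 1 = -(ν + 1) by ring, nicholsonP_neg] at h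
  refine (h.congr_of_eventuallyEq
    (Eventually.of_forall fun z => (nicholsonP_neg (ν + 1) z).symm)).congr_deriv ?_
  ring

/-- This mirrors the equation for AB. The difference P_{ν+1} − P_ν appears through cosh(u + t) −
cosh(u − t) = 2 sinh u sinh t. -/
theorem hasDerivAt_nicholsonR (ν : ℝ) {x : ℝ} (hx : 0 < x) :
    HasDerivAt (nicholsonR ν) (nicholsonP ν x - nicholsonP (ν + 1) x - nicholsonR ν x / x) x := by
  refine ((subExp_nicholsonR ν).hasDerivAt_integral_besselK1 hx).congr_deriv ?_
  have h : 2 * ∫ y in Ioi (0 : ℝ), besselK0 (2 * x * y) * (y * (y *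
      (Real.sinh ((2 * ν + 1) * Real.arsinh y) / y / √(1 + y ^ 2)))) =
      nicholsonP (ν + 1) x - nicholsonP ν x := by
    rw [nicholsonP, nicholsonP, ← integral_sub
      ((subExp_nicholsonP (ν + 1)).integrableOn_besselK0_mul hx)
      ((subExp_nicholsonP ν).integrableOn_besselK0_mul hx), ← integral_const_mul]
    refine setIntegral_congr_fun measurableSet_Ioi fun y hy => ?_
    have hy0 : y ≠ 0 := ne_of_gt hy
    have hs := one_le_sqrt_one_add_sq y
    rw [show 2 * (ν + 1) * Real.arsinh y = (2 * ν + 1) * Real.arsinh y + Real.arsinh y by ring,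
      show 2 * ν * Real.arsinh y = (2 * ν + 1) * Real.arsinh y - Real.arsinh y by ring,
      Real.cosh_add, Real.cosh_sub, Real.sinh_arsinh, Real.cosh_arsinh]
    field_simp
    ring
  rw [h, nicholsonR]
  ring
end

/-! ### Limits of Nicholson's integrals in x, and continuity in the order -/

section
open MeasureTheory Set

theorem mul_div_div_cancel_left_of_ne_zero {y : ℝ} (hy : y ≠ 0) (S R : ℝ) : y * (S / y / R) = S / R := by
  field_simp

/-- Rescaling moves x out of the Bessel kernel into an elementary factor, where limits and
monotonicity in x are visible pointwise. -/
theorem nicholsonP_scaled (ν : ℝ) {x : ℝ} (hx : 0 < x) :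
    x * nicholsonP ν x = ∫ y in Ioi (0 : ℝ), besselK0 (2 * y) *
      (Real.cosh (2 * ν * Real.arsinh (y / x)) / √(1 + (y / x) ^ 2)) := by
  have h := integral_comp_mul_left_Ioi' (fun y => besselK0 (2 * y) *
      (Real.cosh (2 * ν * Real.arsinh (y / x)) / √(1 + (y / x) ^ 2))) 0 hx
  rw [mul_zero] at h
  rw [← h, nicholsonP, smul_eq_mul]
  congr 1
  refine integral_congr_ae (Eventually.of_forall fun y => ?_)
  simp only [mul_div_cancel_left₀ _ hx.ne', mul_assoc]

theorem nicholsonR_scaled (ν : ℝ) {x : ℝ} (hx : 0 < x) :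
    x * nicholsonR ν x = ∫ y in Ioi (0 : ℝ), besselK1 (2 * y) * (y / x *
      (Real.sinh ((2 * ν + 1) * Real.arsinh (y / x)) / (y / x) / √(1 + (y / x) ^ 2))) := by
  have h := integral_comp_mul_left_Ioi' (fun y => besselK1 (2 * y) * (y / x *
      (Real.sinh ((2 * ν + 1) * Real.arsinh (y / x)) / (y / x) / √(1 + (y / x) ^ 2)))) 0 hx
  rw [mul_zero] at h
  rw [← h, nicholsonR, smul_eq_mul]
  congr 1
  refine integral_congr_ae (Eventually.of_forall fun y => ?_)
  simp only [mul_div_cancel_left₀ _ hx.ne', mul_assoc]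

theorem integral_besselK0_two_mul_rpow {s : ℝ} (hs : 0 < s) :
    ∫ y in Ioi (0 : ℝ), besselK0 (2 * y) * (2 * y) ^ (2 * s - 1) =
      2 ^ (2 * s - 2) * Real.Gamma s ^ 2 / 2 := by
  have h := integral_comp_mul_left_Ioi (fun z => besselK0 z * z ^ (2 * s - 1)) 0 two_pos
  rw [h, mul_zero, smul_eq_mul, ← integral_rpow_mul_besselK0 hs]
  simp only [mul_comm (besselK0 _)]
  ring

theorem integral_besselK0_two_mul : ∫ y in Ioi (0 : ℝ), besselK0 (2 * y) = Real.pi / 4 := by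
  have h := integral_besselK0_two_mul_rpow (s := 1 / 2) (by norm_num)
  norm_num [Real.Gamma_one_half_eq, Real.sq_sqrt Real.pi_pos.le] at h
  rw [h]
  ring

theorem SubExp.comp_div {p : ℝ → ℝ} (hp : ContinuousOn p (Ioi 0)) {x : ℝ} (hx : 0 < x) :
    ContinuousOn (fun y => p (y / x)) (Ioi 0) :=
  hp.comp (by fun_prop) fun _ hy => mem_Ioi.2 (div_pos hy hx)

theorem tendsto_div_atTop_zero (y : ℝ) : Tendsto (fun x : ℝ => y / x) atTop (𝓝 0) :=
  tendsto_const_nhds.div_atTop tendsto_id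

theorem cosh_mul_arsinh_div_le (a : ℝ) {x y : ℝ} (hx : 1 ≤ x) (hy : 0 < y) :
    Real.cosh (a * Real.arsinh (y / x)) ≤ Real.cosh (a * Real.arsinh y) := by
  have hx0 : 0 < x := by linarith
  rw [Real.cosh_le_cosh, abs_mul, abs_mul, abs_of_nonneg (Real.arsinh_nonneg_iff.2 hy.le),
    abs_of_nonneg (Real.arsinh_nonneg_iff.2 (by positivity))]
  gcongr
  exact div_le_self hy.le hx

theorem tendsto_mul_nicholsonP (ν : ℝ) :
    Tendsto (fun x => x * nicholsonP ν x) atTop (𝓝 (Real.pi / 4)) := by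
  have hi : IntegrableOn (fun y => besselK0 (2 * y) * Real.cosh (2 * ν * Real.arsinh y))
      (Ioi 0) := by
    simpa using (subExp_cosh (2 * ν)).integrableOn_besselK0_mul one_pos
  have hlim := tendsto_integral_filter_of_dominated_convergence (l := atTop)
    (μ := volume.restrict (Ioi (0 : ℝ))) (F := fun x y : ℝ => besselK0 (2 * y) *
      (Real.cosh (2 * ν * Real.arsinh (y / x)) / √(1 + (y / x) ^ 2)))
    (f := fun y => besselK0 (2 * y)) _ ?_ ?_ hi ?_
  · rw [← integral_besselK0_two_mul]
    refine hlim.congr' ?_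
    filter_upwards [eventually_gt_atTop 0] with x hx
    exact (nicholsonP_scaled ν hx).symm
  · filter_upwards [eventually_gt_atTop 0] with x hx
    have hc := (continuousOn_besselK0_mul one_pos).mul
      (SubExp.comp_div (subExp_nicholsonP ν).1 hx)
    simp only [mul_one] at hc
    exact hc.aestronglyMeasurable measurableSet_Ioi
  · filter_upwards [eventually_ge_atTop 1] with x hx
    refine (ae_restrict_iff' measurableSet_Ioi).2 (Eventually.of_forall fun y hy => ?_)
    have hy0 : (0 : ℝ) < y := hy
    have hK := besselK0_pos (by positivity : 0 < 2 * y)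
    have hc := Real.cosh_pos (2 * ν * Real.arsinh (y / x))
    rw [Real.norm_of_nonneg (by positivity)]
    gcongr
    exact (div_le_self hc.le (one_le_sqrt_one_add_sq _)).trans
      (cosh_mul_arsinh_div_le _ hx hy0)
  · refine Eventually.of_forall fun y => ?_
    have hc : Continuous fun u : ℝ => besselK0 (2 * y) *
        (Real.cosh (2 * ν * Real.arsinh u) / √(1 + u ^ 2)) := by
      refine continuous_const.mul (Continuous.div (?_ : Continuous _) (by fun_prop) fun u => ?_)
      · exact Real.continuous_cosh.comp (continuous_const.mul Real.continuous_arsinh)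
      linarith [one_le_sqrt_one_add_sq u]
    have := (hc.tendsto 0).comp (tendsto_div_atTop_zero y)
    simpa [Function.comp_def] using this

theorem tendsto_mul_nicholsonR (ν : ℝ) :
    Tendsto (fun x => x * nicholsonR ν x) atTop (𝓝 0) := by
  have hi : IntegrableOn (fun y => besselK1 (2 * y) * (y * (2 * |2 * ν + 1| *
      Real.cosh ((2 * ν + 1) * Real.arsinh y)))) (Ioi 0) := by
    simpa using ((subExp_const (2 * |2 * ν + 1|)).mul
      (subExp_cosh (2 * ν + 1))).integrableOn_besselK1_mul one_pos
  have hlim := tendsto_integral_filter_of_dominated_convergence (l := atTop)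
    (μ := volume.restrict (Ioi (0 : ℝ))) (F := fun x y : ℝ => besselK1 (2 * y) * (y / x *
      (Real.sinh ((2 * ν + 1) * Real.arsinh (y / x)) / (y / x) / √(1 + (y / x) ^ 2))))
    (f := fun y => 0) _ ?_ ?_ hi ?_
  · rw [integral_zero] at hlim
    refine hlim.congr' ?_
    filter_upwards [eventually_gt_atTop 0] with x hx
    exact (nicholsonR_scaled ν hx).symm
  · filter_upwards [eventually_gt_atTop 0] with x hx
    have hc := (continuousOn_besselK1_mul one_pos).mul
      (SubExp.comp_div (subExp_id.mul (subExp_nicholsonR ν)).1 hx)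
    simp only [mul_one] at hc
    exact hc.aestronglyMeasurable measurableSet_Ioi
  · filter_upwards [eventually_ge_atTop 1] with x hx
    refine (ae_restrict_iff' measurableSet_Ioi).2 (Eventually.of_forall fun y hy => ?_)
    have hy0 : (0 : ℝ) < y := hy
    have hx0 : 0 < x := by linarith
    have hyx : 0 < y / x := by positivity
    have hK := besselK1_pos (by positivity : 0 < 2 * y)
    have hs := one_le_sqrt_one_add_sq (y / x)
    have hc := cosh_mul_arsinh_div_le (2 * ν + 1) hx hy0
    rw [norm_mul, Real.norm_of_nonneg hK.le]
    gcongr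
    rw [mul_div_div_cancel_left_of_ne_zero hyx.ne', Real.norm_eq_abs, abs_div,
      abs_of_pos (by linarith : 0 < √(1 + (y / x) ^ 2))]
    calc _ ≤ |Real.sinh ((2 * ν + 1) * Real.arsinh (y / x))| := div_le_self (abs_nonneg _) hs
      _ ≤ 2 * |2 * ν + 1| * (y / x) * Real.cosh ((2 * ν + 1) * Real.arsinh (y / x)) :=
        abs_sinh_mul_arsinh_le _ hyx.le
      _ ≤ 2 * |2 * ν + 1| * y * Real.cosh ((2 * ν + 1) * Real.arsinh y) := by
        gcongr
        exact div_le_self hy0.le hx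
      _ = _ := by ring
  · refine (ae_restrict_iff' measurableSet_Ioi).2 (Eventually.of_forall fun y hy => ?_)
    have hy0 : (0 : ℝ) < y := hy
    have hc : Continuous fun u : ℝ => besselK1 (2 * y) *
        (Real.sinh ((2 * ν + 1) * Real.arsinh u) / √(1 + u ^ 2)) := by
      refine continuous_const.mul (Continuous.div (?_ : Continuous _) (by fun_prop) fun u => ?_)
      · exact Real.continuous_sinh.comp (continuous_const.mul Real.continuous_arsinh)
      linarith [one_le_sqrt_one_add_sq u]
    have h := (hc.tendsto 0).comp (tendsto_div_atTop_zero y)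
    simp only [Real.arsinh_zero, mul_zero, Real.sinh_zero, zero_div] at h
    refine h.congr' ?_
    filter_upwards [eventually_gt_atTop 0] with x hx
    have hyx : 0 < y / x := by positivity
    simp only [Function.comp]
    rw [mul_div_div_cancel_left_of_ne_zero hyx.ne']

theorem exp_arsinh_div {x y : ℝ} (hx : 0 < x) :
    Real.exp (Real.arsinh (y / x)) = (y + √(x ^ 2 + y ^ 2)) / x := by
  have h : √(1 + (y / x) ^ 2) = √(x ^ 2 + y ^ 2) / x := by
    rw [eq_div_iff hx.ne', ← Real.sqrt_sq hx.le, ← Real.sqrt_mul (by positivity),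
      Real.sqrt_sq hx.le]
    congr 1
    field_simp
  rw [Real.exp_arsinh, h]
  ring

/-- The apparent singularity at x = 0 is removed: for s > 0 the right side is continuous there with
value (2y)^{2s−1}. -/
theorem rpow_mul_cosh_div {s x y : ℝ} (hx : 0 < x) (hy : 0 < y) :
    x ^ (2 * s - 1) * (Real.cosh (2 * s * Real.arsinh (y / x)) / √(1 + (y / x) ^ 2)) =
      ((y + √(x ^ 2 + y ^ 2)) ^ (2 * s) + x ^ (4 * s) * (y + √(x ^ 2 + y ^ 2)) ^ (-(2 * s))) / 2 /
        √(x ^ 2 + y ^ 2) := by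
  have hr : 0 < √(x ^ 2 + y ^ 2) := Real.sqrt_pos.2 (by positivity)
  have h : √(1 + (y / x) ^ 2) = √(x ^ 2 + y ^ 2) / x := by
    rw [eq_div_iff hx.ne', ← Real.sqrt_sq hx.le, ← Real.sqrt_mul (by positivity),
      Real.sqrt_sq hx.le]
    congr 1
    field_simp
  have he : ∀ c : ℝ, Real.exp (c * Real.arsinh (y / x)) =
      (y + √(x ^ 2 + y ^ 2)) ^ c / x ^ c := by
    intro c
    rw [mul_comm, Real.exp_mul, exp_arsinh_div hx, Real.div_rpow (by positivity) hx.le]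
  have h4 : x ^ (4 * s) = x ^ (2 * s) * x ^ (2 * s) := by
    rw [← Real.rpow_add hx]; ring_nf
  rw [h, Real.cosh_eq, ← neg_mul, he, he, Real.rpow_neg hx.le, Real.rpow_sub_one hx.ne', h4]
  have := Real.rpow_pos_of_pos hx (2 * s)
  field_simp

/-- Dominated convergence reduces the behaviour at 0 to the Mellin transform of K_0. This is where
the Gamma factors that will cancel those of J_ν enter. -/
theorem tendsto_rpow_mul_nicholsonP {s : ℝ} (hs : 0 < s) :
    Tendsto (fun x => x ^ (2 * s) * nicholsonP s x) (𝓝[>] 0)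
      (𝓝 (2 ^ (2 * s - 2) * Real.Gamma s ^ 2 / 2)) := by
  have hi1 : IntegrableOn (fun y => besselK0 (2 * y) * (2 * y) ^ (2 * s - 1)) (Ioi 0) := by
    by_contra hn
    have h := integral_besselK0_two_mul_rpow hs
    rw [integral_undef hn] at h
    have := Real.Gamma_pos_of_pos hs
    have : (0 : ℝ) < 2 ^ (2 * s - 2) * Real.Gamma s ^ 2 / 2 := by positivity
    linarith
  have hi2 : IntegrableOn (fun y => besselK0 (2 * y) * (1 + y) ^ (2 * s)) (Ioi 0) := by
    simpa using (SubExp.one_add_rpow (2 * s) (by positivity)).integrableOn_besselK0_mul one_pos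
  have hlim := tendsto_integral_filter_of_dominated_convergence (l := 𝓝[>] 0)
    (μ := volume.restrict (Ioi (0 : ℝ))) (F := fun x y : ℝ => besselK0 (2 * y) *
      (x ^ (2 * s - 1) * (Real.cosh (2 * s * Real.arsinh (y / x)) / √(1 + (y / x) ^ 2))))
    (f := fun y => besselK0 (2 * y) * (2 * y) ^ (2 * s - 1)) _ ?_ ?_
    ((hi1.const_mul (2 ^ (2 * s) * 2 ^ (1 - 2 * s))).add (hi2.const_mul (2 ^ (2 * s)))) ?_
  · rw [← integral_besselK0_two_mul_rpow hs]
    refine hlim.congr' ?_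
    filter_upwards [self_mem_nhdsWithin] with x hx
    have hx0 : (0 : ℝ) < x := hx
    have h1 : x ^ (2 * s) = x ^ (2 * s - 1) * x := by
      rw [Real.rpow_sub_one hx0.ne']; field_simp
    rw [h1, mul_assoc, nicholsonP_scaled s hx0, ← integral_const_mul]
    refine integral_congr_ae (Eventually.of_forall fun y => ?_)
    simp only
    ring
  · filter_upwards [self_mem_nhdsWithin] with x hx
    have hx0 : (0 : ℝ) < x := hx
    have hc := (continuousOn_besselK0_mul one_pos).mul
      ((SubExp.comp_div (subExp_nicholsonP s).1 hx0).const_smul (x ^ (2 * s - 1)))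
    simp only [mul_one] at hc
    exact hc.aestronglyMeasurable measurableSet_Ioi
  · filter_upwards [Ioo_mem_nhdsGT one_pos] with x hx
    refine (ae_restrict_iff' measurableSet_Ioi).2 (Eventually.of_forall fun y hy => ?_)
    have hy0 : (0 : ℝ) < y := hy
    have hx0 : (0 : ℝ) < x := hx.1
    have hK := besselK0_pos (by positivity : 0 < 2 * y)
    rw [rpow_mul_cosh_div hx0 hy0]
    set r := √(x ^ 2 + y ^ 2) with hrdef
    have hr : 0 < r := Real.sqrt_pos.2 (by positivity)
    have hyr : y ≤ r := Real.le_sqrt_of_sq_le (by nlinarith)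
    have hxr : x ≤ r := Real.le_sqrt_of_sq_le (by nlinarith)
    have hr1 : r ≤ 1 + y := Real.sqrt_le_iff.2 ⟨by positivity, by nlinarith [hx.2]⟩
    rw [Real.norm_of_nonneg (by positivity)]
    have hb1 : (y + r) ^ (2 * s) ≤ 2 ^ (2 * s) * r ^ (2 * s) := by
      rw [← Real.mul_rpow (by norm_num) hr.le]
      exact Real.rpow_le_rpow (by positivity) (by linarith) (by positivity)
    have hb2 : x ^ (4 * s) * (y + r) ^ (-(2 * s)) ≤ r ^ (2 * s) := by
      calc _ ≤ r ^ (4 * s) * r ^ (-(2 * s)) := by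
            gcongr ?_ * ?_
            · exact Real.rpow_le_rpow hx0.le hxr (by positivity)
            · exact Real.rpow_le_rpow_of_nonpos hr (by linarith) (by linarith)
        _ = _ := by rw [← Real.rpow_add hr]; ring_nf
    have h2s : (1 : ℝ) ≤ 2 ^ (2 * s) := Real.one_le_rpow (by norm_num) (by positivity)
    have hr2 : 0 < r ^ (2 * s) := Real.rpow_pos_of_pos hr _
    have hb3 : ((y + r) ^ (2 * s) + x ^ (4 * s) * (y + r) ^ (-(2 * s))) / 2 / r ≤
        2 ^ (2 * s) * r ^ (2 * s - 1) := by
      rw [Real.rpow_sub_one hr.ne', mul_div_assoc']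
      gcongr
      nlinarith
    -- Since y ≤ r ≤ 1 + y, one of the two summands dominates according to the sign of 2s − 1.
    have hb4 : r ^ (2 * s - 1) ≤ y ^ (2 * s - 1) + (1 + y) ^ (2 * s) := by
      rcases le_total 0 (2 * s - 1) with h | h
      · have h5 : r ^ (2 * s - 1) ≤ (1 + y) ^ (2 * s - 1) := Real.rpow_le_rpow hr.le hr1 h
        have h6 : (1 + y) ^ (2 * s - 1) ≤ (1 + y) ^ (2 * s) :=
          Real.rpow_le_rpow_of_exponent_le (by linarith) (by linarith)
        have h7 : 0 < y ^ (2 * s - 1) := Real.rpow_pos_of_pos hy0 _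
        linarith
      · have h5 : r ^ (2 * s - 1) ≤ y ^ (2 * s - 1) := Real.rpow_le_rpow_of_nonpos hy0 hyr h
        have h7 : 0 < (1 + y) ^ (2 * s) := Real.rpow_pos_of_pos (by positivity) _
        linarith
    have h8 : y ^ (2 * s - 1) = 2 ^ (1 - 2 * s) * (2 * y) ^ (2 * s - 1) := by
      rw [Real.mul_rpow (by norm_num) hy0.le, ← mul_assoc, ← Real.rpow_add (by norm_num)]
      norm_num
    calc _ ≤ besselK0 (2 * y) * (2 ^ (2 * s) * (y ^ (2 * s - 1) + (1 + y) ^ (2 * s))) := by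
          gcongr
          exact hb3.trans (by gcongr)
      _ = _ := by rw [h8]; simp only [Pi.add_apply]; ring
  · refine (ae_restrict_iff' measurableSet_Ioi).2 (Eventually.of_forall fun y hy => ?_)
    have hy0 : (0 : ℝ) < y := hy
    have hcont : ContinuousAt (fun x : ℝ => besselK0 (2 * y) * (((y + √(x ^ 2 + y ^ 2)) ^ (2 * s) +
        x ^ (4 * s) * (y + √(x ^ 2 + y ^ 2)) ^ (-(2 * s))) / 2 / √(x ^ 2 + y ^ 2))) 0 := by
      have hne : y + √((0 : ℝ) ^ 2 + y ^ 2) ≠ 0 := by positivity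
      have hc0 : ContinuousAt (fun x : ℝ => y + √(x ^ 2 + y ^ 2)) 0 := by fun_prop
      refine continuousAt_const.mul (((((hc0.rpow_const (Or.inl hne)).add
        ((Real.continuousAt_rpow_const 0 (4 * s) (Or.inr (by positivity))).mul
        (hc0.rpow_const (Or.inl hne)))).div_const 2)).div (by fun_prop) ?_)
      have : 0 < (0 : ℝ) ^ 2 + y ^ 2 := by positivity
      exact (Real.sqrt_pos.2 this).ne'
    have h := (hcont.tendsto).mono_left (nhdsWithin_le_nhds (s := Ioi 0))
    have hval : ((y + √((0 : ℝ) ^ 2 + y ^ 2)) ^ (2 * s) +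
        (0 : ℝ) ^ (4 * s) * (y + √((0 : ℝ) ^ 2 + y ^ 2)) ^ (-(2 * s))) / 2 / √((0 : ℝ) ^ 2 + y ^ 2) =
        (2 * y) ^ (2 * s - 1) := by
      rw [Real.zero_rpow (by positivity)]
      norm_num
      rw [Real.sqrt_sq hy0.le, ← two_mul, Real.rpow_sub_one (by positivity), div_div]
    rw [hval] at h
    refine h.congr' ?_
    filter_upwards [self_mem_nhdsWithin] with x hx
    rw [rpow_mul_cosh_div hx hy0]

theorem continuous_nicholsonP_order {x : ℝ} (hx : 0 < x) : Continuous fun ν => nicholsonP ν x := by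
  refine continuous_iff_continuousAt.2 fun ν₀ => ?_
  refine continuousAt_of_dominated (bound := fun y => besselK0 (2 * x * y) *
    Real.cosh (2 * (|ν₀| + 1) * Real.arsinh y)) ?_ ?_
    ((subExp_cosh _).integrableOn_besselK0_mul hx) ?_
  · exact Eventually.of_forall fun ν => ((subExp_nicholsonP ν).integrableOn_besselK0_mul hx).1
  · filter_upwards [Metric.ball_mem_nhds ν₀ one_pos] with ν hν
    refine (ae_restrict_iff' measurableSet_Ioi).2 (Eventually.of_forall fun y hy => ?_)
    have hy0 : (0 : ℝ) < y := hy
    have hK := besselK0_pos (by positivity : 0 < 2 * x * y)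
    have hc := Real.cosh_pos (2 * ν * Real.arsinh y)
    rw [Real.norm_of_nonneg (by positivity)]
    gcongr
    refine (div_le_self hc.le (one_le_sqrt_one_add_sq _)).trans ?_
    have hν' : |ν| ≤ |ν₀| + 1 := by
      have h1 : |ν - ν₀| < 1 := hν
      have h2 := abs_sub_abs_le_abs_sub ν ν₀
      linarith
    have ha := Real.arsinh_nonneg_iff.2 hy0.le
    rw [Real.cosh_le_cosh, abs_mul, abs_mul, abs_mul, abs_mul, abs_of_nonneg ha,
      abs_of_nonneg (by positivity : 0 ≤ |ν₀| + 1)]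
    gcongr
  · refine Eventually.of_forall fun y => Continuous.continuousAt ?_
    fun_prop

theorem continuous_nicholsonR_order {x : ℝ} (hx : 0 < x) : Continuous fun ν => nicholsonR ν x := by
  refine continuous_iff_continuousAt.2 fun ν₀ => ?_
  refine continuousAt_of_dominated (bound := fun y => besselK1 (2 * x * y) *
    (y * (2 * (2 * |ν₀| + 3) * Real.cosh ((2 * |ν₀| + 3) * Real.arsinh y)))) ?_ ?_
    (((subExp_const _).mul (subExp_cosh _)).integrableOn_besselK1_mul hx) ?_
  · exact Eventually.of_forall fun ν => ((subExp_nicholsonR ν).integrableOn_besselK1_mul hx).1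
  · filter_upwards [Metric.ball_mem_nhds ν₀ one_pos] with ν hν
    refine (ae_restrict_iff' measurableSet_Ioi).2 (Eventually.of_forall fun y hy => ?_)
    have hy0 : (0 : ℝ) < y := hy
    have hK := besselK1_pos (by positivity : 0 < 2 * x * y)
    have hs := one_le_sqrt_one_add_sq y
    have hν' : |2 * ν + 1| ≤ 2 * |ν₀| + 3 := by
      have h1 : |ν - ν₀| < 1 := hν
      have h2 := abs_sub_abs_le_abs_sub ν ν₀
      have h3 := abs_add_le (2 * ν) 1
      rw [abs_mul, abs_two, abs_one] at h3
      linarith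
    have ha := Real.arsinh_nonneg_iff.2 hy0.le
    rw [norm_mul, Real.norm_of_nonneg hK.le]
    gcongr
    rw [mul_div_div_cancel_left_of_ne_zero hy0.ne', Real.norm_eq_abs, abs_div,
      abs_of_pos (by linarith : 0 < √(1 + y ^ 2))]
    calc _ ≤ |Real.sinh ((2 * ν + 1) * Real.arsinh y)| := div_le_self (abs_nonneg _) hs
      _ ≤ 2 * |2 * ν + 1| * y * Real.cosh ((2 * ν + 1) * Real.arsinh y) :=
        abs_sinh_mul_arsinh_le _ hy0.le
      _ ≤ 2 * (2 * |ν₀| + 3) * y * Real.cosh ((2 * |ν₀| + 3) * Real.arsinh y) := by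
        gcongr 2 * ?_ * y * ?_
        rw [Real.cosh_le_cosh, abs_mul, abs_mul, abs_of_nonneg ha,
          abs_of_nonneg (by positivity : 0 ≤ 2 * |ν₀| + 3)]
        gcongr
      _ = _ := by ring
  · refine Eventually.of_forall fun y => Continuous.continuousAt ?_
    fun_prop
end

/-! ### Nicholson's formula for non-integer order -/

/-- The invariant pairing of Nicholson's integrals with two solutions of the Bessel system. -/
noncomputable def nicholsonForm (ν : ℝ) (A B A' B' : ℝ → ℝ) (x : ℝ) : ℝ :=
  x ^ 2 * (A x * A' x * nicholsonP (ν + 1) x - (A x * B' x + B x * A' x) * nicholsonR ν x +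
    B x * B' x * nicholsonP ν x)

/-- For P_ν, R_ν, P_{ν+1} replaced by C², CD, D² and (A', B') = (A, B), the form is the squared
Wronskian x²(AD − BC)². Its constancy uses only the linear equations, which Nicholson's integrals
share, and it polarizes. -/
theorem IsBesselPair.hasDerivAt_nicholsonForm {ν : ℝ} {A B A' B' : ℝ → ℝ}
    (h : IsBesselPair ν A B) (h' : IsBesselPair ν A' B') {x : ℝ} (hx : 0 < x) :
    HasDerivAt (nicholsonForm ν A B A' B') 0 x := by
  obtain ⟨hA, hB⟩ := h x hx
  obtain ⟨hA', hB'⟩ := h' x hx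
  have hP := hasDerivAt_nicholsonP ν hx
  have hQ := hasDerivAt_nicholsonP_add_one ν hx
  have hR := hasDerivAt_nicholsonR ν hx
  refine (((hasDerivAt_id x).pow 2).mul ((((hA.mul hA').mul hQ).sub
    (((hA.mul hB').add (hB.mul hA')).mul hR)).add ((hB.mul hB').mul hP))).congr_deriv ?_
  simp only [id, Pi.add_apply, Pi.mul_apply, Pi.sub_apply, Pi.pow_apply]
  field_simp
  ring

/-- The discriminant of the same linear system is conserved; at infinity xP_ν and xP_{ν+1} tend to
π/4 and xR_ν to 0. -/
theorem nicholson_discriminant (ν : ℝ) {x : ℝ} (hx : 0 < x) :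
    x ^ 2 * (nicholsonP ν x * nicholsonP (ν + 1) x - nicholsonR ν x ^ 2) = (Real.pi / 4) ^ 2 := by
  refine eq_of_tendsto_of_hasDerivAt_zero
    (f := fun x => x ^ 2 * (nicholsonP ν x * nicholsonP (ν + 1) x - nicholsonR ν x ^ 2))
    (eventually_gt_atTop 0) (fun x hx => ?_) ?_ hx
  · refine (((hasDerivAt_id x).pow 2).mul (((hasDerivAt_nicholsonP ν hx).mul
      (hasDerivAt_nicholsonP_add_one ν hx)).sub ((hasDerivAt_nicholsonR ν hx).pow 2))).congr_deriv ?_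
    simp only [id, Pi.mul_apply, Pi.sub_apply, Pi.pow_apply]
    field_simp
    ring
  · have h := ((tendsto_mul_nicholsonP ν).mul (tendsto_mul_nicholsonP (ν + 1))).sub
      ((tendsto_mul_nicholsonR ν).pow 2)
    have h2 : Real.pi / 4 * (Real.pi / 4) - 0 ^ 2 = (Real.pi / 4) ^ 2 := by ring
    rw [h2] at h
    refine h.congr fun x => ?_
    ring

theorem tendsto_rpow_neg_mul_besselJ (ν : ℝ) :
    Tendsto (fun x => x ^ (-ν) * besselJ ν x) (𝓝[>] 0)
      (𝓝 (2 ^ (-ν) * (Real.Gamma (ν + 1))⁻¹)) := by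
  have hc : Continuous fun x : ℝ => 2 ^ (-ν) * besselE ν ((x / 2) ^ 2) := by
    have := continuous_besselE ν
    fun_prop
  have h := (hc.tendsto 0).mono_left (nhdsWithin_le_nhds (s := Set.Ioi 0))
  rw [zero_div, zero_pow two_ne_zero, besselE_zero] at h
  refine h.congr' ?_
  filter_upwards [self_mem_nhdsWithin] with x hx
  have hx0 : (0 : ℝ) < x := hx
  rw [besselJ_eq, ← mul_assoc, Real.div_rpow hx0.le zero_le_two, Real.rpow_neg hx0.le,
    Real.rpow_neg zero_le_two]
  have := Real.rpow_pos_of_pos hx0 ν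
  field_simp

/-- The constant is read off at x → 0. The range of ν makes both ν + 1 and −ν positive, so the
small-x limits of P_{ν+1} and P_ν = P_{−ν} apply. Only the term with J_ν² survives, its Gamma
factors cancelling to 1/2; the term with J_{ν+1}² is of order x^{4+4ν}. -/
theorem nicholsonForm_besselJ {ν : ℝ} (h1 : -1 < ν) (h0 : ν < 0) {x : ℝ} (hx : 0 < x) :
    nicholsonForm ν (besselJ ν) (besselJ (ν + 1)) (besselJ ν) (besselJ (ν + 1)) x = 1 / 2 := by
  refine eq_of_tendsto_of_hasDerivAt_zero (l := 𝓝[>] 0) self_mem_nhdsWithin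
    (fun x hx => (isBesselPair_besselJ ν).hasDerivAt_nicholsonForm (isBesselPair_besselJ ν) hx)
    ?_ hx
  have hG : 0 < Real.Gamma (ν + 1) := Real.Gamma_pos_of_pos (by linarith)
  have hT1 : Tendsto (fun x => x ^ 2 * besselJ ν x ^ 2 * nicholsonP (ν + 1) x) (𝓝[>] 0)
      (𝓝 (1 / 2)) := by
    have h := ((tendsto_rpow_neg_mul_besselJ ν).pow 2).mul
      (tendsto_rpow_mul_nicholsonP (s := ν + 1) (by linarith))
    have hval : (2 ^ (-ν) * (Real.Gamma (ν + 1))⁻¹) ^ 2 *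
        (2 ^ (2 * (ν + 1) - 2) * Real.Gamma (ν + 1) ^ 2 / 2) = 1 / 2 := by
      have h2 : (2 : ℝ) ^ (2 * (ν + 1) - 2) = 2 ^ ν * 2 ^ ν := by
        rw [← Real.rpow_add two_pos]; ring_nf
      have h3 := Real.rpow_pos_of_pos two_pos ν
      rw [h2, Real.rpow_neg zero_le_two]
      field_simp
    rw [hval] at h
    refine h.congr' ?_
    filter_upwards [self_mem_nhdsWithin] with x hx
    have hx0 : (0 : ℝ) < x := hx
    have h2 : x ^ (2 * (ν + 1)) = x ^ ν * x ^ ν * x ^ 2 := by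
      rw [← Real.rpow_add hx0, ← Real.rpow_natCast x 2, ← Real.rpow_add hx0]
      congr 1; push_cast; ring
    have h3 := Real.rpow_pos_of_pos hx0 ν
    rw [h2, Real.rpow_neg hx0.le]
    field_simp
  have hT3 : Tendsto (fun x => x ^ 2 * besselJ (ν + 1) x ^ 2 * nicholsonP ν x) (𝓝[>] 0)
      (𝓝 0) := by
    have h := ((tendsto_rpow_neg_mul_besselJ (ν + 1)).pow 2).mul
      (tendsto_rpow_mul_nicholsonP (s := -ν) (by linarith))
    have hp : Tendsto (fun x : ℝ => x ^ (4 + 4 * ν)) (𝓝[>] 0) (𝓝 0) := by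
      have h4 := (Real.continuous_rpow_const (q := 4 + 4 * ν) (by linarith)).tendsto 0
      rw [Real.zero_rpow (by linarith)] at h4
      exact h4.mono_left nhdsWithin_le_nhds
    have h5 := hp.mul h
    rw [zero_mul] at h5
    refine h5.congr' ?_
    filter_upwards [self_mem_nhdsWithin] with x hx
    have hx0 : (0 : ℝ) < x := hx
    have h2 : x ^ (4 + 4 * ν) * ((x ^ (-(ν + 1))) ^ 2 * x ^ (2 * -ν)) = x ^ 2 := by
      rw [← Real.rpow_natCast (x ^ (-(ν + 1))) 2, ← Real.rpow_mul hx0.le, ← Real.rpow_add hx0,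
        ← Real.rpow_add hx0, ← Real.rpow_natCast x 2]
      congr 1; push_cast; ring
    rw [← h2, nicholsonP_neg]
    ring
  have hT2 : Tendsto (fun x => x ^ 2 * (2 * besselJ ν x * besselJ (ν + 1) x) * nicholsonR ν x)
      (𝓝[>] 0) (𝓝 0) := by
    -- Positivity of the discriminant gives R_ν² ≤ P_ν P_{ν+1}, so the cross term is at most twice
    -- the geometric mean of the other two and no limit of R_ν at 0 is needed.
    have h := ((hT1.mul hT3).const_mul 4).sqrt
    rw [mul_zero, mul_zero, Real.sqrt_zero] at h
    refine squeeze_zero_norm' ?_ h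
    filter_upwards [self_mem_nhdsWithin] with x hx
    have hx0 : (0 : ℝ) < x := hx
    refine Real.abs_le_sqrt ?_
    have hd := nicholson_discriminant ν hx0
    have hd2 : 0 ≤ x ^ 2 * (nicholsonP ν x * nicholsonP (ν + 1) x - nicholsonR ν x ^ 2) := by
      rw [hd]; positivity
    have h6 := mul_nonneg (by positivity : 0 ≤ 4 * (x * besselJ ν x * besselJ (ν + 1) x) ^ 2) hd2
    linarith
  have h := (hT1.sub hT2).add hT3
  rw [sub_zero, add_zero] at h
  refine h.congr fun x => ?_
  rw [nicholsonForm]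
  ring

theorem nicholsonForm_besselJ_neg {ν : ℝ} (h1 : -1 < ν) (h0 : ν < 0) {x : ℝ} (hx : 0 < x) :
    nicholsonForm ν (besselJ (-ν)) (fun x => -besselJ (-ν - 1) x) (besselJ (-ν))
      (fun x => -besselJ (-ν - 1) x) x = 1 / 2 := by
  rw [← nicholsonForm_besselJ (ν := -ν - 1) (by linarith) (by linarith) hx, nicholsonForm,
    nicholsonForm, nicholsonR_neg_sub_one, show -ν - 1 + 1 = -ν by ring, nicholsonP_neg,
    show -ν - 1 = -(ν + 1) by ring, nicholsonP_neg]
  ring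

/-- The mixed pairing of `J_ν` and `J_{-ν}`. -/
noncomputable def nicholsonMixed (ν x : ℝ) : ℝ :=
  nicholsonForm ν (besselJ ν) (besselJ (ν + 1)) (besselJ (-ν)) (fun x => -besselJ (-ν - 1) x) x

/-- Lagrange's identity for a binary quadratic form: mixed² = (product of the two diagonal values) −
Wronskian² · discriminant. Here it reads 1/4 − sin²(νπ)/4. -/
theorem nicholsonMixed_sq {ν : ℝ} (h1 : -1 < ν) (h0 : ν < 0) {x : ℝ} (hx : 0 < x) :
    nicholsonMixed ν x ^ 2 = (Real.cos (ν * Real.pi) / 2) ^ 2 := by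
  have ha := nicholsonForm_besselJ h1 h0 hx
  have hc := nicholsonForm_besselJ_neg h1 h0 hx
  have hd := nicholson_discriminant ν hx
  have hw := wronskian_besselJ_neg ν hx
  have h : nicholsonMixed ν x ^ 2 =
      nicholsonForm ν (besselJ ν) (besselJ (ν + 1)) (besselJ ν) (besselJ (ν + 1)) x *
      nicholsonForm ν (besselJ (-ν)) (fun x => -besselJ (-ν - 1) x) (besselJ (-ν))
        (fun x => -besselJ (-ν - 1) x) x -
      (x * (besselJ ν x * -besselJ (-ν - 1) x - besselJ (ν + 1) x * besselJ (-ν) x)) ^ 2 *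
      (x ^ 2 * (nicholsonP ν x * nicholsonP (ν + 1) x - nicholsonR ν x ^ 2)) := by
    simp only [nicholsonMixed, nicholsonForm]
    ring
  rw [h, ha, hc, hd, hw]
  have := Real.pi_ne_zero
  have h2 := Real.sin_sq_add_cos_sq (ν * Real.pi)
  field_simp
  linear_combination -(16 : ℝ) * h2

theorem nicholsonMixed_neg_sub_one (ν x : ℝ) : nicholsonMixed (-ν - 1) x = -nicholsonMixed ν x := by
  simp only [nicholsonMixed, nicholsonForm]
  rw [nicholsonR_neg_sub_one, show -ν - 1 + 1 = -ν by ring, nicholsonP_neg,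
    show -(-ν - 1) = ν + 1 by ring, show -ν - 1 = -(ν + 1) by ring, nicholsonP_neg,
    show ν + 1 - 1 = ν by ring]
  ring

theorem continuous_besselJ_order {x : ℝ} (hx : 0 < x) : Continuous fun ν => besselJ ν x :=
  (differentiable_besselJ_order hx).continuous

theorem continuous_nicholsonMixed {x : ℝ} (hx : 0 < x) : Continuous fun ν => nicholsonMixed ν x := by
  have hJ := continuous_besselJ_order hx
  have h1 : Continuous fun ν => besselJ (ν + 1) x := hJ.comp (by fun_prop)
  have h2 : Continuous fun ν => besselJ (-ν) x := hJ.comp (by fun_prop)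
  have h3 : Continuous fun ν => besselJ (-ν - 1) x := hJ.comp (by fun_prop)
  have h4 := continuous_nicholsonP_order hx
  have h5 : Continuous fun ν => nicholsonP (ν + 1) x := h4.comp (by fun_prop)
  have h6 := continuous_nicholsonR_order hx
  unfold nicholsonMixed nicholsonForm
  fun_prop

theorem nicholsonMixed_zero {x : ℝ} (hx : 0 < x) : nicholsonMixed 0 x = 1 / 2 := by
  have hJ := continuous_besselJ_order hx
  have h1 : Continuous fun ν => besselJ (ν + 1) x := hJ.comp (by fun_prop)
  have h4 := continuous_nicholsonP_order hx
  have h5 : Continuous fun ν => nicholsonP (ν + 1) x := h4.comp (by fun_prop)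
  have h6 := continuous_nicholsonR_order hx
  have hc : Continuous fun ν =>
      nicholsonForm ν (besselJ ν) (besselJ (ν + 1)) (besselJ ν) (besselJ (ν + 1)) x := by
    unfold nicholsonForm
    fun_prop
  have hlim := (hc.tendsto 0).mono_left (nhdsWithin_le_nhds (s := Set.Iio 0))
  have hconst : Tendsto (fun ν =>
      nicholsonForm ν (besselJ ν) (besselJ (ν + 1)) (besselJ ν) (besselJ (ν + 1)) x)
      (𝓝[<] 0) (𝓝 (1 / 2)) := by
    refine tendsto_const_nhds.congr' ?_
    filter_upwards [Ioo_mem_nhdsLT (by norm_num : (-1 : ℝ) < 0)] with ν hν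
    exact (nicholsonForm_besselJ hν.1 hν.2 hx).symm
  rw [← tendsto_nhds_unique hlim hconst, nicholsonMixed]
  -- At order −1 the coefficient 2(ν + 1) of the recurrence vanishes, so J_{−1} = −J_1 and at ν = 0
  -- the mixed pairing is the diagonal one.
  have hJ1 := besselJ_three_term (-1) hx
  rw [show (-1 : ℝ) + 2 = 1 by norm_num, show (-1 : ℝ) + 1 = 0 by norm_num] at hJ1
  rw [mul_zero, zero_div, zero_mul] at hJ1
  have hJ2 : -besselJ (-1) x = besselJ 1 x := by linarith [hJ1]
  simp only [nicholsonForm, neg_zero, zero_sub, zero_add, hJ2]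

/-- The square leaves a sign undetermined. On (−1/2, 0) the cosine does not vanish, so by continuity
in ν the sign is the one at ν = 0, namely positive. -/
theorem nicholsonMixed_eq_of_half_lt {ν : ℝ} (h1 : -(1 / 2) < ν) (h0 : ν < 0) {x : ℝ}
    (hx : 0 < x) : nicholsonMixed ν x = Real.cos (ν * Real.pi) / 2 := by
  have hcos : ∀ μ : ℝ, -(1 / 2) < μ → μ < 0 → 0 < Real.cos (μ * Real.pi) := fun μ h h' =>
    Real.cos_pos_of_mem_Ioo ⟨by nlinarith [Real.pi_pos], by nlinarith [Real.pi_pos]⟩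
  rcases sq_eq_sq_iff_eq_or_eq_neg.1 (nicholsonMixed_sq (by linarith) h0 hx) with h | h
  · exact h
  · exfalso
    have hneg : nicholsonMixed ν x < 0 := by rw [h]; linarith [hcos ν h1 h0]
    have hpos : (0 : ℝ) < nicholsonMixed 0 x := by rw [nicholsonMixed_zero hx]; norm_num
    obtain ⟨μ, hμ, hμ0⟩ := intermediate_value_Ioo h0.le
      (continuous_nicholsonMixed hx).continuousOn ⟨hneg, hpos⟩
    have h2 := nicholsonMixed_sq (by linarith [hμ.1]) hμ.2 hx
    have h3 := hcos μ (h1.trans hμ.1) hμ.2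
    simp only at hμ0
    rw [hμ0] at h2
    nlinarith

theorem nicholsonMixed_eq {ν : ℝ} (h1 : -1 < ν) (h0 : ν < 0) {x : ℝ} (hx : 0 < x) :
    nicholsonMixed ν x = Real.cos (ν * Real.pi) / 2 := by
  rcases lt_trichotomy ν (-(1 / 2)) with h | h | h
  · have h2 := nicholsonMixed_eq_of_half_lt (ν := -ν - 1) (by linarith) (by linarith) hx
    rw [nicholsonMixed_neg_sub_one, show (-ν - 1) * Real.pi = -(ν * Real.pi + Real.pi) by ring,
      Real.cos_neg, Real.cos_add_pi] at h2
    linarith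
  · have h2 := nicholsonMixed_sq h1 h0 hx
    have h3 : Real.cos (ν * Real.pi) = 0 := by
      rw [h, show -(1 / 2) * Real.pi = -(Real.pi / 2) by ring, Real.cos_neg, Real.cos_pi_div_two]
    rw [h3] at h2 ⊢
    simpa using h2
  · exact nicholsonMixed_eq_of_half_lt h h0 hx

theorem not_int_of_Ioo {ν : ℝ} {n : ℤ} (h1 : (n : ℝ) < ν) (h2 : ν < n + 1) :
    ¬∃ k : ℤ, (k : ℝ) = ν := by
  rintro ⟨k, rfl⟩
  have h3 : n < k := by exact_mod_cast h1
  have h4 : k < n + 1 := by exact_mod_cast h2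
  omega

/-- Evaluating the pairing on the combination of J_ν and J_{−ν} that vanishes at x isolates P_ν(x)
times the squared Wronskian. With the three known constants the other side is J_ν² − 2 cos(νπ) J_ν
J_{−ν} + J_{−ν}² over 2, that is sin²(νπ) N_ν / 2. -/
theorem besselN_eq_nicholsonP_of_neg {ν : ℝ} (h1 : -1 < ν) (h0 : ν < 0) {x : ℝ} (hx : 0 < x) :
    besselN ν x = 8 / Real.pi ^ 2 * nicholsonP ν x := by
  have hν : ¬∃ n : ℤ, (n : ℝ) = ν := not_int_of_Ioo (n := -1) (by simpa) (by simpa)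
  have hs := sin_mul_pi_ne_zero hν
  have ha := nicholsonForm_besselJ h1 h0 hx
  have hc := nicholsonForm_besselJ_neg h1 h0 hx
  have hb := nicholsonMixed_eq h1 h0 hx
  have hw := wronskian_besselJ_neg ν hx
  have h : nicholsonForm ν (besselJ ν) (besselJ (ν + 1)) (besselJ ν) (besselJ (ν + 1)) x *
      besselJ (-ν) x ^ 2 - 2 * nicholsonMixed ν x * besselJ ν x * besselJ (-ν) x +
      nicholsonForm ν (besselJ (-ν)) (fun x => -besselJ (-ν - 1) x) (besselJ (-ν))
        (fun x => -besselJ (-ν - 1) x) x * besselJ ν x ^ 2 =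
      (x * (besselJ ν x * -besselJ (-ν - 1) x - besselJ (ν + 1) x * besselJ (-ν) x)) ^ 2 *
        nicholsonP ν x := by
    simp only [nicholsonMixed, nicholsonForm]
    ring
  rw [ha, hc, hb, hw] at h
  rw [besselN, besselY_of_not_int hν]
  have h2 := Real.sin_sq_add_cos_sq (ν * Real.pi)
  have hpi := Real.pi_ne_zero
  field_simp at h ⊢
  linear_combination Real.pi ^ 2 * besselJ ν x ^ 2 * h2 + h

/-! ### The real part of `H_ν conj(H_{ν+1})` -/

/-- `J_ν J_{ν+1} + Y_ν Y_{ν+1}`. -/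
noncomputable def besselS (ν x : ℝ) : ℝ :=
  besselJ ν x * besselJ (ν + 1) x + besselY ν x * besselY (ν + 1) x

theorem hasDerivAt_besselN {ν : ℝ} (hY : IsBesselPair ν (besselY ν) (besselY (ν + 1))) {x : ℝ}
    (hx : 0 < x) : HasDerivAt (besselN ν) (2 * ν / x * besselN ν x - 2 * besselS ν x) x := by
  refine (((isBesselPair_besselJ ν x hx).1.pow 2).add ((hY x hx).1.pow 2)).congr_deriv ?_
  simp only [besselN, besselS]
  push_cast
  ring

theorem hasDerivAt_besselS {ν : ℝ} (hY : IsBesselPair ν (besselY ν) (besselY (ν + 1))) {x : ℝ}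
    (hx : 0 < x) :
    HasDerivAt (besselS ν) (besselN ν x - besselN (ν + 1) x - besselS ν x / x) x := by
  obtain ⟨h1, h2⟩ := isBesselPair_besselJ ν x hx
  obtain ⟨h3, h4⟩ := hY x hx
  refine ((h1.mul h2).add (h3.mul h4)).congr_deriv ?_
  simp only [besselN, besselS]
  ring

theorem besselS_eq_nicholsonR {ν : ℝ} (hY : IsBesselPair ν (besselY ν) (besselY (ν + 1)))
    (h : ∀ x, 0 < x → besselN ν x = 8 / Real.pi ^ 2 * nicholsonP ν x) {x : ℝ} (hx : 0 < x) :
    besselS ν x = 8 / Real.pi ^ 2 * nicholsonR ν x := by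
  have h1 := (hasDerivAt_nicholsonP ν hx).const_mul (8 / Real.pi ^ 2)
  have h2 := h1.congr_of_eventuallyEq ((eventually_gt_nhds hx).mono fun z hz => h z hz)
  have h3 := h2.unique (hasDerivAt_besselN hY hx)
  rw [h x hx] at h3
  linear_combination h3 / 2

/-- An identity valid for all x > 0 may be differentiated: the first derivative identifies R_ν, the
second identifies P_{ν+1}. The order is raised with no new constant to determine. -/
theorem besselN_add_one_eq_nicholsonP {ν : ℝ}
    (hY : IsBesselPair ν (besselY ν) (besselY (ν + 1)))
    (h : ∀ x, 0 < x → besselN ν x = 8 / Real.pi ^ 2 * nicholsonP ν x) {x : ℝ} (hx : 0 < x) :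
    besselN (ν + 1) x = 8 / Real.pi ^ 2 * nicholsonP (ν + 1) x := by
  have h1 := (hasDerivAt_nicholsonR ν hx).const_mul (8 / Real.pi ^ 2)
  have h2 := h1.congr_of_eventuallyEq
    ((eventually_gt_nhds hx).mono fun z hz => besselS_eq_nicholsonR hY h hz)
  have h3 := h2.unique (hasDerivAt_besselS hY hx)
  rw [h x hx, besselS_eq_nicholsonR hY h hx] at h3
  linear_combination h3

theorem besselN_eq_nicholsonP_of_not_int (n : ℕ) : ∀ ν : ℝ, (n : ℝ) - 1 < ν → ν < n →
    ∀ x, 0 < x → besselN ν x = 8 / Real.pi ^ 2 * nicholsonP ν x := by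
  induction n with
  | zero =>
    intro ν h1 h2 x hx
    exact besselN_eq_nicholsonP_of_neg (by simpa using h1) (by simpa using h2) hx
  | succ n ih =>
    intro ν h1 h2 x hx
    push_cast at h1 h2
    have hν : ¬∃ k : ℤ, (k : ℝ) = ν - 1 :=
      not_int_of_Ioo (n := (n : ℤ) - 1) (by push_cast; linarith) (by push_cast; linarith)
    have h := besselN_add_one_eq_nicholsonP (isBesselPair_besselY_of_not_int hν)
      (ih (ν - 1) (by linarith) (by linarith)) hx
    rwa [sub_add_cancel] at h

section
open MeasureTheory Set

/-! ### `Y_ν` of integer order -/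

/-- The differential system is passed to the limit in integrated form, where pointwise convergence
and a continuous majorant suffice. Continuity and then differentiability of the limit are recovered
from the integral equation by the next two lemmas. -/
theorem intervalIntegral_of_tendsto {f g : ℕ → ℝ → ℝ} {f' g' B : ℝ → ℝ}
    (hf : ∀ j x, 0 < x → HasDerivAt (f j) (g j x) x) (hg : ∀ j, ContinuousOn (g j) (Ioi 0))
    (hff : ∀ x, 0 < x → Tendsto (fun j => f j x) atTop (𝓝 (f' x)))
    (hgg : ∀ x, 0 < x → Tendsto (fun j => g j x) atTop (𝓝 (g' x)))
    (hB : ContinuousOn B (Ioi 0)) (hgB : ∀ j x, 0 < x → |g j x| ≤ B x) {a x : ℝ}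
    (ha : 0 < a) (hx : 0 < x) :
    IntervalIntegrable g' volume a x ∧ f' x = f' a + ∫ s in a..x, g' s := by
  have hsub : uIcc a x ⊆ Ioi 0 := fun s hs => (lt_min ha hx).trans_le hs.1
  have hsub' : uIoc a x ⊆ Ioi 0 := uIoc_subset_uIcc.trans hsub
  have hBi : IntervalIntegrable B volume a x := (hB.mono hsub).intervalIntegrable
  have hlim : Tendsto (fun j => ∫ s in a..x, g j s) atTop (𝓝 (∫ s in a..x, g' s)) := by
    refine intervalIntegral.tendsto_integral_filter_of_dominated_convergence B
      (Eventually.of_forall fun j => ?_) (Eventually.of_forall fun j =>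
      Eventually.of_forall fun s hs => hgB j s (hsub' hs)) hBi
      (Eventually.of_forall fun s hs => hgg s (hsub' hs))
    exact ((hg j).mono hsub').aestronglyMeasurable measurableSet_uIoc
  constructor
  · rw [intervalIntegrable_iff] at hBi ⊢
    refine hBi.mono' ?_ ((ae_restrict_iff' measurableSet_uIoc).2 (Eventually.of_forall fun s hs => ?_))
    · refine aestronglyMeasurable_of_tendsto_ae atTop
        (f := fun j => g j) (fun j => ((hg j).mono hsub').aestronglyMeasurable measurableSet_uIoc)
        ((ae_restrict_iff' measurableSet_uIoc).2 (Eventually.of_forall fun s hs => hgg s (hsub' hs)))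
    · exact le_of_tendsto (hgg s (hsub' hs)).norm
        (Eventually.of_forall fun j => hgB j s (hsub' hs))
  · have h1 : ∀ j, ∫ s in a..x, g j s = f j x - f j a := fun j =>
      intervalIntegral.integral_eq_sub_of_hasDerivAt (fun s hs => hf j s (hsub hs))
        ((hg j).mono hsub).intervalIntegrable
    simp only [h1] at hlim
    linarith [tendsto_nhds_unique hlim ((hff x hx).sub (hff a ha))]

theorem continuousOn_of_intervalIntegral {f g : ℝ → ℝ}
    (h : ∀ a x, 0 < a → 0 < x → IntervalIntegrable g volume a x ∧ f x = f a + ∫ s in a..x, g s) :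
    ContinuousOn f (Ioi 0) := by
  intro x hx
  have hx0 : (0 : ℝ) < x := hx
  have hx2 : 0 < x / 2 := by positivity
  have hc := intervalIntegral.continuousOn_primitive_interval'
    (h (x / 2) (2 * x) hx2 (by positivity)).1 left_mem_uIcc
  have hmem : uIcc (x / 2) (2 * x) ∈ 𝓝 x := by
    rw [uIcc_of_le (by linarith)]
    exact Icc_mem_nhds (by linarith) (by linarith)
  have hcx := (continuousAt_const (y := f (x / 2))).add (hc.continuousAt hmem)
  refine (hcx.congr ?_).continuousWithinAt
  filter_upwards [eventually_gt_nhds hx0] with z hz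
  exact (h (x / 2) z hx2 hz).2.symm

theorem hasDerivAt_of_intervalIntegral {f g : ℝ → ℝ} (hg : ContinuousOn g (Ioi 0))
    (h : ∀ a x, 0 < a → 0 < x → IntervalIntegrable g volume a x ∧ f x = f a + ∫ s in a..x, g s)
    {x : ℝ} (hx : 0 < x) : HasDerivAt f (g x) x := by
  have hd := intervalIntegral.integral_hasDerivAt_right (h (x / 2) x (by positivity) hx).1
    (hg.stronglyMeasurableAtFilter isOpen_Ioi x hx) (hg.continuousAt (Ioi_mem_nhds hx))
  refine (hd.const_add (f (x / 2))).congr_of_eventuallyEq ?_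
  filter_upwards [eventually_gt_nhds hx] with z hz
  exact (h (x / 2) z (by positivity) hz).2

/-- Through Nicholson's formula at non-integer orders this supplies the majorant of Y over a range
of orders. -/
theorem nicholsonP_le_of_abs_le {ν μ x : ℝ} (h : |ν| ≤ |μ|) (hx : 0 < x) :
    nicholsonP ν x ≤ nicholsonP μ x := by
  refine setIntegral_mono_on ((subExp_nicholsonP ν).integrableOn_besselK0_mul hx)
    ((subExp_nicholsonP μ).integrableOn_besselK0_mul hx) measurableSet_Ioi fun y hy => ?_
  have hy0 : (0 : ℝ) < y := hy
  have hK := besselK0_pos (by positivity : 0 < 2 * x * y)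
  gcongr
  rw [Real.cosh_le_cosh, abs_mul, abs_mul, abs_mul, abs_mul]
  gcongr

theorem continuousOn_nicholsonP (ν : ℝ) : ContinuousOn (nicholsonP ν) (Ioi 0) :=
  fun _ hx => (hasDerivAt_nicholsonP ν hx).continuousAt.continuousWithinAt

/-- A sequence of non-integer orders decreasing to `n`. -/
noncomputable def orderSeq (n j : ℕ) : ℝ := n + 1 / (j + 2)

theorem orderSeq_bounds (n j : ℕ) : (n : ℝ) < orderSeq n j ∧ orderSeq n j < n + 1 := by
  have h : (1 : ℝ) / (j + 2) < 1 := by rw [div_lt_one (by positivity)]; linarith [j.cast_nonneg (α := ℝ)]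
  have h2 : (0 : ℝ) < 1 / (j + 2) := by positivity
  exact ⟨by rw [orderSeq]; linarith, by rw [orderSeq]; linarith⟩

theorem orderSeq_not_int (n j : ℕ) : ¬∃ k : ℤ, (k : ℝ) = orderSeq n j :=
  not_int_of_Ioo (n := n) (by simpa using (orderSeq_bounds n j).1)
    (by simpa using (orderSeq_bounds n j).2)

theorem orderSeq_add_one (n j : ℕ) : orderSeq n j + 1 = orderSeq (n + 1) j := by
  rw [orderSeq, orderSeq]; push_cast; ring

theorem tendsto_orderSeq (n : ℕ) : Tendsto (orderSeq n) atTop (𝓝[≠] (n : ℝ)) := by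
  refine tendsto_nhdsWithin_iff.2 ⟨?_, Eventually.of_forall fun j => (orderSeq_bounds n j).1.ne'⟩
  have h : Tendsto (fun j : ℕ => (n : ℝ) + 1 / ((j : ℝ) + 2)) atTop (𝓝 (n + 0)) := by
    refine tendsto_const_nhds.add (tendsto_const_nhds.div_atTop ?_)
    exact tendsto_natCast_atTop_atTop.atTop_add tendsto_const_nhds
  rwa [add_zero] at h

theorem besselN_orderSeq (n j : ℕ) {x : ℝ} (hx : 0 < x) :
    besselN (orderSeq n j) x = 8 / Real.pi ^ 2 * nicholsonP (orderSeq n j) x :=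
  besselN_eq_nicholsonP_of_not_int (n + 1) _ (by push_cast; linarith [(orderSeq_bounds n j).1])
    (by push_cast; linarith [(orderSeq_bounds n j).2]) x hx

/-- At nearby non-integer orders the numerator is −… times no unknown: up to sign conventions it
equals Y_μ sin(μπ), whose square is at most sin²(μπ) N_μ. Nicholson's formula keeps N_μ bounded, so
the limit is 0. -/
theorem besselY_numerator_eq_zero (n : ℕ) {x : ℝ} (hx : 0 < x) :
    besselJ n x * Real.cos (n * Real.pi) - besselJ (-n) x = 0 := by
  have hJ := continuous_besselJ_order hx
  have hg : Continuous fun μ : ℝ => besselJ μ x * Real.cos (μ * Real.pi) - besselJ (-μ) x :=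
    (hJ.mul (by fun_prop)).sub (hJ.comp continuous_neg)
  have ho := (tendsto_nhdsWithin_iff.1 (tendsto_orderSeq n)).1
  have h1 := (((hg.tendsto (n : ℝ)).comp ho).pow 2)
  have hP : Continuous fun μ : ℝ => Real.sin (μ * Real.pi) ^ 2 *
      (8 / Real.pi ^ 2 * nicholsonP μ x) :=
    Continuous.mul (by fun_prop) (continuous_const.mul (continuous_nicholsonP_order hx))
  have h2 := (hP.tendsto (n : ℝ)).comp ho
  simp only [Real.sin_nat_mul_pi, zero_pow two_ne_zero, zero_mul] at h2
  refine pow_eq_zero_iff two_ne_zero |>.1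
    (tendsto_nhds_unique h1 (squeeze_zero (fun j => sq_nonneg _) (fun j => ?_) h2))
  · simp only [Function.comp]
    rw [← besselN_orderSeq n j hx, besselN, besselY_of_not_int (orderSeq_not_int n j)]
    have hs := sin_mul_pi_ne_zero (orderSeq_not_int n j)
    have h4 := sq_nonneg (besselJ (orderSeq n j) x * Real.sin (orderSeq n j * Real.pi))
    field_simp
    nlinarith

/-- Numerator and denominator both vanish at n, so the quotient is a ratio of slopes in the order,
and the denominator has nonzero derivative π cos(nπ). Existence of the limit is what gives meaning
to the `limUnder` in the definition. -/
theorem tendsto_besselYQuot (n : ℕ) {x : ℝ} (hx : 0 < x) :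
    Tendsto (fun μ => besselYQuot μ x) (𝓝[≠] (n : ℝ)) (𝓝 (besselY n x)) := by
  have hJ := differentiable_besselJ_order hx
  have hg : Differentiable ℝ fun μ : ℝ => besselJ μ x * Real.cos (μ * Real.pi) - besselJ (-μ) x :=
    (hJ.mul (by fun_prop)).sub (hJ.comp differentiable_neg)
  have h1 := hasDerivAt_iff_tendsto_slope.1 (hg n).hasDerivAt
  have hs : HasDerivAt (fun μ : ℝ => Real.sin (μ * Real.pi))
      (Real.cos (n * Real.pi) * Real.pi) (n : ℝ) := by
    simpa using ((hasDerivAt_id (n : ℝ)).mul_const Real.pi).sin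
  have h2 := hasDerivAt_iff_tendsto_slope.1 hs
  have hne : Real.cos (n * Real.pi) * Real.pi ≠ 0 := by
    rw [Real.cos_nat_mul_pi]
    exact mul_ne_zero (pow_ne_zero _ (by norm_num)) Real.pi_ne_zero
  have h3 := h1.div h2 hne
  obtain ⟨L, h4⟩ : ∃ L, Tendsto (fun μ => besselYQuot μ x) (𝓝[≠] (n : ℝ)) (𝓝 L) := by
    refine ⟨_, h3.congr' ?_⟩
    filter_upwards [self_mem_nhdsWithin] with μ hμ
    have hμ' : μ - n ≠ 0 := sub_ne_zero.2 hμ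
    simp only [Pi.div_apply, slope_def_field, besselY_numerator_eq_zero n hx, Real.sin_nat_mul_pi,
      sub_zero, besselYQuot]
    rw [div_div_div_cancel_right₀ hμ']
  have h5 : besselY n x = L := by
    rw [besselY, if_pos ⟨n, by simp⟩]
    exact h4.limUnder_eq
  rwa [h5]

theorem tendsto_besselY_orderSeq (n : ℕ) {x : ℝ} (hx : 0 < x) :
    Tendsto (fun j => besselY (orderSeq n j) x) atTop (𝓝 (besselY n x)) := by
  refine ((tendsto_besselYQuot n hx).comp (tendsto_orderSeq n)).congr fun j => ?_
  simp only [Function.comp]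
  rw [besselY, if_neg (orderSeq_not_int n j)]

theorem abs_besselY_orderSeq_le (n j : ℕ) {x : ℝ} (hx : 0 < x) :
    |besselY (orderSeq n j) x| ≤ √(8 / Real.pi ^ 2 * nicholsonP (n + 1) x) := by
  refine Real.abs_le_sqrt ?_
  have h1 : besselY (orderSeq n j) x ^ 2 ≤ besselN (orderSeq n j) x := by
    rw [besselN]; nlinarith [sq_nonneg (besselJ (orderSeq n j) x)]
  refine h1.trans ?_
  rw [besselN_orderSeq n j hx]
  have hb := orderSeq_bounds n j
  gcongr
  refine nicholsonP_le_of_abs_le ?_ hx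
  have hn : (0 : ℝ) ≤ n := n.cast_nonneg
  rw [abs_of_pos (by linarith), abs_of_pos (by linarith)]
  exact hb.2.le

theorem besselY_nat_integral (n : ℕ) {a x : ℝ} (ha : 0 < a) (hx : 0 < x) :
    (IntervalIntegrable (fun s => n / s * besselY n s - besselY (n + 1 : ℕ) s) volume a x ∧
      besselY n x = besselY n a + ∫ s in a..x, (n / s * besselY n s - besselY (n + 1 : ℕ) s)) ∧
    (IntervalIntegrable (fun s => besselY n s - (n + 1) / s * besselY (n + 1 : ℕ) s) volume a x ∧
      besselY (n + 1 : ℕ) x = besselY (n + 1 : ℕ) a +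
        ∫ s in a..x, (besselY n s - (n + 1) / s * besselY (n + 1 : ℕ) s)) := by
  have hpair := fun j => isBesselPair_besselY_of_not_int (orderSeq_not_int n j)
  simp only [orderSeq_add_one] at hpair
  have ho := (tendsto_nhdsWithin_iff.1 (tendsto_orderSeq n)).1
  have hc1 : ∀ j, ContinuousOn (besselY (orderSeq n j)) (Ioi 0) := fun j s hs =>
    (hpair j s hs).1.continuousAt.continuousWithinAt
  have hc2 : ∀ j, ContinuousOn (besselY (orderSeq (n + 1) j)) (Ioi 0) := fun j s hs =>
    (hpair j s hs).2.continuousAt.continuousWithinAt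
  have hinv : ContinuousOn (fun s : ℝ => s⁻¹) (Ioi 0) :=
    continuousOn_id.inv₀ fun s hs => ne_of_gt hs
  let M1 : ℝ → ℝ := fun s => √(8 / Real.pi ^ 2 * nicholsonP (n + 1) s)
  let M2 : ℝ → ℝ := fun s => √(8 / Real.pi ^ 2 * nicholsonP ((n + 1 : ℕ) + 1) s)
  have hM1 : ContinuousOn M1 (Ioi 0) :=
    (continuousOn_const.mul (continuousOn_nicholsonP _)).sqrt
  have hM2 : ContinuousOn M2 (Ioi 0) :=
    (continuousOn_const.mul (continuousOn_nicholsonP _)).sqrt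
  have hb1 : ∀ j s, 0 < s → |besselY (orderSeq n j) s| ≤ M1 s := fun j s hs =>
    abs_besselY_orderSeq_le n j hs
  have hb2 : ∀ j s, 0 < s → |besselY (orderSeq (n + 1) j) s| ≤ M2 s := fun j s hs =>
    abs_besselY_orderSeq_le (n + 1) j hs
  have hn : (0 : ℝ) ≤ n := n.cast_nonneg
  constructor
  · refine intervalIntegral_of_tendsto (f := fun j => besselY (orderSeq n j))
      (g := fun j s => orderSeq n j / s * besselY (orderSeq n j) s - besselY (orderSeq (n + 1) j) s)
      (B := fun s => (n + 1) * s⁻¹ * M1 s + M2 s)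
      (fun j s hs => (hpair j s hs).1) (fun j => ?_) (fun s hs => tendsto_besselY_orderSeq n hs)
      (fun s hs => ?_) (((continuousOn_const.mul hinv).mul hM1).add hM2) (fun j s hs => ?_) ha hx
    · simp only [div_eq_mul_inv]
      exact ((continuousOn_const.mul hinv).mul (hc1 j)).sub (hc2 j)
    · exact ((ho.div_const s).mul (tendsto_besselY_orderSeq n hs)).sub
        (tendsto_besselY_orderSeq (n + 1) hs)
    · have hb := orderSeq_bounds n j
      have hs1 : 0 < s⁻¹ := inv_pos.2 hs
      refine (abs_sub _ _).trans (add_le_add ?_ (hb2 j s hs))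
      rw [abs_mul, div_eq_mul_inv, abs_mul, abs_of_pos hs1, abs_of_pos (by linarith)]
      have := hb1 j s hs
      have := hb.2.le
      gcongr
  · refine intervalIntegral_of_tendsto (f := fun j => besselY (orderSeq (n + 1) j))
      (g := fun j s => besselY (orderSeq n j) s -
        (orderSeq n j + 1) / s * besselY (orderSeq (n + 1) j) s)
      (B := fun s => M1 s + (n + 1 + 1) * s⁻¹ * M2 s)
      (fun j s hs => (hpair j s hs).2) (fun j => ?_)
      (fun s hs => tendsto_besselY_orderSeq (n + 1) hs)
      (fun s hs => ?_) (hM1.add ((continuousOn_const.mul hinv).mul hM2)) (fun j s hs => ?_) ha hx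
    · simp only [div_eq_mul_inv]
      exact (hc1 j).sub ((continuousOn_const.mul hinv).mul (hc2 j))
    · exact (tendsto_besselY_orderSeq n hs).sub
        (((ho.add_const 1).div_const s).mul (tendsto_besselY_orderSeq (n + 1) hs))
    · have hb := orderSeq_bounds n j
      have hs1 : 0 < s⁻¹ := inv_pos.2 hs
      refine (abs_sub _ _).trans (add_le_add (hb1 j s hs) ?_)
      rw [abs_mul, div_eq_mul_inv, abs_mul, abs_of_pos hs1, abs_of_pos (by linarith)]
      have := hb2 j s hs
      have := hb.2.le
      gcongr

theorem isBesselPair_besselY_nat (n : ℕ) : IsBesselPair n (besselY n) (besselY (n + 1)) := by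
  have h1 := fun a x (ha : (0 : ℝ) < a) (hx : 0 < x) => (besselY_nat_integral n ha hx).1
  have h2 := fun a x (ha : (0 : ℝ) < a) (hx : 0 < x) => (besselY_nat_integral n ha hx).2
  have hc1 := continuousOn_of_intervalIntegral h1
  have hc2 := continuousOn_of_intervalIntegral h2
  have hinv : ContinuousOn (fun s : ℝ => s⁻¹) (Ioi 0) :=
    continuousOn_id.inv₀ fun s hs => ne_of_gt hs
  rw [show (n : ℝ) + 1 = (n + 1 : ℕ) by push_cast; rfl]
  intro x hx
  constructor
  · refine hasDerivAt_of_intervalIntegral (g := fun s => n / s * besselY n s -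
      besselY (n + 1 : ℕ) s) ?_ h1 hx
    simp only [div_eq_mul_inv]
    exact ((continuousOn_const.mul hinv).mul hc1).sub hc2
  · refine (hasDerivAt_of_intervalIntegral (g := fun s => besselY n s -
      (n + 1) / s * besselY (n + 1 : ℕ) s) ?_ h2 hx)
    simp only [div_eq_mul_inv]
    exact hc1.sub ((continuousOn_const.mul hinv).mul hc2)

theorem eq_nat_of_int_of_nonneg {ν : ℝ} (hν : 0 ≤ ν) (h : ∃ n : ℤ, (n : ℝ) = ν) :
    ∃ n : ℕ, (n : ℝ) = ν := by
  obtain ⟨n, rfl⟩ := h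
  have : 0 ≤ n := by exact_mod_cast hν
  exact ⟨n.toNat, by exact_mod_cast Int.toNat_of_nonneg this⟩

theorem isBesselPair_besselY {ν : ℝ} (hν : 0 ≤ ν) :
    IsBesselPair ν (besselY ν) (besselY (ν + 1)) := by
  by_cases h : ∃ n : ℤ, (n : ℝ) = ν
  · obtain ⟨n, rfl⟩ := eq_nat_of_int_of_nonneg hν h
    exact isBesselPair_besselY_nat n
  · exact isBesselPair_besselY_of_not_int h

/-- Nicholson's formula. -/
theorem besselN_eq_nicholsonP {ν : ℝ} (hν : 0 ≤ ν) {x : ℝ} (hx : 0 < x) :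
    besselN ν x = 8 / Real.pi ^ 2 * nicholsonP ν x := by
  by_cases h : ∃ n : ℤ, (n : ℝ) = ν
  · obtain ⟨n, rfl⟩ := eq_nat_of_int_of_nonneg hν h
    have ho := (tendsto_nhdsWithin_iff.1 (tendsto_orderSeq n)).1
    have h1 : Tendsto (fun j => besselN (orderSeq n j) x) atTop (𝓝 (besselN n x)) :=
      ((((continuous_besselJ_order hx).tendsto _).comp ho).pow 2).add
        ((tendsto_besselY_orderSeq n hx).pow 2)
    have h2 := (((continuous_nicholsonP_order hx).tendsto _).comp ho).const_mul (8 / Real.pi ^ 2)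
    refine tendsto_nhds_unique h1 (h2.congr fun j => ?_)
    exact (besselN_orderSeq n j hx).symm
  · refine besselN_eq_nicholsonP_of_not_int (⌊ν⌋₊ + 1) ν ?_ ?_ x hx
    · push_cast
      have h1 := Nat.floor_le hν
      have h2 : (⌊ν⌋₊ : ℝ) ≠ ν := fun h3 => h ⟨(⌊ν⌋₊ : ℤ), by exact_mod_cast h3⟩
      have := lt_of_le_of_ne h1 h2
      linarith
    · push_cast
      exact Nat.lt_floor_add_one ν

theorem wronskian_besselJ_besselY {ν : ℝ} (hν : 0 ≤ ν) {x : ℝ} (hx : 0 < x) :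
    x * (besselJ (ν + 1) x * besselY ν x - besselJ ν x * besselY (ν + 1) x) = 2 / Real.pi := by
  by_cases h : ∃ n : ℤ, (n : ℝ) = ν
  · obtain ⟨n, rfl⟩ := eq_nat_of_int_of_nonneg hν h
    have hJ := continuous_besselJ_order hx
    have hJ1 : Continuous fun μ => besselJ (μ + 1) x := hJ.comp (by fun_prop)
    have ho := (tendsto_nhdsWithin_iff.1 (tendsto_orderSeq n)).1
    have hY1 := tendsto_besselY_orderSeq (n + 1) hx
    rw [show ((n + 1 : ℕ) : ℝ) = n + 1 by push_cast; rfl] at hY1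
    have h1 := ((((hJ1.tendsto _).comp ho).mul (tendsto_besselY_orderSeq n hx)).sub
      (((hJ.tendsto _).comp ho).mul hY1)).const_mul x
    refine tendsto_nhds_unique (h1.congr fun j => ?_) tendsto_const_nhds
    simp only [Function.comp]
    rw [← orderSeq_add_one]
    exact wronskian_of_not_int (orderSeq_not_int n j) hx
  · exact wronskian_of_not_int h hx
end

section
open MeasureTheory Set

/-! ### Monotonicity of `N_ν`, `x N_ν(x)` and `N_0(bx) / N_0(x)` -/

theorem besselN_pos {ν : ℝ} (hν : 0 ≤ ν) {x : ℝ} (hx : 0 < x) : 0 < besselN ν x := by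
  rw [besselN_eq_nicholsonP hν hx]
  have := nicholsonP_pos ν hx
  have := Real.pi_pos
  positivity

theorem strictAntiOn_nicholsonP (ν : ℝ) : StrictAntiOn (nicholsonP ν) (Ioi 0) := by
  refine strictAntiOn_of_deriv_neg (convex_Ioi 0) (continuousOn_nicholsonP ν) fun x hx => ?_
  rw [interior_Ioi] at hx
  have hx0 : (0 : ℝ) < x := hx
  rw [(hasDerivAt_nicholsonP_aux ν hx0).deriv]
  have hpos : ∀ y ∈ Ioi (0 : ℝ),
      0 < besselK1 (2 * x * y) * (y * (Real.cosh (2 * ν * Real.arsinh y) / √(1 + y ^ 2))) := by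
    intro y hy
    have hy0 : (0 : ℝ) < y := hy
    have := besselK1_pos (by positivity : 0 < 2 * x * y)
    have := Real.cosh_pos (2 * ν * Real.arsinh y)
    positivity
  have h := (setIntegral_pos_iff_support_of_nonneg_ae
    ((ae_restrict_iff' measurableSet_Ioi).2 (Eventually.of_forall fun y hy => (hpos y hy).le))
    ((subExp_nicholsonP ν).integrableOn_besselK1_mul hx0)).2
    (lt_of_lt_of_le (b := volume (Ioi (0 : ℝ))) (by simp)
      (measure_mono fun y hy => ⟨(hpos y hy).ne', hy⟩))
  linarith

theorem strictAntiOn_besselN {ν : ℝ} (hν : 0 ≤ ν) : StrictAntiOn (besselN ν) (Ioi 0) := by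
  intro x hx y hy hxy
  rw [besselN_eq_nicholsonP hν hx, besselN_eq_nicholsonP hν hy]
  have := Real.pi_pos
  have := strictAntiOn_nicholsonP ν hx hy hxy
  gcongr

/-- This is monotonicity of cosh(at)/cosh t, obtained by turning both products into sums of
hyperbolic cosines and comparing arguments. -/
theorem cosh_mul_mul_cosh_le {a s t : ℝ} (ha : 1 ≤ a) (hs : 0 ≤ s) (hst : s ≤ t) :
    Real.cosh (a * s) * Real.cosh t ≤ Real.cosh (a * t) * Real.cosh s := by
  have h : ∀ u v : ℝ, Real.cosh u * Real.cosh v =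
      (Real.cosh (u + v) + Real.cosh (u - v)) / 2 := by
    intro u v
    rw [Real.cosh_add, Real.cosh_sub]; ring
  rw [h, h]
  have ht : 0 ≤ t := hs.trans hst
  have h1 : Real.cosh (a * s + t) ≤ Real.cosh (a * t + s) := by
    rw [Real.cosh_le_cosh, abs_of_nonneg (by positivity), abs_of_nonneg (by positivity)]
    nlinarith
  have h2 : Real.cosh (a * s - t) ≤ Real.cosh (a * t - s) := by
    rw [Real.cosh_le_cosh]
    exact (abs_le.2 ⟨by nlinarith, by nlinarith⟩).trans (le_abs_self _)
  linarith

theorem integrableOn_nicholsonP_scaled (ν : ℝ) {x : ℝ} (hx : 0 < x) :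
    IntegrableOn (fun y => besselK0 (2 * y) *
      (Real.cosh (2 * ν * Real.arsinh (y / x)) / √(1 + (y / x) ^ 2))) (Ioi 0) := by
  by_contra hn
  have h := nicholsonP_scaled ν hx
  rw [integral_undef hn] at h
  exact (mul_pos hx (nicholsonP_pos ν hx)).ne' h

/-- In scaled form x enters only through cosh(2νt)/cosh t at sinh t = y/x. That ratio is
nondecreasing in t exactly because 2ν ≥ 1. -/
theorem antitoneOn_mul_besselN {ν : ℝ} (hν : 1 / 2 ≤ ν) :
    AntitoneOn (fun x => x * besselN ν x) (Ioi 0) := by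
  intro x hx z hz hxz
  have hx0 : (0 : ℝ) < x := hx
  have hz0 : (0 : ℝ) < z := hz
  simp only
  rw [besselN_eq_nicholsonP (by linarith) hx0, besselN_eq_nicholsonP (by linarith) hz0,
    mul_left_comm, mul_left_comm x, nicholsonP_scaled ν hx0, nicholsonP_scaled ν hz0]
  have := Real.pi_pos
  gcongr ?_ * ?_
  refine setIntegral_mono_on (integrableOn_nicholsonP_scaled ν hz0)
    (integrableOn_nicholsonP_scaled ν hx0) measurableSet_Ioi fun y hy => ?_
  have hy0 : (0 : ℝ) < y := hy
  have hK := besselK0_pos (by positivity : 0 < 2 * y)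
  gcongr ?_ * ?_
  rw [← Real.cosh_arsinh, ← Real.cosh_arsinh, div_le_div_iff₀ (Real.cosh_pos _) (Real.cosh_pos _)]
  refine cosh_mul_mul_cosh_le (by linarith) (Real.arsinh_nonneg_iff.2 (by positivity)) ?_
  exact Real.arsinh_le_arsinh.2 (by gcongr)

theorem tendsto_mul_besselN {ν : ℝ} (hν : 0 ≤ ν) :
    Tendsto (fun x => x * besselN ν x) atTop (𝓝 (2 / Real.pi)) := by
  have h := (tendsto_mul_nicholsonP ν).const_mul (8 / Real.pi ^ 2)
  have h2 : 8 / Real.pi ^ 2 * (Real.pi / 4) = 2 / Real.pi := by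
    have := Real.pi_ne_zero
    field_simp
    norm_num
  rw [h2] at h
  refine h.congr' ?_
  filter_upwards [eventually_gt_atTop 0] with x hx
  rw [besselN_eq_nicholsonP hν hx]
  ring

theorem two_div_pi_le_mul_besselN {ν : ℝ} (hν : 1 / 2 ≤ ν) {x : ℝ} (hx : 0 < x) :
    2 / Real.pi ≤ x * besselN ν x := by
  refine le_of_tendsto (tendsto_mul_besselN (by linarith : 0 ≤ ν)) ?_
  filter_upwards [eventually_ge_atTop x] with z hz
  exact antitoneOn_mul_besselN hν hx (mem_Ioi.2 (hx.trans_le hz)) hz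

/-- The double integral of the product of the two 2×2 determinants is twice the difference of the
two sides (Chebyshev's symmetrization). -/
theorem integral_mul_integral_le {α : Type*} [MeasurableSpace α] {μ : Measure α} [SFinite μ]
    {f₁ f₂ g₁ g₂ : α → ℝ} (h11 : Integrable (fun y => f₁ y * g₁ y) μ)
    (h12 : Integrable (fun y => f₁ y * g₂ y) μ) (h21 : Integrable (fun y => f₂ y * g₁ y) μ)
    (h22 : Integrable (fun y => f₂ y * g₂ y) μ)
    (h : ∀ᵐ p ∂(μ.prod μ), 0 ≤ (f₁ p.1 * f₂ p.2 - f₂ p.1 * f₁ p.2) *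
      (g₁ p.1 * g₂ p.2 - g₂ p.1 * g₁ p.2)) :
    (∫ y, f₁ y * g₂ y ∂μ) * (∫ y, f₂ y * g₁ y ∂μ) ≤
      (∫ y, f₁ y * g₁ y ∂μ) * (∫ y, f₂ y * g₂ y ∂μ) := by
  have i1 := h11.mul_prod h22
  have i2 := h12.mul_prod h21
  have i3 := h21.mul_prod h12
  have i4 := h22.mul_prod h11
  have h1 := integral_nonneg_of_ae h
  have h2 : (fun p : α × α => (f₁ p.1 * f₂ p.2 - f₂ p.1 * f₁ p.2) *
      (g₁ p.1 * g₂ p.2 - g₂ p.1 * g₁ p.2)) = fun p =>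
      (f₁ p.1 * g₁ p.1 * (f₂ p.2 * g₂ p.2) - f₁ p.1 * g₂ p.1 * (f₂ p.2 * g₁ p.2)) -
      (f₂ p.1 * g₁ p.1 * (f₁ p.2 * g₂ p.2) - f₂ p.1 * g₂ p.1 * (f₁ p.2 * g₁ p.2)) := by
    ext p; ring
  have i12 : Integrable (fun p : α × α => f₁ p.1 * g₁ p.1 * (f₂ p.2 * g₂ p.2) -
      f₁ p.1 * g₂ p.1 * (f₂ p.2 * g₁ p.2)) (μ.prod μ) := i1.sub i2
  have i34 : Integrable (fun p : α × α => f₂ p.1 * g₁ p.1 * (f₁ p.2 * g₂ p.2) -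
      f₂ p.1 * g₂ p.1 * (f₁ p.2 * g₁ p.2)) (μ.prod μ) := i3.sub i4
  rw [h2, integral_sub i12 i34, integral_sub i1 i2, integral_sub i3 i4,
    integral_prod_mul (fun y => f₁ y * g₁ y) (fun y => f₂ y * g₂ y),
    integral_prod_mul (fun y => f₁ y * g₂ y) (fun y => f₂ y * g₁ y),
    integral_prod_mul (fun y => f₂ y * g₁ y) (fun y => f₁ y * g₂ y),
    integral_prod_mul (fun y => f₂ y * g₂ y) (fun y => f₁ y * g₁ y)] at h1
  linarith

theorem monotoneOn_mul_besselK1_div_besselK0 :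
    MonotoneOn (fun z => z * besselK1 z / besselK0 z) (Ioi 0) := by
  have hd : ∀ z : ℝ, 0 < z → HasDerivAt (fun z => z * besselK1 z / besselK0 z)
      (z * (besselK1 z ^ 2 - besselK0 z ^ 2) / besselK0 z ^ 2) z := by
    intro z hz
    have hK := besselK0_pos hz
    refine (((hasDerivAt_id z).mul (hasDerivAt_besselK1 hz)).div (hasDerivAt_besselK0 hz)
      hK.ne').congr_deriv ?_
    simp only [id, Pi.mul_apply]
    field_simp
    ring
  refine monotoneOn_of_deriv_nonneg (convex_Ioi 0)
    (fun z hz => (hd z hz).continuousAt.continuousWithinAt)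
    (fun z hz => (hd z (interior_subset hz)).differentiableAt.differentiableWithinAt) fun z hz => ?_
  have hz0 : (0 : ℝ) < z := interior_subset hz
  rw [(hd z hz0).deriv]
  have h0 := besselK0_pos hz0
  have h1 := besselK0_le_besselK1 hz0
  have : 0 ≤ besselK1 z ^ 2 - besselK0 z ^ 2 := by nlinarith
  positivity

/-- The logarithmic derivative, multiplied by y, is a difference of values of −zK_1(z)/K_0(z) at qy
and py, and zK_1/K_0 is nondecreasing. -/
theorem antitoneOn_besselK0_ratio {p q : ℝ} (hp : 0 < p) (hpq : p ≤ q) :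
    AntitoneOn (fun y => besselK0 (q * y) / besselK0 (p * y)) (Ioi 0) := by
  have hq : 0 < q := hp.trans_le hpq
  have hdK : ∀ c y : ℝ, 0 < c → 0 < y → HasDerivAt (fun y => besselK0 (c * y))
      (-besselK1 (c * y) * c) y := by
    intro c y hc hy
    have h1 : HasDerivAt (fun y : ℝ => c * y) c y := by
      simpa using (hasDerivAt_id y).const_mul c
    exact (hasDerivAt_besselK0 (mul_pos hc hy)).comp y h1
  have hd : ∀ y : ℝ, 0 < y → HasDerivAt (fun y => besselK0 (q * y) / besselK0 (p * y)) _ y :=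
    fun y hy => (hdK q y hq hy).div (hdK p y hp hy) (besselK0_pos (mul_pos hp hy)).ne'
  refine antitoneOn_of_deriv_nonpos (convex_Ioi 0)
    (fun y hy => (hd y hy).continuousAt.continuousWithinAt)
    (fun y hy => (hd y (interior_subset hy)).differentiableAt.differentiableWithinAt) fun y hy => ?_
  have hy0 : (0 : ℝ) < y := interior_subset hy
  rw [(hd y hy0).deriv]
  have hm := monotoneOn_mul_besselK1_div_besselK0 (mem_Ioi.2 (mul_pos hp hy0))
    (mem_Ioi.2 (mul_pos hq hy0)) (by gcongr : p * y ≤ q * y)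
  simp only at hm
  rw [div_le_div_iff₀ (besselK0_pos (mul_pos hp hy0)) (besselK0_pos (mul_pos hq hy0))] at hm
  refine div_nonpos_of_nonpos_of_nonneg ?_ (by positivity)
  have h2 : y * (-besselK1 (q * y) * q * besselK0 (p * y) -
      besselK0 (q * y) * (-besselK1 (p * y) * p)) ≤ 0 := by linarith
  by_contra hc
  push Not at hc
  linarith [mul_pos hy0 hc]

/-- After rescaling by b all four integrals pair K_0(2xy) or K_0(2zy) with 1/√(b² + y²) or 1/√(1 +
y²). Both the kernel ratio and the weight ratio are monotone in y in the same direction, so the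
symmetrized integrand is nonnegative. -/
theorem nicholsonP_zero_mul_le {b x z : ℝ} (hb : 1 ≤ b) (hx : 0 < x) (hxz : x ≤ z) :
    nicholsonP 0 x * nicholsonP 0 (z * b) ≤ nicholsonP 0 (x * b) * nicholsonP 0 z := by
  have hb0 : 0 < b := by linarith
  have hz : 0 < z := hx.trans_le hxz
  have hsc : ∀ X : ℝ, nicholsonP 0 (X * b) =
      ∫ y in Ioi (0 : ℝ), besselK0 (2 * X * y) * (1 / √(b ^ 2 + y ^ 2)) := by
    intro X
    have h := integral_comp_mul_left_Ioi
      (fun y => besselK0 (2 * X * y) * (b / √(b ^ 2 + y ^ 2))) 0 hb0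
    have h2 : ∀ y : ℝ, b / √(b ^ 2 + (b * y) ^ 2) = 1 / √(1 + y ^ 2) := by
      intro y
      have h3 : b ^ 2 + (b * y) ^ 2 = b ^ 2 * (1 + y ^ 2) := by ring
      rw [h3, Real.sqrt_mul (by positivity), Real.sqrt_sq hb0.le, ← div_div, div_self hb0.ne']
    simp only [h2, mul_zero, smul_eq_mul] at h
    rw [nicholsonP]
    simp only [mul_zero, zero_mul, Real.cosh_zero]
    rw [← integral_const_mul] at h
    refine Eq.trans ?_ (h.trans ?_)
    · refine integral_congr_ae (Eventually.of_forall fun y => ?_)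
      simp only
      rw [show 2 * (X * b) * y = 2 * X * (b * y) by ring]
    · refine integral_congr_ae (Eventually.of_forall fun y => ?_)
      simp only
      field_simp
  have hP : ∀ X : ℝ, nicholsonP 0 X =
      ∫ y in Ioi (0 : ℝ), besselK0 (2 * X * y) * (1 / √(1 + y ^ 2)) := by
    intro X
    rw [nicholsonP]
    simp only [mul_zero, zero_mul, Real.cosh_zero]
  have hs : ∀ c : ℝ, 0 < c → SubExp fun y => 1 / √(c ^ 2 + y ^ 2) := by
    intro c hc
    refine (subExp_const (1 / c)).of_le ?_ 1 fun y hy => ?_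
    · refine continuousOn_const.div (by fun_prop) fun y _ => ?_
      exact (Real.sqrt_pos.2 (by positivity)).ne'
    · have h1 : c ≤ √(c ^ 2 + y ^ 2) := Real.le_sqrt_of_sq_le (by nlinarith)
      rw [abs_of_nonneg (by positivity), abs_of_nonneg (by positivity), one_mul]
      gcongr
  have hs1 : SubExp fun y => 1 / √(1 + y ^ 2) := by simpa using hs 1 one_pos
  rw [hP x, hsc z, hsc x, hP z]
  refine integral_mul_integral_le (f₁ := fun y => besselK0 (2 * x * y))
    (f₂ := fun y => besselK0 (2 * z * y)) (g₁ := fun y => 1 / √(b ^ 2 + y ^ 2))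
    (g₂ := fun y => 1 / √(1 + y ^ 2)) ((hs b hb0).integrableOn_besselK0_mul hx)
    (hs1.integrableOn_besselK0_mul hx) ((hs b hb0).integrableOn_besselK0_mul hz)
    (hs1.integrableOn_besselK0_mul hz) ?_
  have hf : ∀ y w : ℝ, 0 < y → y ≤ w → besselK0 (2 * x * y) * besselK0 (2 * z * w) -
      besselK0 (2 * z * y) * besselK0 (2 * x * w) ≤ 0 := by
    intro y w hy hyw
    have hw : 0 < w := hy.trans_le hyw
    have h := antitoneOn_besselK0_ratio (p := 2 * x) (q := 2 * z) (by positivity) (by linarith)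
      (mem_Ioi.2 hy) (mem_Ioi.2 hw) hyw
    simp only at h
    rw [div_le_div_iff₀ (besselK0_pos (by positivity)) (besselK0_pos (by positivity))] at h
    linarith
  have hg : ∀ y w : ℝ, 0 < y → y ≤ w → 1 / √(b ^ 2 + y ^ 2) * (1 / √(1 + w ^ 2)) -
      1 / √(1 + y ^ 2) * (1 / √(b ^ 2 + w ^ 2)) ≤ 0 := by
    intro y w hy hyw
    rw [sub_nonpos, div_mul_div_comm, div_mul_div_comm, ← Real.sqrt_mul (by positivity),
      ← Real.sqrt_mul (by positivity)]
    have h1 : 0 < √((1 + y ^ 2) * (b ^ 2 + w ^ 2)) := Real.sqrt_pos.2 (by positivity)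
    gcongr 1 * 1 / √?_
    have h2 : 0 ≤ (b ^ 2 - 1) * (w ^ 2 - y ^ 2) :=
      mul_nonneg (by nlinarith) (by nlinarith)
    linarith
  rw [Measure.prod_restrict]
  refine (ae_restrict_iff' (measurableSet_Ioi.prod measurableSet_Ioi)).2
    (Eventually.of_forall fun p hp => ?_)
  have hp1 : (0 : ℝ) < p.1 := hp.1
  have hp2 : (0 : ℝ) < p.2 := hp.2
  rcases le_total p.1 p.2 with h | h
  · exact mul_nonneg_of_nonpos_of_nonpos (hf _ _ hp1 h) (hg _ _ hp1 h)
  · have h1 := mul_nonneg_of_nonpos_of_nonpos (hf _ _ hp2 h) (hg _ _ hp2 h)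
    linarith

theorem besselN_zero_ratio_le {b x z : ℝ} (hb : 1 ≤ b) (hx : 0 < x) (hxz : x ≤ z) :
    besselN 0 (z * b) / besselN 0 z ≤ besselN 0 (x * b) / besselN 0 x := by
  have hz : 0 < z := hx.trans_le hxz
  have hb0 : 0 < b := by linarith
  rw [besselN_eq_nicholsonP le_rfl hx, besselN_eq_nicholsonP le_rfl hz,
    besselN_eq_nicholsonP le_rfl (mul_pos hx hb0), besselN_eq_nicholsonP le_rfl (mul_pos hz hb0)]
  have hpi := Real.pi_pos
  rw [mul_div_mul_left _ _ (by positivity), mul_div_mul_left _ _ (by positivity),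
    div_le_div_iff₀ (nicholsonP_pos 0 hz) (nicholsonP_pos 0 hx)]
  linarith [nicholsonP_zero_mul_le hb hx hxz]
end

/-! ### The phase of `J_ν + i Y_ν` -/

/-- The phase `θ_ν` of `J_ν + i Y_ν`, normalised by `θ_ν(1) = 0`. -/
noncomputable def besselTheta (ν x : ℝ) : ℝ :=
  ∫ s in (1 : ℝ)..x, 2 / (Real.pi * (s * besselN ν s))

section
open MeasureTheory Set

theorem continuousOn_besselN {ν : ℝ} (hν : 0 ≤ ν) : ContinuousOn (besselN ν) (Ioi 0) :=
  fun _ hx => (hasDerivAt_besselN (isBesselPair_besselY hν) hx).continuousAt.continuousWithinAt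

theorem hasDerivAt_besselTheta {ν : ℝ} (hν : 0 ≤ ν) {x : ℝ} (hx : 0 < x) :
    HasDerivAt (besselTheta ν) (2 / (Real.pi * (x * besselN ν x))) x := by
  have hc : ContinuousOn (fun s => 2 / (Real.pi * (s * besselN ν s))) (Ioi 0) := by
    refine continuousOn_const.div
      (continuousOn_const.mul (continuousOn_id.mul (continuousOn_besselN hν))) fun s hs => ?_
    exact (mul_pos Real.pi_pos (mul_pos hs (besselN_pos hν hs))).ne'
  have hi : ∀ a y : ℝ, 0 < a → 0 < y →
      IntervalIntegrable (fun s => 2 / (Real.pi * (s * besselN ν s))) volume a y :=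
    fun a y ha hy => (hc.mono fun s hs => (lt_min ha hy).trans_le hs.1).intervalIntegrable
  refine hasDerivAt_of_intervalIntegral (g := fun s => 2 / (Real.pi * (s * besselN ν s)))
    hc (fun a y ha hy => ⟨hi a y ha hy, ?_⟩) hx
  exact (intervalIntegral.integral_add_adjacent_intervals (hi 1 a one_pos ha) (hi a y ha hy)).symm

theorem deriv_besselTheta_pos {ν : ℝ} (hν : 0 ≤ ν) {x : ℝ} (hx : 0 < x) :
    0 < 2 / (Real.pi * (x * besselN ν x)) := by
  have := besselN_pos hν hx
  have := Real.pi_pos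
  positivity

theorem continuousOn_besselTheta {ν : ℝ} (hν : 0 ≤ ν) : ContinuousOn (besselTheta ν) (Ioi 0) :=
  fun _ hx => (hasDerivAt_besselTheta hν hx).continuousAt.continuousWithinAt

theorem strictMonoOn_besselTheta {ν : ℝ} (hν : 0 ≤ ν) :
    StrictMonoOn (besselTheta ν) (Ioi 0) := by
  refine strictMonoOn_of_deriv_pos (convex_Ioi 0) (continuousOn_besselTheta hν) fun x hx => ?_
  rw [interior_Ioi] at hx
  rw [(hasDerivAt_besselTheta hν hx).deriv]
  exact deriv_besselTheta_pos hν hx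

theorem exists_besselTheta_sub_eq {ν : ℝ} (hν : 0 ≤ ν) {x y : ℝ} (hx : 0 < x) (hxy : x < y) :
    ∃ c, x < c ∧ c < y ∧ besselTheta ν y - besselTheta ν x =
      2 / (Real.pi * (c * besselN ν c)) * (y - x) := by
  obtain ⟨c, hc, h⟩ := exists_hasDerivAt_eq_slope (besselTheta ν)
    (fun c => 2 / (Real.pi * (c * besselN ν c))) hxy
    ((continuousOn_besselTheta hν).mono fun s hs => hx.trans_le hs.1)
    (fun s hs => hasDerivAt_besselTheta hν (hx.trans hs.1))
  refine ⟨c, hc.1, hc.2, ?_⟩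
  have : y - x ≠ 0 := (sub_pos.2 hxy).ne'
  rw [h, div_mul_cancel₀ _ this]

theorem besselTheta_sub_le {ν : ℝ} (hν : 1 / 2 ≤ ν) {x y : ℝ} (hx : 0 < x) (hxy : x ≤ y) :
    besselTheta ν y - besselTheta ν x ≤ y - x := by
  rcases hxy.eq_or_lt with rfl | hlt
  · simp
  obtain ⟨c, hc, -, h⟩ := exists_besselTheta_sub_eq (by linarith : 0 ≤ ν) hx hlt
  have h1 := two_div_pi_le_mul_besselN hν (hx.trans hc)
  rw [h]
  refine mul_le_of_le_one_left (sub_nonneg.2 hxy) ?_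
  rw [← div_div]
  exact div_le_one_of_le₀ h1 ((by positivity : (0 : ℝ) ≤ 2 / Real.pi).trans h1)

/-- With its companion for Y_ν this says H' = ((log √N_ν)' + iθ')H for H = J_ν + iY_ν; the Wronskian
identifies the imaginary part. -/
theorem hasDerivAt_besselJ_phase {ν : ℝ} (hν : 0 ≤ ν) {x : ℝ} (hx : 0 < x) :
    HasDerivAt (besselJ ν) ((ν / x - besselS ν x / besselN ν x) * besselJ ν x -
      2 / (Real.pi * (x * besselN ν x)) * besselY ν x) x := by
  refine (isBesselPair_besselJ ν x hx).1.congr_deriv ?_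
  have hN := besselN_pos hν hx
  have hW := wronskian_besselJ_besselY hν hx
  have hpi := Real.pi_pos
  have h1 : 2 / (Real.pi * (x * besselN ν x)) = (besselJ (ν + 1) x * besselY ν x -
      besselJ ν x * besselY (ν + 1) x) / besselN ν x := by
    rw [← div_div, ← hW]
    field_simp
  rw [h1]
  have h2 : besselJ (ν + 1) x * besselN ν x = besselJ ν x * besselS ν x +
      besselY ν x * (besselJ (ν + 1) x * besselY ν x - besselJ ν x * besselY (ν + 1) x) := by
    unfold besselN besselS; ring
  field_simp
  linear_combination -x * h2

theorem hasDerivAt_besselY_phase {ν : ℝ} (hν : 0 ≤ ν) {x : ℝ} (hx : 0 < x) :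
    HasDerivAt (besselY ν) ((ν / x - besselS ν x / besselN ν x) * besselY ν x +
      2 / (Real.pi * (x * besselN ν x)) * besselJ ν x) x := by
  refine (isBesselPair_besselY hν x hx).1.congr_deriv ?_
  have hN := besselN_pos hν hx
  have hW := wronskian_besselJ_besselY hν hx
  have hpi := Real.pi_pos
  have h1 : 2 / (Real.pi * (x * besselN ν x)) = (besselJ (ν + 1) x * besselY ν x -
      besselJ ν x * besselY (ν + 1) x) / besselN ν x := by
    rw [← div_div, ← hW]
    field_simp
  rw [h1]
  have h2 : besselY (ν + 1) x * besselN ν x = besselY ν x * besselS ν x -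
      besselJ ν x * (besselJ (ν + 1) x * besselY ν x - besselJ ν x * besselY (ν + 1) x) := by
    unfold besselN besselS; ring
  field_simp
  linear_combination -x * h2

theorem hasDerivAt_sqrt_besselN {ν : ℝ} (hν : 0 ≤ ν) {x : ℝ} (hx : 0 < x) :
    HasDerivAt (fun x => √(besselN ν x))
      ((ν / x - besselS ν x / besselN ν x) * √(besselN ν x)) x := by
  have hN := besselN_pos hν hx
  refine ((hasDerivAt_besselN (isBesselPair_besselY hν) hx).sqrt hN.ne').congr_deriv ?_
  have hs := Real.sqrt_pos.2 hN
  have h2 := Real.sq_sqrt hN.le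
  rw [div_eq_iff (by positivity)]
  have : (ν / x - besselS ν x / besselN ν x) * √(besselN ν x) * (2 * √(besselN ν x)) =
      2 * (ν / x - besselS ν x / besselN ν x) * (√(besselN ν x)) ^ 2 := by ring
  rw [this, h2]
  field_simp

/-- The value at `(x, y)` of the real and imaginary parts of `conj (H x) * H y`,
`H = J_ν + i Y_ν`. -/
theorem besselH_mul_conj {ν : ℝ} (hν : 0 ≤ ν) {x y : ℝ} (hx : 0 < x) (hy : 0 < y) :
    besselJ ν x * besselY ν y - besselJ ν y * besselY ν x =
        √(besselN ν x) * √(besselN ν y) * Real.sin (besselTheta ν y - besselTheta ν x) ∧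
      besselJ ν x * besselJ ν y + besselY ν x * besselY ν y =
        √(besselN ν x) * √(besselN ν y) * Real.cos (besselTheta ν y - besselTheta ν x) := by
  set φ : ℝ → ℝ := fun y => besselTheta ν y - besselTheta ν x with hφ
  set S : ℝ → ℝ := fun y => besselJ ν x * besselY ν y - besselJ ν y * besselY ν x with hS
  set K : ℝ → ℝ := fun y => besselJ ν x * besselJ ν y + besselY ν x * besselY ν y with hK
  set q : ℝ → ℝ := fun y => √(besselN ν y) with hq
  have dφ : ∀ y, 0 < y → HasDerivAt φ (2 / (Real.pi * (y * besselN ν y))) y := fun y hy =>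
    (hasDerivAt_besselTheta hν hy).sub_const _
  have dS : ∀ y, 0 < y → HasDerivAt S ((ν / y - besselS ν y / besselN ν y) * S y +
      2 / (Real.pi * (y * besselN ν y)) * K y) y := fun y hy =>
    (((hasDerivAt_besselY_phase hν hy).const_mul _).sub
      ((hasDerivAt_besselJ_phase hν hy).mul_const _)).congr_deriv (by simp only [hS, hK]; ring)
  have dK : ∀ y, 0 < y → HasDerivAt K ((ν / y - besselS ν y / besselN ν y) * K y -
      2 / (Real.pi * (y * besselN ν y)) * S y) y := fun y hy =>
    (((hasDerivAt_besselJ_phase hν hy).const_mul _).add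
      ((hasDerivAt_besselY_phase hν hy).const_mul _)).congr_deriv (by simp only [hS, hK]; ring)
  have q0 : ∀ y, 0 < y → q y ≠ 0 := fun y hy => (Real.sqrt_pos.2 (besselN_pos hν hy)).ne'
  -- The imaginary and, in the next step, the real part of conj(H(x))H(y)e^{−iφ(y)}/√N_ν(y) are
  -- constant in y; they are evaluated at y = x, where φ = 0.
  have hT := eq_of_hasDerivAt_zero_pos
    (f := fun y => (S y * Real.cos (φ y) - K y * Real.sin (φ y)) / q y) (fun y hy => by
      refine ((((dS y hy).mul (dφ y hy).cos).sub ((dK y hy).mul (dφ y hy).sin)).div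
        (hasDerivAt_sqrt_besselN hν hy) (q0 y hy)).congr_deriv ?_
      rw [div_eq_zero_iff]
      left
      simp only [Pi.mul_apply, Pi.sub_apply]
      ring) hy hx
  have hM := eq_of_hasDerivAt_zero_pos
    (f := fun y => (K y * Real.cos (φ y) + S y * Real.sin (φ y)) / q y) (fun y hy => by
      refine ((((dK y hy).mul (dφ y hy).cos).add ((dS y hy).mul (dφ y hy).sin)).div
        (hasDerivAt_sqrt_besselN hν hy) (q0 y hy)).congr_deriv ?_
      rw [div_eq_zero_iff]
      left
      simp only [Pi.mul_apply, Pi.add_apply]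
      ring) hy hx
  have hφx : φ x = 0 := sub_self _
  have hSx : S x = 0 := by simp only [hS]; ring
  have hKx : K x = q x * q x := by
    simp only [hK, hq]
    rw [Real.mul_self_sqrt (besselN_pos hν hx).le, besselN]
    ring
  simp only [hφx, hSx, hKx, Real.cos_zero, Real.sin_zero, mul_one, mul_zero, sub_zero, add_zero,
    zero_div, mul_div_cancel_right₀ _ (q0 x hx)] at hT hM
  rw [div_eq_zero_iff, or_iff_left (q0 y hy)] at hT
  rw [div_eq_iff (q0 y hy)] at hM
  have hsc := Real.sin_sq_add_cos_sq (φ y)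
  constructor
  · change S y = q x * q y * Real.sin (φ y)
    linear_combination Real.cos (φ y) * hT + Real.sin (φ y) * hM - S y * hsc
  · change K y = q x * q y * Real.cos (φ y)
    linear_combination -Real.sin (φ y) * hT + Real.cos (φ y) * hM - K y * hsc

/-- A phase gain of π means that the cylinder function vanishing at x₀ has a further zero x₁ ≤ y.
Two zeros inside (0, ν + 1] are excluded by Sturm comparison with an explicit positive supersolution
of Bessel's equation. -/
theorem lt_of_pi_le_besselTheta_sub {ν : ℝ} (hν : 0 ≤ ν) {x₀ y : ℝ} (h0 : 0 < x₀) (hy : x₀ < y)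
    (h : Real.pi ≤ besselTheta ν y - besselTheta ν x₀) : ν + 1 < y := by
  obtain ⟨x₁, ⟨h01, h1y⟩, hx₁⟩ := intermediate_value_Icc hy.le
    ((continuousOn_besselTheta hν).mono fun s hs => h0.trans_le hs.1)
    (⟨by linarith [Real.pi_pos], by linarith⟩ : besselTheta ν x₀ + Real.pi ∈
      Icc (besselTheta ν x₀) (besselTheta ν y))
  have h01 : x₀ < x₁ := by
    refine lt_of_le_of_ne h01 fun he => ?_
    rw [he] at hx₁
    linarith [Real.pi_pos]
  refine lt_of_lt_of_le ?_ h1y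
  have h1 : 0 < x₁ := h0.trans h01
  set A : ℝ → ℝ := fun x => besselJ ν x₀ * besselY ν x + -besselY ν x₀ * besselJ ν x with hA
  set B : ℝ → ℝ := fun x => besselJ ν x₀ * besselY (ν + 1) x + -besselY ν x₀ * besselJ (ν + 1) x
    with hB
  have hp : IsBesselPair ν A B :=
    (isBesselPair_besselY hν).smul_add (isBesselPair_besselJ ν) _ _
  have hAe : ∀ x, 0 < x → A x = √(besselN ν x₀) * √(besselN ν x) *
      Real.sin (besselTheta ν x - besselTheta ν x₀) := fun x hx => by
    rw [← (besselH_mul_conj hν h0 hx).1]; simp only [hA]; ring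
  have hA0 : ∀ x, x₀ < x → x < x₁ → 0 < A x := fun x hx hx' => by
    have hx0 := h0.trans hx
    rw [hAe x hx0]
    have m1 := strictMonoOn_besselTheta hν h0 hx0 hx
    have m2 := strictMonoOn_besselTheta hν hx0 h1 hx'
    have := Real.sin_pos_of_pos_of_lt_pi (x := besselTheta ν x - besselTheta ν x₀)
      (by linarith) (by linarith)
    have := Real.sqrt_pos.2 (besselN_pos hν h0)
    have := Real.sqrt_pos.2 (besselN_pos hν hx0)
    positivity
  have hA00 : A x₀ = 0 := by simp only [hA]; ring
  have hA1 : A x₁ = 0 := by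
    rw [hAe x₁ h1, hx₁, add_sub_cancel_left, Real.sin_pi, mul_zero]
  have hB0 : x₀ * B x₀ = -(2 / Real.pi) := by
    rw [← wronskian_besselJ_besselY hν h0]; simp only [hB]; ring
  -- At a zero of A one has A' = −B, and A falls to 0 from positive values.
  have hB1 : 0 ≤ B x₁ := by
    have hd := (hp x₁ h1).1
    rw [hA1, mul_zero, zero_sub] at hd
    by_contra! hneg
    have h2 := hd.tendsto_slope.mono_left (nhdsLT_le_nhdsNE x₁)
    have h3 : (0 : ℝ) ≥ -B x₁ := by
      refine le_of_tendsto h2 ?_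
      filter_upwards [Ioo_mem_nhdsLT h01] with x hx
      rw [slope_def_field, hA1, sub_zero]
      exact (div_neg_of_pos_of_neg (hA0 x hx.1 hx.2) (sub_neg.2 hx.2)).le
    linarith
  by_contra! hle
  set n : ℝ := 1 + ν with hn
  have hnpos : 0 < n := by positivity
  -- w = x(A'f − Af') with f = x^ν exp(−x²/(2n)). For n = ν + 1 this f satisfies (xf')' + (x −
  -- ν²/x)f = −xf(1 − x²/n²), which is ≤ 0 on (0, n]. Hence w is nondecreasing where A > 0, against
  -- its signs at x₀ and x₁.
  set w : ℝ → ℝ := fun x => x ^ ν * Real.exp (-x ^ 2 / (2 * n)) * (x ^ 2 * A x / n - x * B x)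
    with hw
  have dw : ∀ x, 0 < x → HasDerivAt w (x ^ ν * Real.exp (-x ^ 2 / (2 * n)) *
      (x * A x / n * (n - x ^ 2 / n))) x := by
    intro x hx
    obtain ⟨dA, dB⟩ := hp x hx
    have d1 := Real.hasDerivAt_rpow_const (x := x) (p := ν) (Or.inl hx.ne')
    have d2 := (((hasDerivAt_pow 2 x).neg).div_const (2 * n)).exp
    have d3 := (((hasDerivAt_pow 2 x).mul dA).div_const n).sub ((hasDerivAt_id x).mul dB)
    refine ((d1.mul d2).mul d3).congr_deriv ?_
    simp only [Pi.mul_apply, Pi.sub_apply, Pi.neg_apply, id]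
    rw [Real.rpow_sub_one hx.ne']
    have hνn : ν = n - 1 := by rw [hn]; ring
    generalize x ^ ν = p
    generalize Real.exp (-x ^ 2 / (2 * n)) = e
    rw [hνn]
    field_simp
    ring
  have hmono : MonotoneOn w (Icc x₀ x₁) := by
    refine monotoneOn_of_deriv_nonneg (convex_Icc _ _)
      (fun x hx => (dw x (h0.trans_le hx.1)).continuousAt.continuousWithinAt)
      (fun x hx => ?_) fun x hx => ?_
    · rw [interior_Icc] at hx
      exact (dw x (h0.trans hx.1)).differentiableAt.differentiableWithinAt
    · rw [interior_Icc] at hx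
      have hx0 := h0.trans hx.1
      rw [(dw x hx0).deriv]
      have := hA0 x hx.1 hx.2
      have : 0 ≤ n - x ^ 2 / n := by
        rw [sub_nonneg, div_le_iff₀ hnpos]
        nlinarith [hx.2]
      positivity
  have hle01 := hmono (left_mem_Icc.2 h01.le) (right_mem_Icc.2 h01.le) h01.le
  have hw0 : 0 < w x₀ := by
    simp only [hw, hA00, hB0]
    have := Real.pi_pos
    have := Real.rpow_pos_of_pos h0 ν
    simp only [mul_zero, zero_div, zero_sub, neg_neg]
    positivity
  have hw1 : w x₁ ≤ 0 := by
    simp only [hw, hA1]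
    have := Real.rpow_pos_of_pos h1 ν
    simp only [mul_zero, zero_div, zero_sub, mul_neg, neg_nonpos]
    positivity
  linarith

theorem besselU_eq {b ν ρ t : ℝ} (hν : 0 ≤ ν) (hb : 0 < b) (hρ : 0 < ρ) (ht : 0 < t) :
    besselU b ν ρ t = √(besselN ν (ρ * t)) * √(besselN ν (ρ * b)) *
      Real.sin (besselTheta ν (ρ * b) - besselTheta ν (ρ * t)) :=
  (besselH_mul_conj hν (mul_pos hρ ht) (mul_pos hρ hb)).1

/-! ### The zeros of `U_ν(·, 1)` -/

/-- The phase difference `θ_ν(ρ b) - θ_ν(ρ)`. -/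
noncomputable def besselPhase (b ν ρ : ℝ) : ℝ := besselTheta ν (ρ * b) - besselTheta ν ρ

theorem hasDerivAt_besselPhase {b ν : ℝ} (hν : 0 ≤ ν) (hb : 1 < b) {ρ : ℝ} (hρ : 0 < ρ) :
    HasDerivAt (besselPhase b ν)
      (2 / (Real.pi * ρ) * (1 / besselN ν (ρ * b) - 1 / besselN ν ρ)) ρ := by
  have hb0 : 0 < b := by linarith
  have hρb := mul_pos hρ hb0
  have h1 := (hasDerivAt_besselTheta hν hρb).comp ρ ((hasDerivAt_id ρ).mul_const b)
  refine (h1.sub (hasDerivAt_besselTheta hν hρ)).congr_deriv ?_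
  have := besselN_pos hν hρ
  have := besselN_pos hν hρb
  have := Real.pi_pos
  field_simp

/-- The factor ρ cancels in Φ', leaving the sign of 1/N_ν(ρb) − 1/N_ν(ρ), positive because N_ν
decreases. -/
theorem strictMonoOn_besselPhase {b ν : ℝ} (hν : 0 ≤ ν) (hb : 1 < b) :
    StrictMonoOn (besselPhase b ν) (Ioi 0) := by
  refine strictMonoOn_of_deriv_pos (convex_Ioi 0)
    (fun ρ hρ => (hasDerivAt_besselPhase hν hb hρ).continuousAt.continuousWithinAt) fun ρ hρ => ?_
  rw [interior_Ioi] at hρ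
  have hρ0 : 0 < ρ := hρ
  rw [(hasDerivAt_besselPhase hν hb hρ).deriv]
  have hlt : ρ < ρ * b := lt_mul_of_one_lt_right hρ0 hb
  have h1 := strictAntiOn_besselN hν hρ (mem_Ioi.2 (hρ0.trans hlt)) hlt
  have h2 := one_div_lt_one_div_of_lt (besselN_pos hν (hρ0.trans hlt)) h1
  have := Real.pi_pos
  exact mul_pos (by positivity) (sub_pos.2 h2)

theorem besselPhase_pos {b ν : ℝ} (hν : 0 ≤ ν) (hb : 1 < b) {ρ : ℝ} (hρ : 0 < ρ) :
    0 < besselPhase b ν ρ := by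
  have hlt : ρ < ρ * b := lt_mul_of_one_lt_right hρ hb
  exact sub_pos.2 (strictMonoOn_besselTheta hν hρ (mem_Ioi.2 (hρ.trans hlt)) hlt)

/-- By the mean value theorem the quotient is (b − 1)θ'(c) with c > ρ, and θ' → 1 since xN_ν(x) →
2/π. -/
theorem tendsto_besselPhase_div {b ν : ℝ} (hν : 0 ≤ ν) (hb : 1 < b) :
    Tendsto (fun ρ => besselPhase b ν ρ / ρ) atTop (𝓝 (b - 1)) := by
  have h1 : Tendsto (fun c => 2 / (Real.pi * (c * besselN ν c))) atTop (𝓝 1) := by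
    have := tendsto_const_nhds (x := (2 : ℝ)).div ((tendsto_mul_besselN hν).const_mul Real.pi)
      (by positivity)
    rwa [mul_div_cancel₀ _ Real.pi_ne_zero, div_self two_ne_zero] at this
  have hc : ∀ ρ : ℝ, ∃ c, 0 < ρ → ρ < c ∧ besselPhase b ν ρ / ρ =
      2 / (Real.pi * (c * besselN ν c)) * (b - 1) := by
    intro ρ
    by_cases hρ : 0 < ρ
    · obtain ⟨c, h1, -, h2⟩ := exists_besselTheta_sub_eq hν hρ (lt_mul_of_one_lt_right hρ hb)
      refine ⟨c, fun _ => ⟨h1, ?_⟩⟩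
      rw [besselPhase, h2, div_eq_iff hρ.ne']
      ring
    · exact ⟨0, fun h => absurd h hρ⟩
  choose c hc using hc
  have hct : Tendsto c atTop atTop := by
    refine tendsto_atTop_mono' _ ?_ tendsto_id
    filter_upwards [eventually_gt_atTop 0] with ρ hρ
    exact (hc ρ hρ).1.le
  have h2 := (h1.comp hct).mul_const (b - 1)
  rw [one_mul] at h2
  refine h2.congr' ?_
  filter_upwards [eventually_gt_atTop 0] with ρ hρ
  exact (hc ρ hρ).2.symm

theorem tendsto_besselPhase_atTop {b ν : ℝ} (hν : 0 ≤ ν) (hb : 1 < b) :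
    Tendsto (besselPhase b ν) atTop atTop := by
  have h := (tendsto_besselPhase_div hν hb).pos_mul_atTop (sub_pos.2 hb) tendsto_id
  refine h.congr' ?_
  filter_upwards [eventually_gt_atTop 0] with ρ hρ
  exact div_mul_cancel₀ _ hρ.ne'

theorem besselPhase_lt_pi {b ν : ℝ} (hν : 0 ≤ ν) (hb : 1 < b) {ρ : ℝ} (hρ : 0 < ρ)
    (h : ρ * b ≤ ν + 1) : besselPhase b ν ρ < Real.pi := by
  by_contra! h1
  exact absurd (lt_of_pi_le_besselTheta_sub hν hρ (lt_mul_of_one_lt_right hρ hb) h1) (not_lt.2 h)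

theorem exists_besselPhase_eq {b ν : ℝ} (hν : 0 ≤ ν) (hb : 1 < b) {y : ℝ} (hy : Real.pi ≤ y) :
    ∃ ρ, 0 < ρ ∧ besselPhase b ν ρ = y := by
  have hb0 : 0 < b := by linarith
  have hr : 0 < (ν + 1) / b := by positivity
  have h1 := besselPhase_lt_pi hν hb hr (div_mul_cancel₀ _ hb0.ne').le
  obtain ⟨R, hR, hRr⟩ := (((tendsto_besselPhase_atTop hν hb).eventually_ge_atTop y).and
    (eventually_ge_atTop ((ν + 1) / b))).exists
  obtain ⟨ρ, hρ, h⟩ := intermediate_value_Icc hRr (f := besselPhase b ν)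
    (fun ρ hρ => (hasDerivAt_besselPhase hν hb
      (hr.trans_le hρ.1)).continuousAt.continuousWithinAt) ⟨(h1.le.trans hy), hR⟩
  exact ⟨ρ, hr.trans_le hρ.1, h⟩

theorem besselU_one_eq_zero_iff {b ν : ℝ} (hν : 0 ≤ ν) (hb : 1 < b) {ρ : ℝ} (hρ : 0 < ρ) :
    besselU b ν ρ 1 = 0 ↔ ∃ m : ℕ, 1 ≤ m ∧ besselPhase b ν ρ = m * Real.pi := by
  have hb0 : 0 < b := by linarith
  have q1 := (Real.sqrt_pos.2 (besselN_pos hν hρ)).ne'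
  have q2 := (Real.sqrt_pos.2 (besselN_pos hν (mul_pos hρ hb0))).ne'
  rw [besselU_eq hν hb0 hρ one_pos, mul_one, mul_eq_zero, or_iff_right (mul_ne_zero q1 q2),
    Real.sin_eq_zero_iff]
  have hpos := besselPhase_pos hν hb hρ
  constructor
  · rintro ⟨n, hn⟩
    change _ = besselPhase b ν ρ at hn
    rw [← hn] at hpos
    have hn0 : 0 < n := by exact_mod_cast pos_of_mul_pos_left hpos Real.pi_pos.le
    refine ⟨n.toNat, by omega, ?_⟩
    rw [← hn, ← Int.cast_natCast, Int.toNat_of_nonneg hn0.le]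
  · rintro ⟨m, -, hm⟩
    exact ⟨m, by rw [Int.cast_natCast]; exact hm.symm⟩

theorem besselRho_succ_eq {b ν : ℝ} (hν : 0 ≤ ν) (hb : 1 < b) (m : ℕ) {ρ : ℝ} (hρ : 0 < ρ)
    (hΦ : besselPhase b ν ρ = ((m + 1 : ℕ) : ℝ) * Real.pi) (h0 : 0 ≤ besselRho b ν m)
    (h : ∀ r, 0 < r → (besselRho b ν m < r ↔ m * Real.pi < besselPhase b ν r)) :
    besselRho b ν (m + 1) = ρ := by
  have hleast : IsLeast {r : ℝ | besselRho b ν m < r ∧ besselU b ν r 1 = 0} ρ := by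
    refine ⟨⟨(h ρ hρ).2 ?_, (besselU_one_eq_zero_iff hν hb hρ).2 ⟨m + 1, by omega, hΦ⟩⟩, ?_⟩
    · rw [hΦ]
      push_cast
      linarith [Real.pi_pos]
    · rintro r ⟨hr, hr0⟩
      have hrpos := h0.trans_lt hr
      obtain ⟨k, -, hk⟩ := (besselU_one_eq_zero_iff hν hb hrpos).1 hr0
      have h1 := (h r hrpos).1 hr
      rw [hk] at h1
      have h2 : m < k := by exact_mod_cast lt_of_mul_lt_mul_right h1 Real.pi_pos.le
      refine ((strictMonoOn_besselPhase hν hb).le_iff_le hρ hrpos).1 ?_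
      rw [hΦ, hk]
      exact mul_le_mul_of_nonneg_right (by exact_mod_cast h2) Real.pi_pos.le
  exact hleast.csInf_eq

/-- The induction carries a comparison instead of Φ(ρ_m) = mπ because the dummy value at index 0 is
not a zero and lies outside (0, ∞). There the comparison is merely positivity of Φ. -/
theorem besselRho_nonneg_and_lt_iff {b ν : ℝ} (hν : 0 ≤ ν) (hb : 1 < b) (m : ℕ) : 0 ≤ besselRho b ν m ∧
    ∀ r, 0 < r → (besselRho b ν m < r ↔ m * Real.pi < besselPhase b ν r) := by
  induction m with
  | zero =>
    refine ⟨le_rfl, fun r hr => ?_⟩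
    simp only [besselRho, Nat.cast_zero, zero_mul]
    exact iff_of_true hr (besselPhase_pos hν hb hr)
  | succ m ih =>
    obtain ⟨ρ, hρ, hΦ⟩ := exists_besselPhase_eq hν hb (y := ((m + 1 : ℕ) : ℝ) * Real.pi) (by
      push_cast
      nlinarith [Real.pi_pos, (Nat.cast_nonneg m : (0 : ℝ) ≤ m)])
    rw [besselRho_succ_eq hν hb m hρ hΦ ih.1 ih.2]
    refine ⟨hρ.le, fun r hr => ?_⟩
    rw [← hΦ]
    exact ((strictMonoOn_besselPhase hν hb).lt_iff_lt hρ hr).symm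

/-- The `m`-th zero is the solution of `θ_ν(ρ b) - θ_ν(ρ) = m π`. -/
theorem besselPhase_besselRho {b ν : ℝ} (hν : 0 ≤ ν) (hb : 1 < b) {m : ℕ} (hm : 1 ≤ m) :
    0 < besselRho b ν m ∧ besselPhase b ν (besselRho b ν m) = m * Real.pi := by
  obtain ⟨m, rfl⟩ := Nat.exists_eq_add_of_le' hm
  obtain ⟨ρ, hρ, hΦ⟩ := exists_besselPhase_eq hν hb (y := ((m + 1 : ℕ) : ℝ) * Real.pi) (by
    push_cast
    nlinarith [Real.pi_pos, (Nat.cast_nonneg m : (0 : ℝ) ≤ m)])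
  obtain ⟨h0, h⟩ := besselRho_nonneg_and_lt_iff hν hb m
  rw [besselRho_succ_eq hν hb m hρ hΦ h0 h]
  exact ⟨hρ, hΦ⟩

theorem strictMonoOn_besselRho {b ν : ℝ} (hν : 0 ≤ ν) (hb : 1 < b) :
    StrictMonoOn (besselRho b ν) (Ici 1) := by
  intro m hm n hn hmn
  obtain ⟨hm0, hmΦ⟩ := besselPhase_besselRho hν hb hm
  obtain ⟨hn0, hnΦ⟩ := besselPhase_besselRho hν hb hn
  refine ((strictMonoOn_besselPhase hν hb).lt_iff_lt hm0 hn0).1 ?_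
  rw [hmΦ, hnΦ]
  exact mul_lt_mul_of_pos_right (by exact_mod_cast hmn) Real.pi_pos

theorem besselU_besselRho_one {b ν : ℝ} (hν : 0 ≤ ν) (hb : 1 < b) {m : ℕ} (hm : 1 ≤ m) :
    besselU b ν (besselRho b ν m) 1 = 0 := by
  obtain ⟨h0, h⟩ := besselPhase_besselRho hν hb hm
  exact (besselU_one_eq_zero_iff hν hb h0).2 ⟨m, hm, h⟩

theorem image_besselRho {b ν : ℝ} (hν : 0 ≤ ν) (hb : 1 < b) :
    besselRho b ν '' Ici 1 = {ρ : ℝ | 0 < ρ ∧ besselU b ν ρ 1 = 0} := by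
  ext ρ
  constructor
  · rintro ⟨m, hm, rfl⟩
    exact ⟨(besselPhase_besselRho hν hb hm).1, besselU_besselRho_one hν hb hm⟩
  · rintro ⟨hρ, h⟩
    obtain ⟨m, hm, hΦ⟩ := (besselU_one_eq_zero_iff hν hb hρ).1 h
    obtain ⟨h0, h1⟩ := besselPhase_besselRho hν hb hm
    exact ⟨m, hm, (strictMonoOn_besselPhase hν hb).injOn h0 hρ (h1.trans hΦ.symm)⟩

/-- The first π of phase already takes the argument beyond ν + 1. The other (m − 1)π cost at least
that much length, as θ' ≤ 1. Thus ρb > ν + 1 + (m − 1)π, which exceeds ν + m/4. -/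
theorem lt_besselRho {b ν : ℝ} (hν : 1 / 2 ≤ ν) (hb : 1 < b) {m : ℕ} (hm : 1 ≤ m) :
    1 / b * (ν + (m : ℝ) / 4) < besselRho b ν m := by
  have hν0 : 0 ≤ ν := by linarith
  have hb0 : 0 < b := by linarith
  obtain ⟨h0, hΦ⟩ := besselPhase_besselRho hν0 hb hm
  set r := besselRho b ν m
  have hlt : r < r * b := lt_mul_of_one_lt_right h0 hb
  rw [besselPhase] at hΦ
  have hm1 : (1 : ℝ) ≤ m := by exact_mod_cast hm
  have hpi := Real.pi_gt_three
  obtain ⟨x, ⟨hx0, hx1⟩, hx⟩ := intermediate_value_Icc hlt.le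
    ((continuousOn_besselTheta hν0).mono fun s hs => h0.trans_le hs.1)
    (⟨by linarith, by nlinarith⟩ : besselTheta ν r + Real.pi ∈
      Icc (besselTheta ν r) (besselTheta ν (r * b)))
  have hx0' : r < x := by
    refine lt_of_le_of_ne hx0 fun he => ?_
    rw [← he] at hx
    linarith
  have h1 := lt_of_pi_le_besselTheta_sub hν0 h0 hx0' (by linarith)
  have h2 := besselTheta_sub_le hν (h0.trans hx0') hx1
  have h3 : ν + (m : ℝ) / 4 < r * b := by nlinarith
  rw [one_div, inv_mul_lt_iff₀ hb0]
  linarith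

theorem tendsto_besselRho_div {b ν : ℝ} (hν : 0 ≤ ν) (hb : 1 < b) :
    Tendsto (fun m : ℕ => besselRho b ν m / (m : ℝ)) atTop (𝓝 (Real.pi / (b - 1))) := by
  have ht : Tendsto (besselRho b ν) atTop atTop := by
    refine tendsto_atTop.2 fun R => ?_
    have hR : (0 : ℝ) < max R 1 := by positivity
    have h1 : Tendsto (fun m : ℕ => (m : ℝ) * Real.pi) atTop atTop :=
      tendsto_natCast_atTop_atTop.atTop_mul_const Real.pi_pos
    filter_upwards [h1.eventually_ge_atTop (besselPhase b ν (max R 1)), eventually_ge_atTop 1]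
      with m hm hm1
    obtain ⟨h0, hΦ⟩ := besselPhase_besselRho hν hb hm1
    rw [← hΦ] at hm
    exact (le_max_left _ _).trans (((strictMonoOn_besselPhase hν hb).le_iff_le hR h0).1 hm)
  have h2 := tendsto_const_nhds (x := Real.pi).div ((tendsto_besselPhase_div hν hb).comp ht)
    (sub_pos.2 hb).ne'
  refine h2.congr' ?_
  filter_upwards [eventually_ge_atTop 1] with m hm
  obtain ⟨h0, hΦ⟩ := besselPhase_besselRho hν hb hm
  have : (0 : ℝ) < m := by exact_mod_cast hm
  simp only [Pi.div_apply, Function.comp, hΦ]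
  have := Real.pi_pos
  field_simp

end

/-! ### Lommel's integral and the size of `U_ν` -/

/-- The companion `J_{ν+1}(ρt) Y_ν(ρb) - J_ν(ρb) Y_{ν+1}(ρt)` of `U_ν(ρ, t)`. -/
noncomputable def besselV (b ν ρ t : ℝ) : ℝ :=
  besselJ (ν + 1) (ρ * t) * besselY ν (ρ * b) - besselJ ν (ρ * b) * besselY (ν + 1) (ρ * t)

section
open MeasureTheory Set

theorem hasDerivAt_besselU {b ν ρ t : ℝ} (hν : 0 ≤ ν) (hρ : 0 < ρ) (ht : 0 < t) :
    HasDerivAt (besselU b ν ρ) (ν / t * besselU b ν ρ t - ρ * besselV b ν ρ t) t := by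
  have hp := ((isBesselPair_besselJ ν).smul_add (isBesselPair_besselY hν) (besselY ν (ρ * b))
    (-besselJ ν (ρ * b)) (ρ * t) (mul_pos hρ ht)).1
  have h := hp.comp t ((hasDerivAt_id t).const_mul ρ)
  refine (h.congr_deriv ?_).congr_of_eventuallyEq (Eventually.of_forall fun s => ?_)
  · simp only [besselU, besselV]
    field_simp
    ring
  · simp only [besselU, Function.comp]
    ring

theorem hasDerivAt_besselV {b ν ρ t : ℝ} (hν : 0 ≤ ν) (hρ : 0 < ρ) (ht : 0 < t) :
    HasDerivAt (besselV b ν ρ) (ρ * besselU b ν ρ t - (ν + 1) / t * besselV b ν ρ t) t := by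
  have hp := ((isBesselPair_besselJ ν).smul_add (isBesselPair_besselY hν) (besselY ν (ρ * b))
    (-besselJ ν (ρ * b)) (ρ * t) (mul_pos hρ ht)).2
  have h := hp.comp t ((hasDerivAt_id t).const_mul ρ)
  refine (h.congr_deriv ?_).congr_of_eventuallyEq (Eventually.of_forall fun s => ?_)
  · simp only [besselU, besselV]
    field_simp
    ring
  · simp only [besselV, Function.comp]
    ring

/-- At a zero of U_ν the vectors (J_ν, Y_ν) at ρa and ρb are parallel. The companion V and the
Wronskian expression W = J_{ν+1}Y_ν − J_νY_{ν+1} at ρa satisfy V·H(ρa) = W·H(ρb); take squared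
lengths. -/
theorem besselV_sq_of_besselU_eq_zero {b ν ρ a : ℝ} (hν : 0 ≤ ν) (hρ : 0 < ρ) (ha : 0 < a)
    (h : besselU b ν ρ a = 0) :
    (ρ * a * besselV b ν ρ a) ^ 2 =
      4 / Real.pi ^ 2 * (besselN ν (ρ * b) / besselN ν (ρ * a)) := by
  have hN := besselN_pos hν (mul_pos hρ ha)
  have hW := wronskian_besselJ_besselY hν (mul_pos hρ ha)
  have h4 : 4 / Real.pi ^ 2 = (2 / Real.pi) ^ 2 := by ring
  rw [h4, ← hW, ← mul_div_assoc, eq_div_iff hN.ne']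
  simp only [besselU] at h
  simp only [besselN, besselV]
  generalize besselJ ν (ρ * a) = j at *
  generalize besselY ν (ρ * a) = y at *
  generalize besselJ ν (ρ * b) = j' at *
  generalize besselY ν (ρ * b) = y' at *
  generalize besselJ (ν + 1) (ρ * a) = j1 at *
  generalize besselY (ν + 1) (ρ * a) = y1 at *
  have e1 : j * (j1 * y' - j' * y1) = j' * (j1 * y - j * y1) := by linear_combination j1 * h
  have e2 : y * (j1 * y' - j' * y1) = y' * (j1 * y - j * y1) := by linear_combination y1 * h
  linear_combination (ρ * a) ^ 2 * ((j * (j1 * y' - j' * y1) + j' * (j1 * y - j * y1)) * e1 +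
    (y * (j1 * y' - j' * y1) + y' * (j1 * y - j * y1)) * e2)

theorem besselU_self (b ν ρ : ℝ) : besselU b ν ρ b = 0 := by
  simp only [besselU]; ring

theorem besselN_ratio_le_one {b ν ρ a : ℝ} (hν : 0 ≤ ν) (hρ : 0 < ρ) (ha : 0 < a) (hab : a ≤ b) :
    besselN ν (ρ * b) / besselN ν (ρ * a) ≤ 1 := by
  have h1 := mul_pos hρ ha
  have h2 : ρ * a ≤ ρ * b := mul_le_mul_of_nonneg_left hab hρ.le
  exact (div_le_one (besselN_pos hν h1)).2
    ((strictAntiOn_besselN hν).antitoneOn h1 (mem_Ioi.2 (h1.trans_le h2)) h2)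

theorem besselN_ratio_pos {b ν ρ a : ℝ} (hν : 0 ≤ ν) (hρ : 0 < ρ) (ha : 0 < a) (hb : 0 < b) :
    0 < besselN ν (ρ * b) / besselN ν (ρ * a) :=
  div_pos (besselN_pos hν (mul_pos hρ hb)) (besselN_pos hν (mul_pos hρ ha))

theorem deriv_besselU_sq {b ν ρ a : ℝ} (hν : 0 ≤ ν) (hρ : 0 < ρ) (ha : 0 < a)
    (h : besselU b ν ρ a = 0) :
    (deriv (besselU b ν ρ) a) ^ 2 =
      4 / (Real.pi ^ 2 * a ^ 2) * (besselN ν (ρ * b) / besselN ν (ρ * a)) := by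
  have h1 := besselV_sq_of_besselU_eq_zero hν hρ ha h
  rw [(hasDerivAt_besselU hν hρ ha).deriv, h]
  have : 4 / (Real.pi ^ 2 * a ^ 2) * (besselN ν (ρ * b) / besselN ν (ρ * a)) =
      4 / Real.pi ^ 2 * (besselN ν (ρ * b) / besselN ν (ρ * a)) / a ^ 2 := by
    rw [← div_div]; ring
  rw [this, ← h1, eq_div_iff (by positivity)]
  ring

theorem continuousOn_besselU {b ν ρ : ℝ} (hν : 0 ≤ ν) (hρ : 0 < ρ) :
    ContinuousOn (besselU b ν ρ) (Ioi 0) :=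
  fun _ ht => (hasDerivAt_besselU hν hρ ht).continuousAt.continuousWithinAt

theorem intervalIntegrable_besselU_sq_mul {b ν ρ a c : ℝ} (hν : 0 ≤ ν) (hρ : 0 < ρ) (ha : 0 < a)
    (hc : 0 < c) : IntervalIntegrable (fun t => besselU b ν ρ t ^ 2 * t) volume a c := by
  refine ContinuousOn.intervalIntegrable ?_
  refine (((continuousOn_besselU hν hρ).pow 2).mul continuousOn_id).mono fun s hs => ?_
  exact (lt_min ha hc).trans_le hs.1

/-- Lommel's integral between two zeros. -/
theorem integral_besselU_sq_mul {b ν ρ a : ℝ} (hν : 0 ≤ ν) (hρ : 0 < ρ) (ha : 0 < a)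
    (hb : 0 < b) (h : besselU b ν ρ a = 0) :
    ρ ^ 2 * (∫ t in a..b, besselU b ν ρ t ^ 2 * t) =
      2 / Real.pi ^ 2 * (1 - besselN ν (ρ * b) / besselN ν (ρ * a)) := by
  -- This is Lommel's primitive (tU')² + (ρ²t² − ν²)U², with tU' written through the companion. At a
  -- zero of U only (ρtV)² remains.
  set F : ℝ → ℝ := fun t => (ν * besselU b ν ρ t - ρ * t * besselV b ν ρ t) ^ 2 +
    (ρ ^ 2 * t ^ 2 - ν ^ 2) * besselU b ν ρ t ^ 2 with hF
  have dF : ∀ t, 0 < t → HasDerivAt F (2 * ρ ^ 2 * (besselU b ν ρ t ^ 2 * t)) t := by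
    intro t ht
    have dU := hasDerivAt_besselU (b := b) hν hρ ht
    have dV := hasDerivAt_besselV (b := b) hν hρ ht
    have d1 := ((dU.const_mul ν).sub (((hasDerivAt_id t).const_mul ρ).mul dV)).pow 2
    have d2 := (((hasDerivAt_pow 2 t).const_mul (ρ ^ 2)).sub_const (ν ^ 2)).mul (dU.pow 2)
    refine (d1.add d2).congr_deriv ?_
    simp only [Pi.mul_apply, Pi.sub_apply, Pi.pow_apply, id]
    field_simp
    ring
  have hpos : ∀ t ∈ uIcc a b, 0 < t := fun t ht => (lt_min ha hb).trans_le ht.1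
  have hI := intervalIntegral.integral_eq_sub_of_hasDerivAt (fun t ht => dF t (hpos t ht))
    ((intervalIntegrable_besselU_sq_mul hν hρ ha hb).const_mul _)
  rw [intervalIntegral.integral_const_mul] at hI
  have hzero : ∀ t, 0 < t → besselU b ν ρ t = 0 →
      F t = 4 / Real.pi ^ 2 * (besselN ν (ρ * b) / besselN ν (ρ * t)) := by
    intro t ht h0
    rw [← besselV_sq_of_besselU_eq_zero hν hρ ht h0]
    simp only [hF, h0]
    ring
  rw [hzero a ha h, hzero b hb (besselU_self b ν ρ),
    div_self (besselN_pos hν (mul_pos hρ hb)).ne'] at hI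
  linear_combination hI / 2

theorem besselN_ratio_le_inv {b ν ρ : ℝ} (hν : 1 / 2 ≤ ν) (hb : 1 < b) (hρ : 0 < ρ) :
    besselN ν (ρ * b) / besselN ν ρ ≤ 1 / b := by
  have hb0 : 0 < b := by linarith
  have hlt : ρ < ρ * b := lt_mul_of_one_lt_right hρ hb
  have h := antitoneOn_mul_besselN hν hρ (mem_Ioi.2 (hρ.trans hlt)) hlt.le
  simp only at h
  have hN := besselN_pos (by linarith : 0 ≤ ν) hρ
  rw [div_le_div_iff₀ hN hb0]
  refine le_of_mul_le_mul_left ?_ hρ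
  linarith

/-! ### The bound to the left of the least zero -/

/-- Bessel's equation has the factored form (s^{1−2ν}(s^νA)')' = −ρ²s^{1−ν}A. Where A > 0 the inner
bracket g is nonincreasing, so (s^νA)' ≥ g(a)s^{2ν−1}. Integrating up to the zero a bounds t^νA(t)
by −g(a)(a^{2ν} − t^{2ν})/(2ν). -/
theorem le_rpow_of_hasDerivAt_pair {ν ρ a : ℝ} {A B : ℝ → ℝ} (hν : 0 < ν)
    (dA : ∀ t, 0 < t → HasDerivAt A (ν / t * A t - ρ * B t) t)
    (dB : ∀ t, 0 < t → HasDerivAt B (ρ * A t - (ν + 1) / t * B t) t) (ha : A a = 0)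
    (hpos : ∀ t, 0 < t → t < a → 0 < A t) {t : ℝ} (ht : 0 < t) (hta : t < a) :
    A t ≤ t ^ (-ν) * (a ^ ν * |ρ * a * B a| / (2 * ν)) := by
  have ha0 : 0 < a := ht.trans hta
  -- Since sA' = νA − ρsB, this is s^{1−2ν}(s^νA)'.
  set g : ℝ → ℝ := fun s => s ^ (-ν) * (2 * ν * A s - ρ * s * B s) with hg
  have dg : ∀ s, 0 < s → HasDerivAt g (-(ρ ^ 2 * s * s ^ (-ν) * A s)) s := by
    intro s hs
    have d1 := Real.hasDerivAt_rpow_const (x := s) (p := -ν) (Or.inl hs.ne')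
    have d2 := ((dA s hs).const_mul (2 * ν)).sub
      (((hasDerivAt_id s).const_mul ρ).mul (dB s hs))
    refine (d1.mul d2).congr_deriv ?_
    simp only [Pi.mul_apply, Pi.sub_apply, id]
    rw [Real.rpow_sub_one hs.ne']
    field_simp
    ring
  have hganti : AntitoneOn g (Icc t a) := by
    refine antitoneOn_of_deriv_nonpos (convex_Icc _ _)
      (fun s hs => (dg s (ht.trans_le hs.1)).continuousAt.continuousWithinAt)
      (fun s hs => ?_) fun s hs => ?_
    · rw [interior_Icc] at hs
      exact (dg s (ht.trans hs.1)).differentiableAt.differentiableWithinAt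
    · rw [interior_Icc] at hs
      have hs0 := ht.trans hs.1
      rw [(dg s hs0).deriv, neg_nonpos]
      have := hpos s hs0 hs.2
      positivity
  set H : ℝ → ℝ := fun s => s ^ ν * A s - g a * (s ^ (2 * ν) / (2 * ν)) with hH
  have dH : ∀ s, 0 < s → HasDerivAt H (s ^ (2 * ν) / s * (g s - g a)) s := by
    intro s hs
    have d1 := Real.hasDerivAt_rpow_const (x := s) (p := ν) (Or.inl hs.ne')
    have d2 := Real.hasDerivAt_rpow_const (x := s) (p := 2 * ν) (Or.inl hs.ne')
    refine ((d1.mul (dA s hs)).sub ((d2.div_const (2 * ν)).const_mul (g a))).congr_deriv ?_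
    have e1 : s ^ (2 * ν) = s ^ ν * s ^ ν := by rw [two_mul, Real.rpow_add hs]
    have e2 : s ^ (2 * ν) / s * g s = s ^ ν / s * (2 * ν * A s - ρ * s * B s) := by
      have : s ^ ν * s ^ (-ν) = 1 := by rw [← Real.rpow_add hs]; simp
      simp only [hg]
      rw [e1]
      linear_combination s ^ ν / s * (2 * ν * A s - ρ * s * B s) * this
    rw [mul_sub (s ^ (2 * ν) / s), e2, Real.rpow_sub_one hs.ne', Real.rpow_sub_one hs.ne']
    field_simp
    ring
  have hHmono : MonotoneOn H (Icc t a) := by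
    refine monotoneOn_of_deriv_nonneg (convex_Icc _ _)
      (fun s hs => (dH s (ht.trans_le hs.1)).continuousAt.continuousWithinAt)
      (fun s hs => ?_) fun s hs => ?_
    · rw [interior_Icc] at hs
      exact (dH s (ht.trans hs.1)).differentiableAt.differentiableWithinAt
    · rw [interior_Icc] at hs
      have hs0 := ht.trans hs.1
      rw [(dH s hs0).deriv]
      have := sub_nonneg.2 (hganti ⟨hs.1.le, hs.2.le⟩ (right_mem_Icc.2 hta.le) hs.2.le)
      positivity
  have h1 := hHmono (left_mem_Icc.2 hta.le) (right_mem_Icc.2 hta.le) hta.le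
  simp only [hH, ha, mul_zero, zero_sub] at h1
  have hga : g a = -(a ^ (-ν) * (ρ * a * B a)) := by
    simp only [hg, ha]; ring
  have hle : t ^ (2 * ν) ≤ a ^ (2 * ν) := Real.rpow_le_rpow ht.le hta.le (by positivity)
  have hat : t ^ ν * A t ≤ a ^ ν * |ρ * a * B a| / (2 * ν) := by
    have h2 : t ^ ν * A t ≤ -g a * ((a ^ (2 * ν) - t ^ (2 * ν)) / (2 * ν)) := by
      rw [sub_div]; linarith
    have h3 : -g a ≤ a ^ (-ν) * |ρ * a * B a| := by
      rw [hga, neg_neg]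
      exact mul_le_mul_of_nonneg_left (le_abs_self _) (by positivity)
    have h4 : (a ^ (2 * ν) - t ^ (2 * ν)) / (2 * ν) ≤ a ^ (2 * ν) / (2 * ν) := by
      have : 0 < t ^ (2 * ν) := Real.rpow_pos_of_pos ht _
      gcongr
      linarith
    calc t ^ ν * A t ≤ -g a * ((a ^ (2 * ν) - t ^ (2 * ν)) / (2 * ν)) := h2
      _ ≤ a ^ (-ν) * |ρ * a * B a| * ((a ^ (2 * ν) - t ^ (2 * ν)) / (2 * ν)) :=
        mul_le_mul_of_nonneg_right h3 (div_nonneg (sub_nonneg.2 hle) (by positivity))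
      _ ≤ a ^ (-ν) * |ρ * a * B a| * (a ^ (2 * ν) / (2 * ν)) :=
        mul_le_mul_of_nonneg_left h4 (by positivity)
      _ = a ^ ν * |ρ * a * B a| / (2 * ν) := by
        have : a ^ (-ν) * a ^ (2 * ν) = a ^ ν := by rw [← Real.rpow_add ha0]; congr 1; ring
        rw [← this]; ring
  rw [Real.rpow_neg ht.le, ← div_eq_inv_mul, le_div_iff₀ (Real.rpow_pos_of_pos ht _), mul_comm]
  exact hat

/-- Minimality of a gives U_ν a constant sign on (0, a), so the one-sided estimate applies to U_ν or
−U_ν. The factors a^ν ≤ 1 and |ρaV| ≤ 2/π, the latter from monotonicity of N_ν, produce the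
constant. -/
theorem abs_besselU_le {b ν ρ a : ℝ} (hν : 0 < ν) (hρ : 0 < ρ) (hab : a ≤ b)
    (ha : a ≤ 1) (h : IsLeast {t : ℝ | 0 < t ∧ besselU b ν ρ t = 0} a) {t : ℝ} (ht : 0 < t)
    (hta : t < a) : |besselU b ν ρ t| ≤ t ^ (-ν) / (Real.pi * ν) := by
  obtain ⟨⟨ha0, hUa⟩, hlow⟩ := h
  have hpi := Real.pi_pos
  have hbd : |ρ * a * besselV b ν ρ a| ≤ 2 / Real.pi := by
    refine abs_le_of_sq_le_sq ?_ (by positivity)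
    rw [besselV_sq_of_besselU_eq_zero hν.le hρ ha0 hUa]
    have : 4 / Real.pi ^ 2 = (2 / Real.pi) ^ 2 := by ring
    rw [this]
    exact mul_le_of_le_one_right (by positivity) (besselN_ratio_le_one hν.le hρ ha0 hab)
  have haν : a ^ ν ≤ 1 := Real.rpow_le_one ha0.le ha hν.le
  have key : t ^ (-ν) * (a ^ ν * |ρ * a * besselV b ν ρ a| / (2 * ν)) ≤
      t ^ (-ν) / (Real.pi * ν) := by
    rw [div_eq_mul_one_div (t ^ (-ν))]
    refine mul_le_mul_of_nonneg_left ?_ (by positivity)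
    have h1 : a ^ ν * |ρ * a * besselV b ν ρ a| ≤ 1 * (2 / Real.pi) :=
      mul_le_mul haν hbd (abs_nonneg _) zero_le_one
    calc _ ≤ 1 * (2 / Real.pi) / (2 * ν) := by gcongr
      _ = 1 / (Real.pi * ν) := by field_simp
  have hne : ∀ s ∈ Ioo 0 a, besselU b ν ρ s ≠ 0 := fun s hs h0 =>
    absurd (hlow ⟨hs.1, h0⟩) (not_le.2 hs.2)
  have hcont := (continuousOn_besselU (b := b) hν.le hρ).mono
    (fun s hs => hs.1 : Ioo 0 a ⊆ Ioi 0)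
  have dU := fun s (hs : 0 < s) => hasDerivAt_besselU (b := b) hν.le hρ hs
  have dV := fun s (hs : 0 < s) => hasDerivAt_besselV (b := b) hν.le hρ hs
  have hsame : ∀ s ∈ Ioo 0 a, 0 < besselU b ν ρ t * besselU b ν ρ s := by
    intro s hs
    by_contra! hneg
    have hmem : (0 : ℝ) ∈ uIcc (besselU b ν ρ t) (besselU b ν ρ s) := by
      rw [mem_uIcc]
      rcases mul_nonpos_iff.1 hneg with h | h
      · exact Or.inr ⟨h.2, h.1⟩
      · exact Or.inl h
    have hsub : uIcc t s ⊆ Ioo 0 a := ordConnected_Ioo.uIcc_subset ⟨ht, hta⟩ hs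
    obtain ⟨r, hr, hr0⟩ := intermediate_value_uIcc (hcont.mono hsub) hmem
    exact hne r (hsub hr) hr0
  rcases (hne t ⟨ht, hta⟩).lt_or_gt with hneg | hpos
  · rw [abs_of_neg hneg]
    refine (le_rpow_of_hasDerivAt_pair (A := fun s => -besselU b ν ρ s)
      (B := fun s => -besselV b ν ρ s) (ρ := ρ) hν
      (fun s hs => (dU s hs).neg.congr_deriv (by ring))
      (fun s hs => (dV s hs).neg.congr_deriv (by ring)) (by simp [hUa])
      (fun s hs hsa => ?_) ht hta).trans ?_
    · exact neg_pos.2 (neg_of_mul_pos_right (hsame s ⟨hs, hsa⟩) hneg.le)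
    · rw [mul_neg, abs_neg]
      exact key
  · rw [abs_of_pos hpos]
    exact (le_rpow_of_hasDerivAt_pair hν dU dV hUa
      (fun s hs hsa => pos_of_mul_pos_right (hsame s ⟨hs, hsa⟩) hpos.le) ht hta).trans key

end
theorem mainTheorem7 (b : ℝ) (hb : 1 < b) :
    -- the numbers `ρ_{ν,m}`, `m ≥ 1`, are the positive zeros of `U_ν(·, 1)` in increasing order
    (∀ ν : ℝ, 0 ≤ ν →
      StrictMonoOn (besselRho b ν) (Set.Ici 1) ∧
      besselRho b ν '' Set.Ici 1 = {ρ : ℝ | 0 < ρ ∧ besselU b ν ρ 1 = 0}) ∧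
    -- (i)
    ((∀ ν : ℝ, 1 / 2 ≤ ν → ∀ m : ℕ, 1 ≤ m →
        besselRho b ν m > 1 / b * (ν + (m : ℝ) / 4)) ∧
      (∀ ν : ℝ, 0 ≤ ν →
        Tendsto (fun m : ℕ => besselRho b ν m / (m : ℝ)) atTop (𝓝 (Real.pi / (b - 1))))) ∧
    -- (ii)
    (∀ ν : ℝ, 0 ≤ ν → ∀ m : ℕ, 1 ≤ m → ∀ a : ℝ, 0 < a → a ≤ b →
      besselU b ν (besselRho b ν m) a = 0 →
        DifferentiableAt ℝ (fun t => besselU b ν (besselRho b ν m) t) a ∧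
        (deriv (fun t => besselU b ν (besselRho b ν m) t) a) ^ 2 =
          4 / (Real.pi ^ 2 * a ^ 2) *
            (besselN ν (besselRho b ν m * b) / besselN ν (besselRho b ν m * a)) ∧
        4 / (Real.pi ^ 2 * a ^ 2) *
            (besselN ν (besselRho b ν m * b) / besselN ν (besselRho b ν m * a)) ≤
          4 / (Real.pi ^ 2 * a ^ 2)) ∧
    -- (iii)
    (∀ ν : ℝ, 0 ≤ ν → ∀ m : ℕ, 1 ≤ m → ∀ a : ℝ, 0 < a → a < b →
      besselU b ν (besselRho b ν m) a = 0 →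
        IntervalIntegrable (fun t => besselU b ν (besselRho b ν m) t ^ 2 * t)
          MeasureTheory.volume a b ∧
        besselRho b ν m ^ 2 * (∫ t in a..b, besselU b ν (besselRho b ν m) t ^ 2 * t) =
          2 / Real.pi ^ 2 *
            (1 - besselN ν (besselRho b ν m * b) / besselN ν (besselRho b ν m * a)) ∧
        2 / Real.pi ^ 2 *
            (1 - besselN ν (besselRho b ν m * b) / besselN ν (besselRho b ν m * a)) ≤
          2 / Real.pi ^ 2) ∧
    -- (iv)
    ((∀ ν : ℝ, 1 / 2 ≤ ν → ∀ m : ℕ, 1 ≤ m →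
        besselRho b ν m ^ 2 * (∫ t in (1 : ℝ)..b, besselU b ν (besselRho b ν m) t ^ 2 * t) ≥
          2 / Real.pi ^ 2 * ((b - 1) / b)) ∧
      (∀ m : ℕ, 1 ≤ m →
        besselRho b 0 m ^ 2 * (∫ t in (1 : ℝ)..b, besselU b 0 (besselRho b 0 m) t ^ 2 * t) ≥
          2 / Real.pi ^ 2 *
            (1 - besselN 0 (besselRho b 0 1 * b) / besselN 0 (besselRho b 0 1)))) ∧
    -- (v)
    (∀ ν : ℝ, 0 < ν → ∀ m : ℕ, 1 ≤ m → ∀ a : ℝ,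
      IsLeast {t : ℝ | 0 < t ∧ besselU b ν (besselRho b ν m) t = 0} a →
        ∀ t : ℝ, 0 < t → t < a →
          |besselU b ν (besselRho b ν m) t| ≤ t ^ (-ν) / (Real.pi * ν)) := by
  have hb0 : 0 < b := by linarith
  refine ⟨fun ν hν => ⟨strictMonoOn_besselRho hν hb, image_besselRho hν hb⟩,
    ⟨fun ν hν m hm => lt_besselRho hν hb hm, fun ν hν => tendsto_besselRho_div hν hb⟩,
    fun ν hν m hm a ha hab h0 => ?_, fun ν hν m hm a ha hab h0 => ?_,
    ⟨fun ν hν m hm => ?_, fun m hm => ?_⟩, fun ν hν m hm a h t ht hta => ?_⟩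
  · have hρ := (besselPhase_besselRho hν hb hm).1
    refine ⟨(hasDerivAt_besselU hν hρ ha).differentiableAt, deriv_besselU_sq hν hρ ha h0, ?_⟩
    exact mul_le_of_le_one_right (by positivity) (besselN_ratio_le_one hν hρ ha hab)
  · have hρ := (besselPhase_besselRho hν hb hm).1
    refine ⟨intervalIntegrable_besselU_sq_mul hν hρ ha hb0,
      integral_besselU_sq_mul hν hρ ha hb0 h0, ?_⟩
    refine mul_le_of_le_one_right (by positivity) ?_
    linarith [besselN_ratio_pos hν hρ ha hb0]
  · have hν0 : 0 ≤ ν := by linarith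
    have hρ := (besselPhase_besselRho hν0 hb hm).1
    rw [integral_besselU_sq_mul hν0 hρ one_pos hb0 (besselU_besselRho_one hν0 hb hm), mul_one]
    refine mul_le_mul_of_nonneg_left ?_ (by positivity)
    have h1 := besselN_ratio_le_inv hν hb hρ
    rw [sub_div, div_self hb0.ne']
    linarith
  · have hρ := (besselPhase_besselRho le_rfl hb hm).1
    have hρ1 := (besselPhase_besselRho le_rfl hb le_rfl).1
    rw [integral_besselU_sq_mul le_rfl hρ one_pos hb0 (besselU_besselRho_one le_rfl hb hm),
      mul_one]
    refine mul_le_mul_of_nonneg_left (sub_le_sub_left ?_ 1) (by positivity)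
    exact besselN_zero_ratio_le hb.le hρ1
      ((strictMonoOn_besselRho le_rfl hb).monotoneOn (Set.mem_Ici.2 le_rfl) hm hm)
  · have hρ := (besselPhase_besselRho hν.le hb hm).1
    -- By the choice of ρ the point t = 1 is itself a zero, so the least zero cannot exceed 1.
    have ha : a ≤ 1 := h.2 ⟨one_pos, besselU_besselRho_one hν.le hb hm⟩
    exact abs_besselU_le hν hρ (ha.trans hb.le) ha h ht hta
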